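/- Let $d\ge 1$, $p\in\mathbb N_0$, let $\Omega\subset\mathbb R^d$ be a bounded open set (for instance a bounded Lipschitz domain), let $0<\alpha\le\beta<\infty$ and $\kappa>0$. There are constants $C_0>0$ and $C>0$, depending only on $d,p,\Omega,\alpha,\beta,\kappa$, such that the following holds for - every $H>0$ and every finite face-to-face decomposition $\mathcal T_H$ of $\Omega$ into closed axis-parallel $d$-rectangles (that is, $\bigcup_{K\in\mathcal T_H}K=\overline\Omega$, $\operatorname{int}K\subset\Omega$ for all $K$, distinct elements have disjoint interiors, and two elements that meet do so in a common face) all of whose side lengths $s$ satisfy $s\le\kappa H$ and $H\le\kappa s$; - every measurable scalar coefficient $A$ with $\alpha\le A\le\beta$ a.e. in $\Omega$. Put $a_S(u,w)=\int_{\Omega\cap S} A\nabla u\cdot\nabla w\,dx$ and $a=a_\Omega$. Let $V_H\subset L^2(\Omega)$ be the space of functions which on every $K\in\mathcal T_H$ are polynomials of degree at most $p$ in each variable, $\Pi_H$ the $L^2(\Omega)$-orthogonal projection onto $V_H$, and $W=\{w\in H^1_0(\Omega):\Pi_H w=0\}$. For $S\subset\overline\Omega$ let $W(S)$ be the set of $w\in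 W$ that vanish a.e. in $\Omega\setminus S$, let $\mathtt N(S)=\mathtt N^1(S)=\bigcup\{K\in\mathcal T_H: K\cap\overline S\ne\emptyset\}$, and $\mathtt N^{\ell}(S)=\mathtt N(\mathtt N^{\ell-1}(S))$ for $\ell\ge2$. For every $G\in\mathcal T_H$, every integer $\lambda_G\ge1$ and every $v\in L^2(\Omega)$ the problems $$\mathcal D_G^{[\lambda_G]}v\in W(\mathtt N^{\lambda_G}(G)),\quad a_{\mathtt N^{\lambda_G}(G)}\big(\mathcal D_G^{[\lambda_G]}v,w\big)=-(v,w)_{L^2(G)}\ \text{ for all } w\in W(\mathtt N^{\lambda_G}(G)),$$ $$\mathcal D_Gv\in W,\quad a(\mathcal D_Gv,w)=-(v,w)_{L^2(G)}\ \text{ for all } w\in W,$$ have unique solutions, and for all $v\in H^1_0(\Omega)$ and $w\in W$ $$a\big((\mathcal D_G^{[\lambda_G]}-\mathcal D_G)v,\,w\big)\le C_0\,H^2\,e^{-C\lambda_G}\,\|\nabla v\|_{L^2(G)}\,\|\nabla w\|_{L^2(\mathtt N^{\lambda_G+1}(G))}.$$ -/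

import Mathlib

open MeasureTheory Set

/-- Euclidean space `ℝ^d`. -/
abbrev Euc (d : ℕ) : Type := EuclideanSpace ℝ (Fin d)

noncomputable section

/-! ### The Sobolev space `H¹₀(Ω)` -/

/-- Smooth real functions with compact support contained in `Ω`. -/
def IsTestFunction {d : ℕ} (Ω : Set (Euc d)) (φ : Euc d → ℝ) : Prop :=
  ContDiff ℝ (⊤ : ℕ∞) φ ∧ HasCompactSupport φ ∧ tsupport φ ⊆ Ω

/-- `L²(Ω)` for real-valued functions. -/
abbrev L2 {d : ℕ} (Ω : Set (Euc d)) : Type := Lp ℝ 2 (volume.restrict Ω)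

/-- The Hilbert space `L²(Ω) × L²(Ω; ℝ^d)`, in which the pair `(u, ∇u)` has the `H¹`-norm of `u`. -/
abbrev L2Pair {d : ℕ} (Ω : Set (Euc d)) : Type :=
  WithLp 2 (L2 Ω × Lp (Euc d) 2 (volume.restrict Ω))

/-- The pairs `(φ, ∇φ)` for test functions `φ`. -/
def testPairs {d : ℕ} (Ω : Set (Euc d)) : Submodule ℝ (L2Pair Ω) where
  carrier := {z | ∃ φ : Euc d → ℝ, IsTestFunction Ω φ ∧
    z.fst =ᵐ[volume.restrict Ω] φ ∧ z.snd =ᵐ[volume.restrict Ω] gradient φ}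
  zero_mem' := by
    refine ⟨fun _ => 0, ⟨contDiff_const, HasCompactSupport.zero, ?_⟩, ?_, ?_⟩
    · have h : tsupport (fun _ : Euc d => (0 : ℝ)) = ∅ := by
        simp [tsupport, Function.support]
      rw [h]
      exact empty_subset _
    · exact Lp.coeFn_zero ℝ 2 (volume.restrict Ω)
    · filter_upwards [Lp.coeFn_zero (Euc d) 2 (volume.restrict Ω)] with x hx
      rw [gradient_fun_const]
      exact hx
  add_mem' := by
    rintro z z' ⟨φ, ⟨h1, h2, h3⟩, h4, h5⟩ ⟨ψ, ⟨k1, k2, k3⟩, k4, k5⟩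
    refine ⟨φ + ψ, ⟨h1.add k1, h2.add k2,
      (tsupport_add φ ψ).trans (union_subset h3 k3)⟩, ?_, ?_⟩
    · filter_upwards [Lp.coeFn_add z.fst z'.fst, h4, k4] with x hx a b
      rw [WithLp.add_fst, hx, Pi.add_apply, Pi.add_apply, a, b]
    · filter_upwards [Lp.coeFn_add z.snd z'.snd, h5, k5] with x hx a b
      rw [WithLp.add_snd, hx, Pi.add_apply, a, b, gradient, gradient, gradient,
        fderiv_add (h1.differentiable (by simp) x) (k1.differentiable (by simp) x), map_add]
  smul_mem' := by
    rintro c z ⟨φ, ⟨h1, h2, h3⟩, h4, h5⟩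
    refine ⟨c • φ, ⟨contDiff_const.smul h1, h2.smul_left,
      (closure_mono (Function.support_const_smul_subset c φ)).trans h3⟩, ?_, ?_⟩
    · filter_upwards [Lp.coeFn_smul c z.fst, h4] with x hx a
      rw [WithLp.smul_fst, hx, Pi.smul_apply, Pi.smul_apply, a]
    · filter_upwards [Lp.coeFn_smul c z.snd, h5] with x hx a
      rw [WithLp.smul_snd, hx, Pi.smul_apply, a, gradient, gradient,
        fderiv_const_smul (h1.differentiable (by simp) x), map_smul]

/-- `H¹₀(Ω)`: the closure of the test functions in the `H¹`-norm. An element `u` is stored as the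
pair of the function `fnOf u` and its weak gradient `gradOf u`. -/
def H10 {d : ℕ} (Ω : Set (Euc d)) : Submodule ℝ (L2Pair Ω) := (testPairs Ω).topologicalClosure

/-- The underlying `L²`-function of `u ∈ H¹₀(Ω)`. -/
def fnOf {d : ℕ} {Ω : Set (Euc d)} (u : H10 Ω) : L2 Ω := (u : L2Pair Ω).fst

/-- The weak gradient of `u ∈ H¹₀(Ω)`. -/
def gradOf {d : ℕ} {Ω : Set (Euc d)} (u : H10 Ω) : Lp (Euc d) 2 (volume.restrict Ω) :=
  (u : L2Pair Ω).snd

/-- `‖∇u‖_{L²(S)}` (only the part of `S` inside `Ω` counts). -/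
def gradNorm {d : ℕ} {Ω : Set (Euc d)} (S : Set (Euc d)) (u : H10 Ω) : ℝ :=
  Real.sqrt (∫ x in Ω ∩ S, ‖gradOf u x‖ ^ 2)

/-! ### Rectangular meshes, patches, piecewise polynomials -/

/-- The closed `d`-rectangle `∏ᵢ [aᵢ, bᵢ]`, `aᵢ < bᵢ`. -/
def cell {d : ℕ} (K : BoxIntegral.Box (Fin d)) : Set (Euc d) :=
  {x | ∀ i, x i ∈ Icc (K.lower i) (K.upper i)}

/-- `F` is a (closed, nonempty) face of `K`, of any dimension `0, …, d`. -/
def IsFace {d : ℕ} (K : BoxIntegral.Box (Fin d)) (F : Set (Euc d)) : Prop :=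
  ∃ s : Fin d → Set ℝ,
    (∀ i, s i = {K.lower i} ∨ s i = {K.upper i} ∨ s i = Icc (K.lower i) (K.upper i)) ∧
    F = {x | ∀ i, x i ∈ s i}

/-- `T` is a regular (face-to-face) decomposition of `Ω` into `d`-rectangles, all of whose side
lengths agree with the mesh size `H` up to the factor `κ` (shape regularity and
quasi-uniformity with the mesh constant `κ`). -/
structure IsRectMesh {d : ℕ} (Ω : Set (Euc d)) (H κ : ℝ)
    (T : Finset (BoxIntegral.Box (Fin d))) : Prop where
  covers : ⋃ K ∈ T, cell K = closure Ω
  interior_subset : ∀ K ∈ T, interior (cell K) ⊆ Ω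
  disjoint : ∀ K ∈ T, ∀ L ∈ T, K ≠ L → Disjoint (interior (cell K)) (interior (cell L))
  conforming : ∀ K ∈ T, ∀ L ∈ T, (cell K ∩ cell L).Nonempty →
    IsFace K (cell K ∩ cell L) ∧ IsFace L (cell K ∩ cell L)
  side_le : ∀ K ∈ T, ∀ i, K.upper i - K.lower i ≤ κ * H
  le_side : ∀ K ∈ T, ∀ i, H ≤ κ * (K.upper i - K.lower i)

/-- The one-layer patch `N(S)`: the union of all elements that touch `S`. -/
def patchOne {d : ℕ} (T : Finset (BoxIntegral.Box (Fin d))) (S : Set (Euc d)) : Set (Euc d) :=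
  ⋃ K ∈ T, ⋃ _ : (closure S ∩ cell K).Nonempty, cell K

/-- The patch `N^l(S)` of order `l`. -/
def patch {d : ℕ} (T : Finset (BoxIntegral.Box (Fin d))) (l : ℕ) (S : Set (Euc d)) :
    Set (Euc d) :=
  (patchOne T)^[l] S

/-- The space `V_H` of functions in `L²(Ω)` that coincide on every element with a polynomial of
degree at most `p` in each variable. -/
def polySpace {d : ℕ} (Ω : Set (Euc d)) (T : Finset (BoxIntegral.Box (Fin d))) (p : ℕ) :
    Submodule ℝ (L2 Ω) where
  carrier := {v | ∀ K ∈ T, ∃ q ∈ MvPolynomial.restrictDegree (Fin d) ℝ p,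
    ∀ᵐ x ∂(volume.restrict Ω), x ∈ cell K → v x = MvPolynomial.eval (fun i => x i) q}
  zero_mem' := by
    intro K _
    refine ⟨0, Submodule.zero_mem _, ?_⟩
    filter_upwards [Lp.coeFn_zero ℝ 2 (volume.restrict Ω)] with x hx _
    simpa using hx
  add_mem' := by
    intro v w hv hw K hK
    obtain ⟨q, hq, h1⟩ := hv K hK
    obtain ⟨r, hr, h2⟩ := hw K hK
    refine ⟨q + r, Submodule.add_mem _ hq hr, ?_⟩
    filter_upwards [Lp.coeFn_add v w, h1, h2] with x hx a b hxK
    rw [hx, Pi.add_apply, a hxK, b hxK, map_add]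
  smul_mem' := by
    intro c v hv K hK
    obtain ⟨q, hq, h1⟩ := hv K hK
    refine ⟨c • q, Submodule.smul_mem _ c hq, ?_⟩
    filter_upwards [Lp.coeFn_smul c v, h1] with x hx a hxK
    rw [hx, Pi.smul_apply, a hxK, MvPolynomial.smul_eval, smul_eq_mul]

/-- The fine-scale space `W`: the functions in `H¹₀(Ω)` whose `L²`-orthogonal projection onto `V_H`
vanishes, that is, which lie in the `L²`-orthogonal complement of `V_H`. -/
def fineSpace {d : ℕ} (Ω : Set (Euc d)) (T : Finset (BoxIntegral.Box (Fin d))) (p : ℕ) :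
    Set (H10 Ω) :=
  {w | fnOf w ∈ (polySpace Ω T p)ᗮ}

/-- `W(S)`: the functions in `W` with support in `S`. -/
def fineSpaceOn {d : ℕ} (Ω : Set (Euc d)) (T : Finset (BoxIntegral.Box (Fin d))) (p : ℕ)
    (S : Set (Euc d)) : Set (H10 Ω) :=
  {w | w ∈ fineSpace Ω T p ∧ ∀ᵐ x ∂(volume.restrict Ω), x ∉ S → fnOf w x = 0}

/-! ### The bilinear form and the element-wise enriched corrections -/

/-- `A ∈ L^∞(Ω)` is a scalar coefficient with `α ≤ A ≤ β` almost everywhere. -/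
def IsCoefficient {d : ℕ} (Ω : Set (Euc d)) (α β : ℝ) (A : Euc d → ℝ) : Prop :=
  AEStronglyMeasurable A (volume.restrict Ω) ∧ ∀ᵐ x ∂(volume.restrict Ω), α ≤ A x ∧ A x ≤ β

/-- `a_S(u, w) = (A ∇u, ∇w)_{L²(S)}`; the full form `a` is `energyOn A Ω`. -/
def energyOn {d : ℕ} {Ω : Set (Euc d)} (A : Euc d → ℝ) (S : Set (Euc d)) (u w : H10 Ω) : ℝ :=
  ∫ x in Ω ∩ S, A x * inner ℝ (gradOf u x) (gradOf w x)

/-- `u` solves the element-wise enriched correction problem on the patch `S` for the element `G`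
and the datum `v ∈ L²(Ω)`: `u ∈ W(S)` and `a_S(u, w) = -(v, w)_{L²(G)}` for all `w ∈ W(S)`. -/
def IsEnrichedCorrection {d : ℕ} {Ω : Set (Euc d)} (T : Finset (BoxIntegral.Box (Fin d))) (p : ℕ)
    (A : Euc d → ℝ) (S : Set (Euc d)) (G : BoxIntegral.Box (Fin d)) (v : L2 Ω) (u : H10 Ω) :
    Prop :=
  u ∈ fineSpaceOn Ω T p S ∧
    ∀ w ∈ fineSpaceOn Ω T p S, energyOn A S u w = -∫ x in Ω ∩ cell G, v x * fnOf w x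

/-- The solution of the element-wise enriched correction problem on `S`. -/
def enrichedCorrectionOn {d : ℕ} {Ω : Set (Euc d)} (T : Finset (BoxIntegral.Box (Fin d))) (p : ℕ)
    (A : Euc d → ℝ) (S : Set (Euc d)) (G : BoxIntegral.Box (Fin d)) (v : L2 Ω) : H10 Ω :=
  Classical.epsilon (IsEnrichedCorrection T p A S G v)

/-- The localized element-wise enriched correction operator `D_G^{[l]}`. -/
def locCorrection {d : ℕ} {Ω : Set (Euc d)} (T : Finset (BoxIntegral.Box (Fin d))) (p : ℕ)
    (A : Euc d → ℝ) (l : ℕ) (G : BoxIntegral.Box (Fin d)) (v : L2 Ω) : H10 Ω :=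
  enrichedCorrectionOn T p A (patch T l (cell G)) G v

/-- The global element-wise enriched correction operator `D_G = D_G^{[∞]}`. -/
def globCorrection {d : ℕ} {Ω : Set (Euc d)} (T : Finset (BoxIntegral.Box (Fin d))) (p : ℕ)
    (A : Euc d → ℝ) (G : BoxIntegral.Box (Fin d)) (v : L2 Ω) : H10 Ω :=
  enrichedCorrectionOn T p A Ω G v

end

/-! Functions in `W` have mean zero on every cell, so the Poincaré inequality holds on `W` cell by
cell, with a constant of order `H` and without boundary conditions. This gives coercivity, hence
unique solvability by Lax–Milgram. It also bounds the load `(v, w)` on `G` by `H²‖∇v‖‖∇w‖`: the mean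
of `v` on `G` may be subtracted, and then each factor contributes one power of `H`.

Locality comes from a cut-off that stays inside `W` (`exists_hasFineCutoff`). Multiplying `w` by a
smooth `θ` with `|∇θ| ≲ 1/H` destroys the orthogonality to `V_H`. It is restored by subtracting in
each cell a smooth bubble with the same moments as `θw` (`exists_bubble`, `exists_correction`). On
cells where `θ` is identically 0 or 1 these moments vanish and nothing is subtracted. The factor
`1/H` is absorbed by Poincaré, so the cut-off is stable on each cell separately.

Decay (`sum_energy_sdiff_layer_le`): the equation of the localized correction `u` is tested with `u`
cut off so as to vanish on the patch of order `k`. The load disappears. Beyond the patch of order `k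
+ 1` the form is at least `α` times the energy, and on the ring in between it is at least `-β√C`
times the energy. Filling the hole shows that the energy outside the patch shrinks by the factor `ρ
= β√C / (β√C + α) < 1` per layer.

Error (`defect_le`): by the global equation, the error tested with `w` is the defect `a(u, w) + (v,
w)` on `G`. If `w'` is `w` cut off at order `l - 1`, then `w - w'` is admissible for the local
problem, so the defect equals `a(u, w')`. Since `w'` vanishes on the patch of order `l - 1` and `u`
outside that of order `l`, only the outermost ring contributes, and there `u` is exponentially
small. Decay of the global correction is not needed. -/

noncomputable section

/-! ### Cells and meshes -/

open scoped ENNReal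

variable {d : ℕ}

/-- The open `d`-rectangle `∏ᵢ (aᵢ, bᵢ)`. -/
def openCell (K : BoxIntegral.Box (Fin d)) : Set (Euc d) :=
  {x | ∀ i, x i ∈ Ioo (K.lower i) (K.upper i)}

theorem cell_eq_preimage (K : BoxIntegral.Box (Fin d)) :
    cell K = EuclideanSpace.equiv (Fin d) ℝ ⁻¹' (univ.pi fun i => Icc (K.lower i) (K.upper i)) := by
  ext x; simp only [cell, Set.mem_preimage, Set.mem_pi, Set.mem_univ, true_imp_iff]; rfl

theorem openCell_eq_preimage (K : BoxIntegral.Box (Fin d)) :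
    openCell K =
      EuclideanSpace.equiv (Fin d) ℝ ⁻¹' (univ.pi fun i => Ioo (K.lower i) (K.upper i)) := by
  ext x; simp only [openCell, Set.mem_preimage, Set.mem_pi, Set.mem_univ, true_imp_iff]; rfl

theorem isClosed_cell (K : BoxIntegral.Box (Fin d)) : IsClosed (cell K) := by
  rw [cell_eq_preimage]
  exact (isClosed_set_pi fun i _ => isClosed_Icc).preimage
    (EuclideanSpace.equiv (Fin d) ℝ).continuous

theorem isOpen_openCell (K : BoxIntegral.Box (Fin d)) : IsOpen (openCell K) := by
  rw [openCell_eq_preimage]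
  exact (isOpen_set_pi finite_univ fun i _ => isOpen_Ioo).preimage
    (EuclideanSpace.equiv (Fin d) ℝ).continuous

theorem measurableSet_openCell (K : BoxIntegral.Box (Fin d)) : MeasurableSet (openCell K) :=
  (isOpen_openCell K).measurableSet

theorem openCell_subset_cell (K : BoxIntegral.Box (Fin d)) : openCell K ⊆ cell K :=
  fun _ hx i => Ioo_subset_Icc_self (hx i)

theorem interior_cell (K : BoxIntegral.Box (Fin d)) : interior (cell K) = openCell K := by
  rw [cell_eq_preimage, openCell_eq_preimage]
  have := (EuclideanSpace.equiv (Fin d) ℝ).toHomeomorph.preimage_interior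
    (univ.pi fun i => Icc (K.lower i) (K.upper i))
  rw [interior_pi_set finite_univ] at this
  simp only [interior_Icc] at this
  exact this.symm

theorem volume_euc_preimage (s : Set (Fin d → ℝ)) :
    volume (EuclideanSpace.equiv (Fin d) ℝ ⁻¹' s) = volume s :=
  (PiLp.volume_preserving_ofLp (Fin d)).measure_preimage_equiv
    (f := (MeasurableEquiv.toLp 2 (Fin d → ℝ)).symm) s

theorem volume_openCell (K : BoxIntegral.Box (Fin d)) :
    volume (openCell K) = ENNReal.ofReal (∏ i, (K.upper i - K.lower i)) := by
  rw [openCell_eq_preimage, volume_euc_preimage, Real.volume_pi_Ioo,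
    ENNReal.ofReal_prod_of_nonneg fun i _ => (sub_nonneg.2 (K.lower_lt_upper i).le)]

theorem cell_eq_preimage_Icc (K : BoxIntegral.Box (Fin d)) :
    cell K = EuclideanSpace.equiv (Fin d) ℝ ⁻¹' Icc K.lower K.upper := by
  rw [cell_eq_preimage, pi_univ_Icc]

theorem volume_cell (K : BoxIntegral.Box (Fin d)) :
    volume (cell K) = ENNReal.ofReal (∏ i, (K.upper i - K.lower i)) := by
  rw [cell_eq_preimage_Icc, volume_euc_preimage, Real.volume_Icc_pi,
    ENNReal.ofReal_prod_of_nonneg fun i _ => (sub_nonneg.2 (K.lower_lt_upper i).le)]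

theorem volume_openCell_ne_top (K : BoxIntegral.Box (Fin d)) : volume (openCell K) ≠ ∞ := by
  rw [volume_openCell]; exact ENNReal.ofReal_ne_top

/-- Both boxes have the same finite volume, so faces are null sets. Integrals can therefore be taken
over open cells, which are disjoint and lie inside `Ω`, whereas closed cells overlap and may reach
the boundary of `Ω`. -/
theorem openCell_ae_eq_cell (K : BoxIntegral.Box (Fin d)) : openCell K =ᵐ[volume] cell K :=
  ae_eq_of_subset_of_measure_ge (openCell_subset_cell K) (by rw [volume_cell, volume_openCell])
    (measurableSet_openCell K).nullMeasurableSet (by rw [volume_cell]; exact ENNReal.ofReal_ne_top)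

theorem prod_side_pos (K : BoxIntegral.Box (Fin d)) : 0 < ∏ i, (K.upper i - K.lower i) :=
  Finset.prod_pos fun i _ => sub_pos.2 (K.lower_lt_upper i)

theorem cell_nonempty (K : BoxIntegral.Box (Fin d)) : (cell K).Nonempty :=
  ⟨WithLp.toLp 2 K.lower, fun i => ⟨le_rfl, (K.lower_lt_upper i).le⟩⟩

namespace IsRectMesh

variable {Ω : Set (Euc d)} {H κ : ℝ} {T : Finset (BoxIntegral.Box (Fin d))}

theorem openCell_subset (hT : IsRectMesh Ω H κ T) {K : BoxIntegral.Box (Fin d)} (hK : K ∈ T) :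
    openCell K ⊆ Ω := by
  rw [← interior_cell]; exact hT.interior_subset K hK

theorem pairwiseDisjoint_openCell (hT : IsRectMesh Ω H κ T) :
    (T : Set (BoxIntegral.Box (Fin d))).PairwiseDisjoint openCell := by
  intro K hK L hL h
  have := hT.disjoint K hK L hL h
  rwa [interior_cell, interior_cell] at this

theorem eq_of_mem_openCell (hT : IsRectMesh Ω H κ T) {K L : BoxIntegral.Box (Fin d)} (hK : K ∈ T)
    (hL : L ∈ T) {x : Euc d} (h : x ∈ openCell K) (h' : x ∈ openCell L) : K = L := by
  by_contra hne
  exact Set.disjoint_left.1 (hT.pairwiseDisjoint_openCell hK hL hne) h h'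

theorem exists_cell (hT : IsRectMesh Ω H κ T) {x : Euc d} (hx : x ∈ Ω) : ∃ K ∈ T, x ∈ cell K := by
  have h := subset_closure hx
  rw [← hT.covers] at h
  simpa using h

theorem inter_biUnion_ae_eq (hT : IsRectMesh Ω H κ T) {S : Finset (BoxIntegral.Box (Fin d))}
    (hS : S ⊆ T) : (Ω ∩ ⋃ K ∈ S, cell K : Set (Euc d)) =ᵐ[volume] ⋃ K ∈ S, openCell K := by
  have h1 : ∀ᵐ x ∂(volume : Measure (Euc d)), ∀ K ∈ S, x ∈ cell K → x ∈ openCell K := by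
    rw [Filter.eventually_all_finset]
    intro K _
    filter_upwards [openCell_ae_eq_cell K] with x hx h
    exact (eq_iff_iff.1 hx).2 h
  filter_upwards [h1] with x hx
  refine eq_iff_iff.2 ⟨fun h => ?_, fun h => ?_⟩
  · obtain ⟨_, h⟩ := h
    obtain ⟨K, hK, h⟩ := mem_iUnion₂.1 h
    exact mem_iUnion₂.2 ⟨K, hK, hx K hK h⟩
  · obtain ⟨K, hK, h⟩ := mem_iUnion₂.1 h
    exact ⟨hT.openCell_subset (hS hK) h, mem_iUnion₂.2 ⟨K, hK, openCell_subset_cell K h⟩⟩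

theorem ae_eq_biUnion (hT : IsRectMesh Ω H κ T) : Ω =ᵐ[volume] ⋃ K ∈ T, openCell K := by
  have h := hT.inter_biUnion_ae_eq Finset.Subset.rfl
  rwa [hT.covers, inter_eq_left.2 subset_closure] at h

theorem ae_mem_openCell_of_mem_cell (K : BoxIntegral.Box (Fin d)) :
    ∀ᵐ x ∂(volume : Measure (Euc d)).restrict Ω, x ∈ cell K → x ∈ openCell K := by
  refine ae_restrict_of_ae ?_
  filter_upwards [openCell_ae_eq_cell K] with x hx h
  exact (eq_iff_iff.1 hx).2 h

theorem restrict_le (hT : IsRectMesh Ω H κ T) {K : BoxIntegral.Box (Fin d)} (hK : K ∈ T) :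
    (volume : Measure (Euc d)).restrict (openCell K) ≤ volume.restrict Ω :=
  Measure.restrict_mono (hT.openCell_subset hK) le_rfl

theorem ae_openCell (hT : IsRectMesh Ω H κ T) {K : BoxIntegral.Box (Fin d)} (hK : K ∈ T)
    {q : Euc d → Prop} (h : ∀ᵐ x ∂(volume : Measure (Euc d)).restrict Ω, q x) :
    ∀ᵐ x ∂(volume : Measure (Euc d)).restrict (openCell K), q x :=
  ae_restrict_of_ae_restrict_of_subset (hT.openCell_subset hK) h

/-- A property that holds almost everywhere on every cell holds almost everywhere. -/
theorem ae_of_forall_cell (hT : IsRectMesh Ω H κ T) {q : Euc d → Prop}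
    (h : ∀ K ∈ T, ∀ᵐ x ∂(volume : Measure (Euc d)).restrict (openCell K), q x) :
    ∀ᵐ x ∂(volume : Measure (Euc d)).restrict Ω, q x := by
  rw [Measure.restrict_congr_set hT.ae_eq_biUnion, ae_restrict_biUnion_finset_iff]
  exact h

theorem setIntegral_biUnion (hT : IsRectMesh Ω H κ T) {S : Finset (BoxIntegral.Box (Fin d))}
    (hS : S ⊆ T) {g : Euc d → ℝ} (hg : IntegrableOn g Ω) :
    ∫ x in Ω ∩ ⋃ K ∈ S, cell K, g x = ∑ K ∈ S, ∫ x in openCell K, g x := by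
  rw [setIntegral_congr_set (hT.inter_biUnion_ae_eq hS)]
  exact integral_biUnion_finset S (fun K _ => measurableSet_openCell K)
    (hT.pairwiseDisjoint_openCell.subset (by exact_mod_cast hS))
    fun K hK => hg.mono_set (hT.openCell_subset (hS hK))

theorem setIntegral_eq_sum (hT : IsRectMesh Ω H κ T) {g : Euc d → ℝ} (hg : IntegrableOn g Ω) :
    ∫ x in Ω, g x = ∑ K ∈ T, ∫ x in openCell K, g x := by
  rw [← hT.setIntegral_biUnion Finset.Subset.rfl hg, hT.covers, inter_eq_left.2 subset_closure]

/-- Packing: the open cells are disjoint, each has volume at least `(H / κ) ^ d`, and all lie in a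
cube of side `2 * R`. -/
theorem card_mul_le (hT : IsRectMesh Ω H κ T) (hH : 0 < H) (hκ : 0 < κ)
    {S : Finset (BoxIntegral.Box (Fin d))} (hS : S ⊆ T) (x : Euc d) {R : ℝ}
    (hR : ∀ K ∈ S, ∀ y ∈ openCell K, ∀ i, |y i - x i| ≤ R) (hR0 : 0 ≤ R) :
    S.card * (H / κ) ^ d ≤ (2 * R) ^ d := by
  have h1 : ∑ K ∈ S, volume (openCell K) ≤ ENNReal.ofReal ((2 * R) ^ d) := by
    rw [← measure_biUnion_finset (hT.pairwiseDisjoint_openCell.subset (by exact_mod_cast hS))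
      fun K _ => measurableSet_openCell K]
    calc volume (⋃ K ∈ S, openCell K) ≤ volume (EuclideanSpace.equiv (Fin d) ℝ ⁻¹'
          Icc (fun i => x i - R) (fun i => x i + R)) := by
          refine measure_mono fun y hy => ?_
          obtain ⟨K, hK, hy⟩ := mem_iUnion₂.1 hy
          have := fun i => abs_le.1 (hR K hK y hy i)
          refine ⟨fun i => ?_, fun i => ?_⟩
          · have := (this i).1
            change x i - R ≤ y i
            linarith
          · have := (this i).2
            change y i ≤ x i + R
            linarith
      _ = _ := by
          rw [volume_euc_preimage, Real.volume_Icc_pi, ENNReal.ofReal_pow (by positivity)]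
          simp only [add_sub_sub_cancel, Finset.prod_const, Finset.card_univ, Fintype.card_fin]
          rw [two_mul]
  have h2 : ∀ K ∈ S, ENNReal.ofReal ((H / κ) ^ d) ≤ volume (openCell K) := by
    intro K hK
    rw [volume_openCell]
    refine ENNReal.ofReal_le_ofReal ?_
    calc (H / κ) ^ d = ∏ _i : Fin d, H / κ := by rw [Finset.prod_const, Finset.card_univ, Fintype.card_fin]
      _ ≤ _ := Finset.prod_le_prod (fun i _ => by positivity) fun i _ =>
        (div_le_iff₀' hκ).2 (hT.le_side K (hS hK) i)
  have h3 := (Finset.card_nsmul_le_sum S _ _ h2).trans h1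
  rw [nsmul_eq_mul, ← ENNReal.ofReal_natCast, ← ENNReal.ofReal_mul (by positivity)] at h3
  exact (ENNReal.ofReal_le_ofReal_iff (by positivity)).1 h3

end IsRectMesh

end

noncomputable section

/-! ### Cutoff functions -/

open scoped ENNReal

variable {d : ℕ}

/-- The derivative is continuous and vanishes outside `[0, 1]`, where the function is constant on
either side. -/
theorem exists_bound_deriv_smoothTransition :
    ∃ M : ℝ, 0 ≤ M ∧ ∀ t, ‖deriv Real.smoothTransition t‖ ≤ M := by
  have hc : Continuous (deriv Real.smoothTransition) :=
    (Real.smoothTransition.contDiff (n := 1)).continuous_deriv le_rfl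
  have hs : HasCompactSupport (deriv Real.smoothTransition) := by
    refine HasCompactSupport.intro (isCompact_Icc (a := (0 : ℝ)) (b := 1)) fun t ht => ?_
    rcases lt_or_ge t 0 with h | h
    · have : Real.smoothTransition =ᶠ[nhds t] fun _ => 0 := by
        filter_upwards [Iio_mem_nhds h] with s hs
        exact Real.smoothTransition.zero_of_nonpos (le_of_lt hs)
      rw [this.deriv_eq, deriv_const]
    · have h1 : 1 < t := by
        by_contra h'
        exact ht ⟨h, not_lt.1 h'⟩
      have : Real.smoothTransition =ᶠ[nhds t] fun _ => 1 := by
        filter_upwards [Ioi_mem_nhds h1] with s hs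
        exact Real.smoothTransition.one_of_one_le (le_of_lt hs)
      rw [this.deriv_eq, deriv_const]
  obtain ⟨M, hM⟩ := hs.exists_bound_of_continuous hc
  exact ⟨M, (norm_nonneg _).trans (hM 0), hM⟩

/-- Product rule, with every undifferentiated factor at most 1 in absolute value. The point is
fixed, so a factor that is locally constant there may be given the bound `C i = 0`. -/
theorem norm_fderiv_prod_le {E ι : Type*} [NormedAddCommGroup E] [NormedSpace ℝ E] (s : Finset ι)
    (f : ι → E → ℝ) (C : ι → ℝ) (x : E) (hd : ∀ i ∈ s, DifferentiableAt ℝ (f i) x)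
    (h1 : ∀ i ∈ s, |f i x| ≤ 1) (hC : ∀ i ∈ s, ‖fderiv ℝ (f i) x‖ ≤ C i) :
    ‖fderiv ℝ (fun y => ∏ i ∈ s, f i y) x‖ ≤ ∑ i ∈ s, C i := by
  classical
  induction s using Finset.induction_on with
  | empty => simp
  | insert i s hi ih =>
    have hs := ih (fun j hj => hd j (Finset.mem_insert_of_mem hj))
      (fun j hj => h1 j (Finset.mem_insert_of_mem hj))
      (fun j hj => hC j (Finset.mem_insert_of_mem hj))
    simp only [Finset.prod_insert hi, Finset.sum_insert hi]
    have hdi := hd i (Finset.mem_insert_self i s)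
    have hds : DifferentiableAt ℝ (fun y => ∏ j ∈ s, f j y) x :=
      (HasFDerivAt.finsetProd fun j hj =>
        (hd j (Finset.mem_insert_of_mem hj)).hasFDerivAt).differentiableAt
    rw [fderiv_fun_mul hdi hds]
    have hp : |∏ j ∈ s, f j x| ≤ 1 := by
      rw [Finset.abs_prod]
      exact Finset.prod_le_one (fun j _ => abs_nonneg _)
        fun j hj => h1 j (Finset.mem_insert_of_mem hj)
    calc _ ≤ ‖f i x • fderiv ℝ (fun y => ∏ j ∈ s, f j y) x‖
          + ‖(∏ j ∈ s, f j x) • fderiv ℝ (f i) x‖ := norm_add_le _ _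
      _ ≤ 1 * (∑ j ∈ s, C j) + 1 * C i := by
        rw [norm_smul, norm_smul]
        gcongr
        · exact h1 i (Finset.mem_insert_self i s)
        · exact hp
        · exact hC i (Finset.mem_insert_self i s)
      _ = _ := by ring

/-- A smooth function of one variable that is `1` on `[a, b]` and `0` at distance `≥ 1/c`. -/
def plateau (c a b t : ℝ) : ℝ :=
  Real.smoothTransition (1 + c * (t - a)) * Real.smoothTransition (1 + c * (b - t))

theorem plateau_nonneg (c a b t : ℝ) : 0 ≤ plateau c a b t :=
  mul_nonneg (Real.smoothTransition.nonneg _) (Real.smoothTransition.nonneg _)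

theorem plateau_le_one (c a b t : ℝ) : plateau c a b t ≤ 1 :=
  mul_le_one₀ (Real.smoothTransition.le_one _) (Real.smoothTransition.nonneg _)
    (Real.smoothTransition.le_one _)

theorem plateau_eq_one {c a b t : ℝ} (hc : 0 ≤ c) (h : t ∈ Icc a b) : plateau c a b t = 1 := by
  have h1 := mul_nonneg hc (sub_nonneg.2 h.1)
  have h2 := mul_nonneg hc (sub_nonneg.2 h.2)
  rw [plateau, Real.smoothTransition.one_of_one_le (by linarith),
    Real.smoothTransition.one_of_one_le (by linarith), mul_one]

theorem plateau_eq_zero {c a b t : ℝ} (h : 1 ≤ c * (a - t) ∨ 1 ≤ c * (t - b)) :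
    plateau c a b t = 0 := by
  rcases h with h | h
  · rw [plateau, Real.smoothTransition.zero_of_nonpos (by nlinarith), zero_mul]
  · rw [plateau, mul_comm, Real.smoothTransition.zero_of_nonpos (by nlinarith), zero_mul]

theorem contDiff_plateau (c a b : ℝ) {n : ℕ∞} : ContDiff ℝ n (plateau c a b) := by
  unfold plateau
  exact (Real.smoothTransition.contDiff.comp (by fun_prop)).mul
    (Real.smoothTransition.contDiff.comp (by fun_prop))

theorem norm_deriv_plateau_le {M : ℝ} (hM : ∀ t, ‖deriv Real.smoothTransition t‖ ≤ M) {c : ℝ}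
    (hc : 0 ≤ c) (a b t : ℝ) : ‖deriv (plateau c a b) t‖ ≤ 2 * M * c := by
  have hd : ∀ s, HasDerivAt Real.smoothTransition (deriv Real.smoothTransition s) s := fun s =>
    ((Real.smoothTransition.contDiff (n := 1)).differentiable (by simp) s).hasDerivAt
  have h1 : HasDerivAt (fun t => Real.smoothTransition (1 + c * (t - a)))
      (deriv Real.smoothTransition (1 + c * (t - a)) * c) t := by
    refine (hd _).comp t ?_
    simpa using (((hasDerivAt_id t).sub_const a).const_mul c).const_add 1
  have h2 : HasDerivAt (fun t => Real.smoothTransition (1 + c * (b - t)))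
      (deriv Real.smoothTransition (1 + c * (b - t)) * -c) t := by
    refine (hd _).comp t ?_
    simpa using (((hasDerivAt_id t).const_sub b).const_mul c).const_add 1
  have h3 : deriv (plateau c a b) t = _ := (h1.mul h2).deriv
  rw [h3]
  have hM0 : 0 ≤ M := (norm_nonneg _).trans (hM 0)
  have e1 : ∀ s, ‖Real.smoothTransition s‖ ≤ 1 := fun s => by
    rw [Real.norm_of_nonneg (Real.smoothTransition.nonneg s)]; exact Real.smoothTransition.le_one s
  have hc' : ‖c‖ = c := Real.norm_of_nonneg hc
  refine (norm_add_le _ _).trans ?_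
  simp only [norm_mul, norm_neg, hc']
  calc _ ≤ M * c * 1 + 1 * (M * c) := by
        gcongr
        · exact hM _
        · exact e1 _
        · exact e1 _
        · exact hM _
    _ = _ := by ring

/-- A smooth function on `ℝ^d` that is `1` on `K` and `0` at distance `≥ 1/c` in the sup-norm. -/
def boxPlateau (c : ℝ) (K : BoxIntegral.Box (Fin d)) (x : Euc d) : ℝ :=
  ∏ i, plateau c (K.lower i) (K.upper i) (x i)

theorem boxPlateau_nonneg (c : ℝ) (K : BoxIntegral.Box (Fin d)) (x : Euc d) :
    0 ≤ boxPlateau c K x :=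
  Finset.prod_nonneg fun _ _ => plateau_nonneg _ _ _ _

theorem boxPlateau_le_one (c : ℝ) (K : BoxIntegral.Box (Fin d)) (x : Euc d) :
    boxPlateau c K x ≤ 1 :=
  Finset.prod_le_one (fun _ _ => plateau_nonneg _ _ _ _) fun _ _ => plateau_le_one _ _ _ _

theorem boxPlateau_eq_one {c : ℝ} (hc : 0 ≤ c) {K : BoxIntegral.Box (Fin d)} {x : Euc d}
    (hx : x ∈ cell K) : boxPlateau c K x = 1 :=
  Finset.prod_eq_one fun i _ => plateau_eq_one hc (hx i)

theorem boxPlateau_eq_zero {c : ℝ} {K : BoxIntegral.Box (Fin d)} {x : Euc d} {i : Fin d}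
    (h : 1 ≤ c * (K.lower i - x i) ∨ 1 ≤ c * (x i - K.upper i)) : boxPlateau c K x = 0 :=
  Finset.prod_eq_zero (Finset.mem_univ i) (plateau_eq_zero h)

theorem contDiff_boxPlateau (c : ℝ) (K : BoxIntegral.Box (Fin d)) {n : ℕ∞} :
    ContDiff ℝ n (boxPlateau c K) :=
  contDiff_prod fun _ _ => (contDiff_plateau _ _ _).comp (by fun_prop)

theorem norm_proj_le (i : Fin d) :
    ‖(EuclideanSpace.proj i : Euc d →L[ℝ] ℝ)‖ ≤ 1 :=
  ContinuousLinearMap.opNorm_le_bound _ zero_le_one fun x => by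
    rw [one_mul]; exact PiLp.norm_apply_le x i

theorem norm_fderiv_comp_coord_le {f : ℝ → ℝ} (hf : Differentiable ℝ f) (i : Fin d) (x : Euc d) :
    ‖fderiv ℝ (fun y : Euc d => f (y i)) x‖ ≤ ‖deriv f (x i)‖ := by
  have h : HasFDerivAt (fun y : Euc d => f (y i))
      (deriv f (x i) • (EuclideanSpace.proj i : Euc d →L[ℝ] ℝ)) x :=
    (hf (x i)).hasDerivAt.comp_hasFDerivAt x (EuclideanSpace.proj i : Euc d →L[ℝ] ℝ).hasFDerivAt
  rw [h.fderiv, norm_smul]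
  exact mul_le_of_le_one_right (norm_nonneg _) (norm_proj_le i)

theorem norm_fderiv_boxPlateau_le {M : ℝ} (hM : ∀ t, ‖deriv Real.smoothTransition t‖ ≤ M) {c : ℝ}
    (hc : 0 ≤ c) (K : BoxIntegral.Box (Fin d)) (x : Euc d) :
    ‖fderiv ℝ (boxPlateau c K) x‖ ≤ d * (2 * M * c) := by
  have hdiff : ∀ a b, Differentiable ℝ (plateau c a b) := fun a b =>
    (contDiff_plateau c a b (n := 1)).differentiable (by simp)
  refine (norm_fderiv_prod_le Finset.univ
    (fun i (y : Euc d) => plateau c (K.lower i) (K.upper i) (y i)) (fun _ => 2 * M * c) x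
    (fun i _ => ?_) (fun i _ => ?_) fun i _ => ?_).trans ?_
  · exact (hdiff _ _ (x i)).comp x (EuclideanSpace.proj i : Euc d →L[ℝ] ℝ).differentiableAt
  · rw [abs_of_nonneg (plateau_nonneg _ _ _ _)]; exact plateau_le_one _ _ _ _
  · exact (norm_fderiv_comp_coord_le (hdiff _ _) i x).trans (norm_deriv_plateau_le hM hc _ _ _)
  · simp

/-! ### Touching elements of a face-to-face mesh -/

theorem mem_patchOne {T : Finset (BoxIntegral.Box (Fin d))} {S : Set (Euc d)} {x : Euc d} :
    x ∈ patchOne T S ↔ ∃ K ∈ T, (closure S ∩ cell K).Nonempty ∧ x ∈ cell K := by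
  simp [patchOne, and_left_comm]

theorem mem_patchOne_cell {T : Finset (BoxIntegral.Box (Fin d))} {K : BoxIntegral.Box (Fin d)}
    {x : Euc d} :
    x ∈ patchOne T (cell K) ↔ ∃ M ∈ T, (cell K ∩ cell M).Nonempty ∧ x ∈ cell M := by
  rw [mem_patchOne, (isClosed_cell K).closure_eq]

theorem isClosed_patchOne (T : Finset (BoxIntegral.Box (Fin d))) (S : Set (Euc d)) :
    IsClosed (patchOne T S) :=
  T.finite_toSet.isClosed_biUnion fun K _ => isClosed_iUnion_of_finite fun _ => isClosed_cell K

/-- If the intersection of two boxes is a face of `M` that is `{a}` in direction `i`, then `a` is an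
endpoint of the other box in this direction. -/
theorem cell_face_endpoint {K M : BoxIntegral.Box (Fin d)} (h : (cell K ∩ cell M).Nonempty)
    {s : Fin d → Set ℝ} (hs : cell K ∩ cell M = {x | ∀ i, x i ∈ s i}) {i : Fin d} :
    (s i = {M.lower i} → K.upper i ≤ M.lower i) ∧ (s i = {M.upper i} → M.upper i ≤ K.lower i) := by
  obtain ⟨y, hyK, hyM⟩ := h
  -- In a common point of the two boxes, the coordinate `i` can be replaced by any value common to
  -- both side intervals without leaving the intersection.
  have key : ∀ t, t ∈ Icc (K.lower i) (K.upper i) → t ∈ Icc (M.lower i) (M.upper i) → t ∈ s i := by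
    intro t htK htM
    have hz : (WithLp.toLp 2 (Function.update y i t) : Euc d) ∈ cell K ∩ cell M := by
      refine ⟨fun j => ?_, fun j => ?_⟩ <;> by_cases hj : j = i
      · subst hj; simpa using htK
      · simpa [hj] using hyK j
      · subst hj; simpa using htM
      · simpa [hj] using hyM j
    rw [hs] at hz
    simpa using hz i
  have hK := hyK i
  have hM := hyM i
  refine ⟨fun hsi => ?_, fun hsi => ?_⟩
  -- The right end of the overlap of the two intervals must be the single point `M.lower i`. It
  -- cannot be `M.upper i`, hence it is `K.upper i`.
  · have := key (min (K.upper i) (M.upper i))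
      ⟨le_min (K.lower_lt_upper i).le (hK.1.trans hM.2), min_le_left _ _⟩
      ⟨le_min (hM.1.trans hK.2) (M.lower_lt_upper i).le, min_le_right _ _⟩
    rw [hsi, mem_singleton_iff] at this
    rcases min_choice (K.upper i) (M.upper i) with h | h
    · exact (h.symm.trans this).le
    · exact absurd (h.symm.trans this) (M.lower_lt_upper i).ne'
  · have := key (max (K.lower i) (M.lower i))
      ⟨le_max_left _ _, max_le (K.lower_lt_upper i).le (hM.1.trans hK.2)⟩
      ⟨le_max_right _ _, max_le (hK.1.trans hM.2) (M.lower_lt_upper i).le⟩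
    rw [hsi, mem_singleton_iff] at this
    rcases max_choice (K.lower i) (M.lower i) with h | h
    · exact (h.symm.trans this).ge
    · exact absurd (h.symm.trans this) (M.lower_lt_upper i).ne

namespace IsRectMesh

variable {Ω : Set (Euc d)} {H κ : ℝ} {T : Finset (BoxIntegral.Box (Fin d))}

/-- A point of `M` that also lies in an element not touching `K` has distance at least `H / κ` from
`K`, when `M` touches `K`. -/
theorem far_of_not_touching (hT : IsRectMesh Ω H κ T) (hκ : 0 < κ) {K L M : BoxIntegral.Box (Fin d)}
    (hK : K ∈ T) (hL : L ∈ T) (hM : M ∈ T) {x : Euc d} (hxM : x ∈ cell M) (hxL : x ∈ cell L)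
    (hKM : (cell K ∩ cell M).Nonempty) (hKL : ¬(cell K ∩ cell L).Nonempty) :
    ∃ i, H / κ ≤ K.lower i - x i ∨ H / κ ≤ x i - K.upper i := by
  obtain ⟨s, hs, hsF⟩ := (hT.conforming K hK M hM hKM).2
  obtain ⟨s', hs', hsF'⟩ := (hT.conforming L hL M hM ⟨x, hxL, hxM⟩).2
  -- Both intersections are faces of `M`, hence products. If their factors met in every direction,
  -- they would share a point, which would lie in `cell K ∩ cell L`.
  obtain ⟨i, hi⟩ : ∃ i, ¬(s i ∩ s' i).Nonempty := by
    by_contra! hne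
    choose z hz using hne
    have h1 : (WithLp.toLp 2 z : Euc d) ∈ cell K ∩ cell M := by
      rw [hsF]; exact fun i => (hz i).1
    have h2 : (WithLp.toLp 2 z : Euc d) ∈ cell L ∩ cell M := by
      rw [hsF']; exact fun i => (hz i).2
    exact hKL ⟨_, h1.1, h2.1⟩
  have hx : x i ∈ s' i := by
    have : x ∈ cell L ∩ cell M := ⟨hxL, hxM⟩
    rw [hsF'] at this
    exact this i
  have hlt := M.lower_lt_upper i
  have hside := (div_le_iff₀' hκ).2 (hT.le_side M hM i)
  obtain ⟨e1, e2⟩ := cell_face_endpoint hKM hsF (i := i)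
  refine ⟨i, ?_⟩
  have hl : M.lower i ∈ Icc (M.lower i) (M.upper i) := ⟨le_rfl, hlt.le⟩
  have hu : M.upper i ∈ Icc (M.lower i) (M.upper i) := ⟨hlt.le, le_rfl⟩
  -- Of the nine combinations only opposite endpoints are disjoint. Then a full side of `M`, of
  -- length at least `H / κ`, lies between `x` and `K` in this direction.
  rcases hs i with h | h | h <;> rcases hs' i with h' | h' | h'
  · exact absurd ⟨M.lower i, by simp [h, h']⟩ hi
  · right
    rw [h', mem_singleton_iff] at hx
    have := e1 h
    linarith
  · exact absurd ⟨M.lower i, by rw [h, h']; exact ⟨rfl, hl⟩⟩ hi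
  · left
    rw [h', mem_singleton_iff] at hx
    have := e2 h
    linarith
  · exact absurd ⟨M.upper i, by simp [h, h']⟩ hi
  · exact absurd ⟨M.upper i, by rw [h, h']; exact ⟨rfl, hu⟩⟩ hi
  · exact absurd ⟨M.lower i, by rw [h, h']; exact ⟨hl, rfl⟩⟩ hi
  · exact absurd ⟨M.upper i, by rw [h, h']; exact ⟨hu, rfl⟩⟩ hi
  · exact absurd ⟨M.lower i, by rw [h, h']; exact ⟨hl, hl⟩⟩ hi

end IsRectMesh

open Classical in
/-- The plateau function of the box `K`, set to zero outside the patch of `K`. -/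
def hat (T : Finset (BoxIntegral.Box (Fin d))) (c : ℝ) (K : BoxIntegral.Box (Fin d))
    (x : Euc d) : ℝ :=
  if x ∈ patchOne T (cell K) then boxPlateau c K x else 0

theorem hat_nonneg (T : Finset (BoxIntegral.Box (Fin d))) (c : ℝ) (K : BoxIntegral.Box (Fin d))
    (x : Euc d) : 0 ≤ hat T c K x := by
  unfold hat; split_ifs
  exacts [boxPlateau_nonneg _ _ _, le_rfl]

theorem hat_le_one (T : Finset (BoxIntegral.Box (Fin d))) (c : ℝ) (K : BoxIntegral.Box (Fin d))
    (x : Euc d) : hat T c K x ≤ 1 := by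
  unfold hat; split_ifs
  exacts [boxPlateau_le_one _ _ _, zero_le_one]

namespace IsRectMesh

variable {Ω : Set (Euc d)} {H κ : ℝ} {T : Finset (BoxIntegral.Box (Fin d))}

theorem hat_eq_one {c : ℝ} (hc : 0 ≤ c) {K : BoxIntegral.Box (Fin d)} (hK : K ∈ T) {x : Euc d}
    (hx : x ∈ cell K) : hat T c K x = 1 := by
  rw [hat, if_pos (mem_patchOne_cell.2 ⟨K, hK, ⟨x, hx, hx⟩, hx⟩), boxPlateau_eq_one hc hx]

/-- In some coordinate `x` is at distance at least `H / κ` from `K`, while the slope `2 * κ / H`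
makes the plateau vanish already from half that distance on. The factor 2 leaves room for a
neighbourhood of `x`. -/
theorem boxPlateau_eventually_zero (hT : IsRectMesh Ω H κ T) (hH : 0 < H) (hκ : 0 < κ)
    {K L M : BoxIntegral.Box (Fin d)}
    (hK : K ∈ T) (hL : L ∈ T) (hM : M ∈ T) {x : Euc d} (hxM : x ∈ cell M) (hxL : x ∈ cell L)
    (hKM : (cell K ∩ cell M).Nonempty) (hKL : ¬(cell K ∩ cell L).Nonempty) :
    ∀ᶠ y in nhds x, boxPlateau (2 * κ / H) K y = 0 := by
  obtain ⟨i, hi⟩ := hT.far_of_not_touching hκ hK hL hM hxM hxL hKM hKL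
  have hpos : 0 < H / κ := by positivity
  have hcont : Continuous fun y : Euc d => y i := by fun_prop
  have e : ∀ r : ℝ, H / κ / 2 < r → 1 ≤ 2 * κ / H * r := by
    intro r hr
    calc (1 : ℝ) = 2 * κ / H * (H / κ / 2) := by field_simp
      _ ≤ _ := by gcongr
  rcases hi with hi | hi
  · have h : ∀ᶠ y in nhds x, y i < K.lower i - H / κ / 2 :=
      hcont.continuousAt.eventually_lt_const (by linarith)
    filter_upwards [h] with y hy
    exact boxPlateau_eq_zero (i := i) (Or.inl (e _ (by linarith)))
  · have h : ∀ᶠ y in nhds x, K.upper i + H / κ / 2 < y i :=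
      hcont.continuousAt.eventually_const_lt (by linarith)
    filter_upwards [h] with y hy
    exact boxPlateau_eq_zero (i := i) (Or.inr (e _ (by linarith)))

theorem hat_eq_zero (hT : IsRectMesh Ω H κ T) (hH : 0 < H) (hκ : 0 < κ)
    {K L : BoxIntegral.Box (Fin d)} (hK : K ∈ T) (hL : L ∈ T) {x : Euc d} (hxL : x ∈ cell L)
    (hKL : ¬(cell K ∩ cell L).Nonempty) : hat T (2 * κ / H) K x = 0 := by
  unfold hat
  split_ifs with h
  · obtain ⟨M, hM, hKM, hxM⟩ := mem_patchOne_cell.1 h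
    exact (hT.boxPlateau_eventually_zero hH hκ hK hL hM hxM hxL hKM hKL).self_of_nhds
  · rfl

/-- The truncation to the patch is needed because an element may come closer to `K` than `H / (2 *
κ)` without touching it, across a narrow gap in `Ω`. It creates no jump inside `Ω`: if a point of
the patch also lies in an element not touching `K`, the plateau is zero nearby; if all elements
containing the point touch `K`, they cover a neighbourhood of it and nothing is truncated there. -/
theorem hat_eventuallyEq (hT : IsRectMesh Ω H κ T) (hΩ : IsOpen Ω) (hH : 0 < H) (hκ : 0 < κ)
    {K : BoxIntegral.Box (Fin d)} (hK : K ∈ T) {x : Euc d} (hx : x ∈ Ω) :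
    (hat T (2 * κ / H) K =ᶠ[nhds x] fun _ => 0) ∨
      (hat T (2 * κ / H) K =ᶠ[nhds x] boxPlateau (2 * κ / H) K ∧ x ∈ patchOne T (cell K)) := by
  by_cases h : x ∈ patchOne T (cell K)
  · by_cases h2 : ∃ L ∈ T, x ∈ cell L ∧ ¬(cell K ∩ cell L).Nonempty
    · left
      obtain ⟨L, hL, hxL, hKL⟩ := h2
      obtain ⟨M, hM, hKM, hxM⟩ := mem_patchOne_cell.1 h
      filter_upwards [hT.boxPlateau_eventually_zero hH hκ hK hL hM hxM hxL hKM hKL] with y hy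
      unfold hat; split_ifs
      exacts [hy, rfl]
    · right
      refine ⟨?_, h⟩
      push Not at h2
      have hev : ∀ᶠ y in nhds x, ∀ L ∈ T, y ∈ cell L → x ∈ cell L := by
        rw [Filter.eventually_all_finset]
        intro L _
        by_cases hxL : x ∈ cell L
        · exact Filter.Eventually.of_forall fun _ _ => hxL
        · filter_upwards [(isClosed_cell L).isOpen_compl.mem_nhds hxL] with y hy hy'
          exact absurd hy' hy
      filter_upwards [hev, hΩ.mem_nhds hx] with y hy hyΩ
      obtain ⟨L, hL, hyL⟩ := hT.exists_cell hyΩ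
      rw [hat, if_pos (mem_patchOne_cell.2 ⟨L, hL, h2 L hL (hy L hL hyL), hyL⟩)]
  · left
    filter_upwards [(isClosed_patchOne T (cell K)).isOpen_compl.mem_nhds h] with y hy
    rw [hat, if_neg hy]

/-- If `M` contains `x` and touches `K`, every point of `K` is within `2 * κ * H` of `x` in each
coordinate. Packing then gives a count independent of `H`. -/
theorem card_touching_le (hT : IsRectMesh Ω H κ T) (hH : 0 < H) (hκ : 0 < κ)
    {S : Finset (BoxIntegral.Box (Fin d))} (hS : S ⊆ T) (x : Euc d)
    (hx : ∀ K ∈ S, x ∈ patchOne T (cell K)) : (S.card : ℝ) ≤ (4 * κ ^ 2) ^ d := by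
  have h := hT.card_mul_le hH hκ hS x (R := 2 * κ * H) (fun K hK y hy i => ?_) (by positivity)
  · have hp : 0 < (H / κ) ^ d := by positivity
    have : (2 * (2 * κ * H)) ^ d = (4 * κ ^ 2) ^ d * (H / κ) ^ d := by
      rw [← mul_pow]; congr 1; field_simp; ring
    rw [this] at h
    exact le_of_mul_le_mul_right h hp
  · obtain ⟨M, hM, ⟨z, hzK, hzM⟩, hxM⟩ := mem_patchOne_cell.1 (hx K hK)
    have hK1 := hT.side_le K (hS hK) i
    have hM1 := hT.side_le M hM i
    have := (hzK i).1
    have := (hzK i).2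
    have := (hzM i).1
    have := (hzM i).2
    have := (hxM i).1
    have := (hxM i).2
    have := (hy i).1
    have := (hy i).2
    rw [abs_le]
    constructor <;> linarith

end IsRectMesh

/-- Smooth cut-off functions on a mesh, with gradients of size `1 / H`. -/
theorem exists_cutoff (d : ℕ) {κ : ℝ} (hκ : 0 < κ) :
    ∃ C : ℝ, 0 ≤ C ∧ ∀ (Ω : Set (Euc d)), IsOpen Ω → ∀ H : ℝ, 0 < H →
      ∀ T : Finset (BoxIntegral.Box (Fin d)), IsRectMesh Ω H κ T → ∀ S ⊆ T,
        ∃ θ : Euc d → ℝ, (∀ x ∈ Ω, ContDiffAt ℝ (⊤ : ℕ∞) θ x) ∧ (∀ x, 0 ≤ θ x ∧ θ x ≤ 1) ∧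
          (∀ x ∈ Ω, ‖fderiv ℝ θ x‖ ≤ C / H) ∧ (∀ K ∈ S, ∀ x ∈ cell K, θ x = 0) ∧
          ∀ K ∈ T, (∀ L ∈ S, ¬(cell L ∩ cell K).Nonempty) → ∀ x ∈ cell K, θ x = 1 := by
  classical
  obtain ⟨M, hM0, hM⟩ := exists_bound_deriv_smoothTransition
  refine ⟨(4 * κ ^ 2) ^ d * (d * (2 * M * (2 * κ))), by positivity, ?_⟩
  intro Ω hΩ H hH T hT S hS
  set c := 2 * κ / H with hc
  have hc0 : 0 ≤ c := by positivity
  have hsm : ∀ K ∈ S, ∀ x ∈ Ω, ContDiffAt ℝ (⊤ : ℕ∞) (hat T c K) x := by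
    intro K hK x hx
    rcases hT.hat_eventuallyEq hΩ hH hκ (hS hK) hx with h | ⟨h, -⟩
    · exact contDiffAt_const.congr_of_eventuallyEq h
    · exact (contDiff_boxPlateau c K).contDiffAt.congr_of_eventuallyEq h
  -- The product is 0 as soon as one hat equals 1, and it is 1 where all hats vanish.
  refine ⟨fun x => ∏ K ∈ S, (1 - hat T c K x), fun x hx => ?_, fun x => ⟨?_, ?_⟩, fun x hx => ?_,
    fun K hK x hx => ?_, fun K hK hKS x hx => ?_⟩
  · exact contDiffAt_prod fun K hK => contDiffAt_const.sub (hsm K hK x hx)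
  · exact Finset.prod_nonneg fun K _ => sub_nonneg.2 (hat_le_one _ _ _ _)
  · exact Finset.prod_le_one (fun K _ => sub_nonneg.2 (hat_le_one _ _ _ _))
      fun K _ => sub_le_self _ (hat_nonneg _ _ _ _)
  -- Only elements of `S` whose patch contains `x` contribute to the derivative at `x`. Their number
  -- is bounded independently of the size of `S`.
  · refine (norm_fderiv_prod_le S (fun K y => 1 - hat T c K y)
      (fun K => if x ∈ patchOne T (cell K) then d * (2 * M * c) else 0) x (fun K hK => ?_)
      (fun K _ => ?_) fun K hK => ?_).trans ?_
    · exact (contDiffAt_const.sub (hsm K hK x hx)).differentiableAt (by simp)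
    · rw [abs_of_nonneg (sub_nonneg.2 (hat_le_one _ _ _ _))]
      exact sub_le_self _ (hat_nonneg _ _ _ _)
    · rw [fderiv_const_sub, norm_neg]
      rcases hT.hat_eventuallyEq hΩ hH hκ (hS hK) hx with h | ⟨h, h'⟩
      · rw [h.fderiv_eq]
        simp only [fderiv_fun_const, Pi.zero_apply, norm_zero]
        split_ifs <;> positivity
      · rw [if_pos h', h.fderiv_eq]
        exact norm_fderiv_boxPlateau_le hM hc0 K x
    · rw [← Finset.sum_filter, Finset.sum_const, nsmul_eq_mul]
      have := hT.card_touching_le hH hκ ((Finset.filter_subset _ _).trans hS) x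
        (S := S.filter fun K => x ∈ patchOne T (cell K)) fun K hK => (Finset.mem_filter.1 hK).2
      calc _ ≤ (4 * κ ^ 2) ^ d * (d * (2 * M * c)) := by gcongr
        _ = _ := by rw [hc]; ring
  · exact Finset.prod_eq_zero hK (by rw [IsRectMesh.hat_eq_one hc0 (hS hK) hx, sub_self])
  · exact Finset.prod_eq_one fun L hL => by
      rw [hT.hat_eq_zero hH hκ (hS hL) hK hx (hKS L hL), sub_zero]

end

noncomputable section

/-! ### Calculus in `H¹₀(Ω)` -/

open scoped ENNReal

variable {d : ℕ} {Ω : Set (Euc d)}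

theorem inner_gradient (φ : Euc d → ℝ) (x v : Euc d) :
    inner ℝ (gradient φ x) v = fderiv ℝ φ x v := by
  rw [gradient, InnerProductSpace.toDual_symm_apply]

theorem norm_gradient (φ : Euc d → ℝ) (x : Euc d) : ‖gradient φ x‖ = ‖fderiv ℝ φ x‖ := by
  rw [gradient, LinearIsometryEquiv.norm_map]

theorem continuous_gradient {φ : Euc d → ℝ} (h : ContDiff ℝ (⊤ : ℕ∞) φ) :
    Continuous (gradient φ) :=
  (InnerProductSpace.toDual ℝ (Euc d)).symm.continuous.comp (h.continuous_fderiv (by simp))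

theorem gradient_eq_zero_of_notMem_tsupport {φ : Euc d → ℝ} {x : Euc d} (hx : x ∉ tsupport φ) :
    gradient φ x = 0 := by
  have : φ =ᶠ[nhds x] fun _ => 0 := notMem_tsupport_iff_eventuallyEq.1 hx
  rw [gradient, this.fderiv_eq]
  simp

theorem hasCompactSupport_gradient {φ : Euc d → ℝ} (h : HasCompactSupport φ) :
    HasCompactSupport (gradient φ) :=
  HasCompactSupport.intro h.isCompact fun _ hx => gradient_eq_zero_of_notMem_tsupport hx

namespace IsTestFunction

theorem memLp {φ : Euc d → ℝ} (h : IsTestFunction Ω φ) (s : Set (Euc d)) :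
    MemLp φ 2 (volume.restrict s) :=
  (h.1.continuous.memLp_of_hasCompactSupport h.2.1).restrict s

theorem memLp_gradient {φ : Euc d → ℝ} (h : IsTestFunction Ω φ) (s : Set (Euc d)) :
    MemLp (gradient φ) 2 (volume.restrict s) :=
  ((continuous_gradient h.1).memLp_of_hasCompactSupport (hasCompactSupport_gradient h.2.1)).restrict
    s

/-- A test function as an element of `H¹₀(Ω)`. -/
def toH10 {φ : Euc d → ℝ} (h : IsTestFunction Ω φ) : H10 Ω :=
  ⟨WithLp.toLp 2 ((h.memLp Ω).toLp φ, (h.memLp_gradient Ω).toLp (gradient φ)),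
    subset_closure ⟨φ, h, (h.memLp Ω).coeFn_toLp, (h.memLp_gradient Ω).coeFn_toLp⟩⟩

theorem fnOf_toH10 {φ : Euc d → ℝ} (h : IsTestFunction Ω φ) :
    fnOf h.toH10 =ᵐ[volume.restrict Ω] φ :=
  (h.memLp Ω).coeFn_toLp

theorem gradOf_toH10 {φ : Euc d → ℝ} (h : IsTestFunction Ω φ) :
    gradOf h.toH10 =ᵐ[volume.restrict Ω] gradient φ :=
  (h.memLp_gradient Ω).coeFn_toLp

theorem sum {ι : Type*} {s : Finset ι} {φ : ι → Euc d → ℝ} (h : ∀ i ∈ s, IsTestFunction Ω (φ i)) :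
    IsTestFunction Ω (fun x => ∑ i ∈ s, φ i x) := by
  classical
  induction s using Finset.induction_on with
  | empty =>
    refine ⟨by simpa using contDiff_const, ?_, ?_⟩
    · simp only [Finset.sum_empty]
      exact HasCompactSupport.zero
    simp [tsupport, Function.support]
  | insert i s hi ih =>
    have h1 := h i (Finset.mem_insert_self i s)
    have h2 := ih fun j hj => h j (Finset.mem_insert_of_mem hj)
    simp only [Finset.sum_insert hi]
    exact ⟨h1.1.add h2.1, h1.2.1.add h2.2.1,
      (tsupport_add _ _).trans (union_subset h1.2.2 h2.2.2)⟩

theorem const_mul {φ : Euc d → ℝ} (h : IsTestFunction Ω φ) (c : ℝ) :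
    IsTestFunction Ω (fun x => c * φ x) :=
  ⟨contDiff_const.mul h.1, h.2.1.mul_left, (tsupport_mul_subset_right).trans h.2.2⟩

end IsTestFunction

/-- Density: a closed condition on the pair `(u, ∇u)` has to be checked for test functions only.
Integration by parts and the Poincaré inequality are transferred to `H10` in this way. -/
theorem H10.mem_of_isClosed (u : H10 Ω) {P : Set (L2Pair Ω)} (hP : IsClosed P)
    (h : ∀ z ∈ testPairs Ω, z ∈ P) : (u : L2Pair Ω) ∈ P :=
  closure_minimal (s := (testPairs Ω : Set (L2Pair Ω))) h hP u.2

theorem fnOf_sub (u v : H10 Ω) : fnOf (u - v) = fnOf u - fnOf v := rfl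

theorem gradOf_sub (u v : H10 Ω) : gradOf (u - v) = gradOf u - gradOf v := rfl

/-- Multiplication by a smooth function that is bounded together with its gradient preserves
`H¹₀(Ω)`, and the product rule holds. -/
theorem H10.exists_mul (hΩ : IsOpen Ω) {θ : Euc d → ℝ} {B L : ℝ}
    (hθ : ∀ x ∈ Ω, ContDiffAt ℝ (⊤ : ℕ∞) θ x) (hB : ∀ x, |θ x| ≤ B)
    (hL : ∀ x ∈ Ω, ‖fderiv ℝ θ x‖ ≤ L) (u : H10 Ω) :
    ∃ u' : H10 Ω, (∀ᵐ x ∂volume.restrict Ω, fnOf u' x = θ x * fnOf u x) ∧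
      ∀ᵐ x ∂volume.restrict Ω, gradOf u' x = θ x • gradOf u x + fnOf u x • gradient θ x := by
  have hcd : ContDiffOn ℝ (⊤ : ℕ∞) θ Ω := fun x hx => (hθ x hx).contDiffWithinAt
  have h1 : MemLp θ ∞ (volume.restrict Ω) :=
    memLp_top_of_bound (hcd.continuousOn.aestronglyMeasurable hΩ.measurableSet) B
      (ae_of_all _ hB)
  have hg : ContinuousOn (gradient θ) Ω :=
    (InnerProductSpace.toDual ℝ (Euc d)).symm.continuous.comp_continuousOn
      (hcd.continuousOn_fderiv_of_isOpen hΩ (by simp))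
  have h2 : MemLp (gradient θ) ∞ (volume.restrict Ω) :=
    memLp_top_of_bound (hg.aestronglyMeasurable hΩ.measurableSet) L <| by
      filter_upwards [ae_restrict_mem hΩ.measurableSet] with x hx
      rw [norm_gradient]; exact hL x hx
  -- Multiplication by the bounded functions `θ` and `∇θ` is a bounded operator on `L²`, by Hölder
  -- with exponents `∞` and `2`. The map `(u, g) ↦ (θu, θg + u∇θ)` is therefore continuous; it sends
  -- test pairs to test pairs, hence the closure into itself.
  set m1 : L2 Ω →L[ℝ] L2 Ω :=
    (ContinuousLinearMap.lsmul ℝ ℝ : ℝ →L[ℝ] ℝ →L[ℝ] ℝ).holderL _ ∞ 2 2 (h1.toLp θ) with hm1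
  set m2 : Lp (Euc d) 2 (volume.restrict Ω) →L[ℝ] Lp (Euc d) 2 (volume.restrict Ω) :=
    (ContinuousLinearMap.lsmul ℝ ℝ : ℝ →L[ℝ] Euc d →L[ℝ] Euc d).holderL _ ∞ 2 2 (h1.toLp θ) with hm2
  set m3 : L2 Ω →L[ℝ] Lp (Euc d) 2 (volume.restrict Ω) :=
    (ContinuousLinearMap.lsmul ℝ ℝ : ℝ →L[ℝ] Euc d →L[ℝ] Euc d).flip.holderL _ ∞ 2 2
      (h2.toLp (gradient θ)) with hm3
  have e1 : ∀ f : L2 Ω, ∀ᵐ x ∂volume.restrict Ω, m1 f x = θ x * f x := fun f => by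
    filter_upwards [ContinuousLinearMap.coeFn_holder (r := 2)
      (ContinuousLinearMap.lsmul ℝ ℝ : ℝ →L[ℝ] ℝ →L[ℝ] ℝ) (h1.toLp θ) f, h1.coeFn_toLp] with x a b
    rw [hm1, ContinuousLinearMap.holderL_apply_apply, a, b]; rfl
  have e2 : ∀ f, ∀ᵐ x ∂volume.restrict Ω, m2 f x = θ x • f x := fun f => by
    filter_upwards [ContinuousLinearMap.coeFn_holder (r := 2)
      (ContinuousLinearMap.lsmul ℝ ℝ : ℝ →L[ℝ] Euc d →L[ℝ] Euc d) (h1.toLp θ) f, h1.coeFn_toLp]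
      with x a b
    rw [hm2, ContinuousLinearMap.holderL_apply_apply, a, b]; rfl
  have e3 : ∀ f, ∀ᵐ x ∂volume.restrict Ω, m3 f x = f x • gradient θ x := fun f => by
    filter_upwards [ContinuousLinearMap.coeFn_holder (r := 2)
      (ContinuousLinearMap.lsmul ℝ ℝ : ℝ →L[ℝ] Euc d →L[ℝ] Euc d).flip (h2.toLp (gradient θ)) f,
      h2.coeFn_toLp] with x a b
    rw [hm3, ContinuousLinearMap.holderL_apply_apply, a, b]; rfl
  let m : L2Pair Ω → L2Pair Ω := fun z => WithLp.toLp 2 (m1 z.fst, m2 z.snd + m3 z.fst)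
  have hm : Continuous m := by
    refine (WithLp.prod_continuous_toLp 2 _ _).comp ?_
    fun_prop
  have hmem : m u ∈ H10 Ω := by
    refine map_mem_closure (s := (testPairs Ω : Set (L2Pair Ω))) hm u.2 ?_
    rintro z ⟨φ, hφ, hz1, hz2⟩
    refine ⟨fun x => θ x * φ x, ⟨?_, hφ.2.1.mul_left, tsupport_mul_subset_right.trans hφ.2.2⟩,
      ?_, ?_⟩
    -- Smoothness of `θ` is known only in `Ω`. At points off the support of `φ` the product vanishes
    -- locally.
    · rw [contDiff_iff_contDiffAt]
      intro x
      by_cases hx : x ∈ tsupport φ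
      · exact (hθ x (hφ.2.2 hx)).mul hφ.1.contDiffAt
      · have h0 : (fun x => θ x * φ x) =ᶠ[nhds x] fun _ => 0 := by
          filter_upwards [notMem_tsupport_iff_eventuallyEq.1 hx] with y hy
          rw [hy]; simp
        exact contDiffAt_const.congr_of_eventuallyEq h0
    · filter_upwards [e1 z.fst, hz1] with x a b
      exact a.trans (by rw [b])
    · filter_upwards [e2 z.snd, e3 z.fst, Lp.coeFn_add (m2 z.snd) (m3 z.fst), hz1, hz2,
        ae_restrict_mem hΩ.measurableSet] with x a b c hb hc hx
      refine c.trans ?_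
      rw [Pi.add_apply, a, b, hb, hc]
      simp only [gradient]
      rw [fderiv_fun_mul ((hθ x hx).differentiableAt (by simp)) (hφ.1.differentiable (by simp) x),
        map_add]
      simp
  refine ⟨⟨m u, hmem⟩, e1 _, ?_⟩
  filter_upwards [e2 (gradOf u), e3 (fnOf u), Lp.coeFn_add (m2 (gradOf u)) (m3 (fnOf u))]
    with x a b c
  exact c.trans (by rw [Pi.add_apply, a, b])

/-- Integration by parts on `H¹₀(Ω)`. -/
theorem H10.integral_fderiv_mul (u : H10 Ω) {g : Euc d → ℝ} (hg : IsTestFunction Ω g) (e : Euc d) :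
    (∫ x in Ω, fderiv ℝ g x e * fnOf u x) + ∫ x in Ω, g x * inner ℝ e (gradOf u x) = 0 := by
  have m1 : MemLp (fun x => fderiv ℝ g x e) 2 (volume.restrict Ω) := by
    refine MemLp.restrict Ω (Continuous.memLp_of_hasCompactSupport ?_ ?_)
    · exact (hg.1.continuous_fderiv (by simp)).clm_apply continuous_const
    · refine hg.2.1.fderiv_apply ℝ e
  have m2 : MemLp (fun x => g x • e) 2 (volume.restrict Ω) := by
    refine MemLp.restrict Ω (Continuous.memLp_of_hasCompactSupport ?_ ?_)
    · exact hg.1.continuous.smul continuous_const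
    · exact hg.2.1.smul_right
  have i1 : ∀ f : L2 Ω, inner ℝ (m1.toLp _) f = ∫ x in Ω, fderiv ℝ g x e * f x := fun f => by
    rw [L2.inner_def]
    refine integral_congr_ae ?_
    filter_upwards [m1.coeFn_toLp] with x hx
    rw [hx]; simp [mul_comm]
  have i2 : ∀ f : Lp (Euc d) 2 (volume.restrict Ω),
      inner ℝ (m2.toLp _) f = ∫ x in Ω, g x * inner ℝ e (f x) := fun f => by
    rw [L2.inner_def]
    refine integral_congr_ae ?_
    filter_upwards [m2.coeFn_toLp] with x hx
    rw [hx, real_inner_smul_left]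
  -- Both terms are inner products with fixed elements of `L²`, so the identity is a closed
  -- condition.
  have key := H10.mem_of_isClosed u
    (P := {z | inner ℝ (m1.toLp _) z.fst + inner ℝ (m2.toLp _) z.snd = 0})
    (isClosed_eq (by fun_prop) continuous_const) ?_
  · simp only [mem_ofPred_eq, i1, i2] at key
    exact key
  · rintro z ⟨φ, hφ, hz1, hz2⟩
    simp only [mem_ofPred_eq, i1, i2]
    have j1 : ∫ x in Ω, fderiv ℝ g x e * z.fst x = ∫ x, fderiv ℝ g x e * φ x := by
      rw [← setIntegral_eq_integral_of_forall_compl_eq_zero (s := Ω) (f := fun x => fderiv ℝ g x e * φ x)]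
      · refine integral_congr_ae ?_
        filter_upwards [hz1] with x hx
        rw [hx]
      · intro x hx
        rw [image_eq_zero_of_notMem_tsupport fun h => hx (hφ.2.2 h), mul_zero]
    have j2 : ∫ x in Ω, g x * inner ℝ e (z.snd x) = ∫ x, g x * fderiv ℝ φ x e := by
      rw [← setIntegral_eq_integral_of_forall_compl_eq_zero (s := Ω) (f := fun x => g x * fderiv ℝ φ x e)]
      · refine integral_congr_ae ?_
        filter_upwards [hz2] with x hx
        rw [hx, real_inner_comm, inner_gradient]
      · intro x hx
        rw [image_eq_zero_of_notMem_tsupport fun h => hx (hg.2.2 h), zero_mul]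
    have c1 : Continuous fun x => fderiv ℝ g x e :=
      (hg.1.continuous_fderiv (by simp)).clm_apply continuous_const
    have c2 : Continuous fun x => fderiv ℝ φ x e :=
      (hφ.1.continuous_fderiv (by simp)).clm_apply continuous_const
    rw [j1, j2, integral_mul_fderiv_eq_neg_fderiv_mul_of_integrable]
    · ring
    · exact (c1.mul hφ.1.continuous).integrable_of_hasCompactSupport hφ.2.1.mul_left
    · exact (hg.1.continuous.mul c2).integrable_of_hasCompactSupport hg.2.1.mul_right
    · exact (hg.1.continuous.mul hφ.1.continuous).integrable_of_hasCompactSupport hg.2.1.mul_right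
    · exact fun x _ => hg.1.differentiable (by simp) x
    · exact fun x _ => hφ.1.differentiable (by simp) x

/-- The weak gradient vanishes where the function vanishes. -/
theorem H10.gradOf_ae_eq_zero [IsFiniteMeasure (volume.restrict Ω)] (u : H10 Ω) {O : Set (Euc d)}
    (hO : IsOpen O) (hOΩ : O ⊆ Ω) (h : ∀ᵐ x ∂volume.restrict O, fnOf u x = 0) :
    ∀ᵐ x ∂volume.restrict O, gradOf u x = 0 := by
  have hint : IntegrableOn (gradOf u) Ω := (Lp.memLp (gradOf u)).integrable (by norm_num)
  -- Fundamental lemma of the calculus of variations. For `g` supported in `O`, integration by parts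
  -- moves the derivative onto `g`, and the resulting integrand vanishes almost everywhere: `u` is
  -- zero on `O` and the derivative of `g` is zero off `O`.
  have := hO.ae_eq_zero_of_integral_contDiff_smul_eq_zero (μ := volume) (f := gradOf u)
    ((hint.mono_set hOΩ).locallyIntegrableOn) fun g hg1 hg2 hg3 => ?_
  · rw [ae_restrict_iff' hO.measurableSet]
    exact this
  have hg : IsTestFunction Ω g := ⟨hg1, hg2, hg3.trans hOΩ⟩
  rw [← setIntegral_eq_integral_of_forall_compl_eq_zero (s := Ω) fun x hx => by
    rw [image_eq_zero_of_notMem_tsupport fun h => hx (hg.2.2 h), zero_smul]]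
  have hi : IntegrableOn (fun x => g x • gradOf u x) Ω :=
    (MemLp.smul (p := 2) (q := 2) (r := 1) (Lp.memLp (gradOf u)) (hg.memLp Ω)).integrable le_rfl
  refine ext_inner_left ℝ fun e => ?_
  rw [← integral_inner hi, inner_zero_right]
  have := H10.integral_fderiv_mul u hg e
  have h0 : ∫ x in Ω, fderiv ℝ g x e * fnOf u x = 0 := by
    rw [← integral_zero (Euc d) ℝ (μ := volume.restrict Ω)]
    refine integral_congr_ae (ae_restrict_of_ae ?_)
    rw [ae_restrict_iff' hO.measurableSet] at h
    filter_upwards [h] with x hx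
    by_cases hxO : x ∈ O
    · rw [hx hxO, mul_zero]
    · rw [fderiv_of_notMem_tsupport (𝕜 := ℝ) fun h => hxO (hg3 h)]; simp
  rw [h0, zero_add] at this
  simpa only [real_inner_smul_right] using this

end

noncomputable section

/-! ### Poincaré inequality -/

open scoped ENNReal

variable {d : ℕ} {Ω : Set (Euc d)}

/-- Jensen's inequality on the unit interval, from the nonnegativity of the variance. -/
theorem sq_intervalIntegral_le {f : ℝ → ℝ} (hf : Continuous f) :
    (∫ t in (0 : ℝ)..1, f t) ^ 2 ≤ ∫ t in (0 : ℝ)..1, f t ^ 2 := by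
  set m := ∫ t in (0 : ℝ)..1, f t with hm
  have h0 : 0 ≤ ∫ t in (0 : ℝ)..1, (f t - m) ^ 2 :=
    intervalIntegral.integral_nonneg zero_le_one fun t _ => sq_nonneg _
  have h1 : ∫ t in (0 : ℝ)..1, (f t - m) ^ 2 = (∫ t in (0 : ℝ)..1, f t ^ 2) - m ^ 2 := by
    have : ∀ t, (f t - m) ^ 2 = (f t ^ 2 - (2 * m) * f t) + m ^ 2 := fun t => by ring
    simp_rw [this]
    rw [intervalIntegral.integral_add, intervalIntegral.integral_sub,
      intervalIntegral.integral_const_mul, ← hm]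
    · simp; ring
    all_goals exact Continuous.intervalIntegrable (by fun_prop) _ _
  linarith

/-- The fundamental theorem of calculus along the segment from `y` to `x`, followed by Jensen.
Values in `ℝ≥0∞` allow later exchanges of integrals without integrability conditions. -/
theorem ofReal_sq_sub_le {φ : Euc d → ℝ} (hφ : ContDiff ℝ (⊤ : ℕ∞) φ) {D : ℝ} {x y : Euc d}
    (hD : ‖x - y‖ ^ 2 ≤ D) :
    ENNReal.ofReal ((φ x - φ y) ^ 2) ≤ ENNReal.ofReal D *
      ∫⁻ t in Icc (0 : ℝ) 1, ENNReal.ofReal (‖gradient φ ((1 - t) • y + t • x)‖ ^ 2) := by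
  have hcf : Continuous fun t : ℝ => fderiv ℝ φ ((1 - t) • y + t • x) :=
    (hφ.continuous_fderiv (by simp)).comp (by fun_prop)
  have hftc : ∫ t in (0 : ℝ)..1, fderiv ℝ φ ((1 - t) • y + t • x) (x - y) = φ x - φ y := by
    have := intervalIntegral.integral_eq_sub_of_hasDerivAt (a := 0) (b := 1)
      (f := fun t : ℝ => φ ((1 - t) • y + t • x))
      (f' := fun t => fderiv ℝ φ ((1 - t) • y + t • x) (x - y)) (fun t _ => ?_)
      (Continuous.intervalIntegrable (by fun_prop) _ _)
    · simpa using this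
    · have h1 : HasDerivAt (fun t : ℝ => (1 - t) • y + t • x) (x - y) t := by
        have := (((hasDerivAt_id t).const_sub 1).smul_const y).add
          ((hasDerivAt_id t).smul_const x)
        convert! this using 1
        simp; abel
      exact (hφ.differentiable (by simp) _).hasFDerivAt.comp_hasDerivAt t h1
  have hcg : Continuous fun t : ℝ => ‖gradient φ ((1 - t) • y + t • x)‖ ^ 2 := by
    simp_rw [norm_gradient]; fun_prop
  have hle : (φ x - φ y) ^ 2 ≤
      D * ∫ t in (0 : ℝ)..1, ‖gradient φ ((1 - t) • y + t • x)‖ ^ 2 := by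
    rw [← hftc, ← intervalIntegral.integral_const_mul]
    refine (sq_intervalIntegral_le (by fun_prop)).trans ?_
    refine intervalIntegral.integral_mono_on zero_le_one
      (Continuous.intervalIntegrable (by fun_prop) _ _)
      (Continuous.intervalIntegrable (by fun_prop) _ _) fun t _ => ?_
    rw [norm_gradient]
    have h := (fderiv ℝ φ ((1 - t) • y + t • x)).le_opNorm (x - y)
    calc (fderiv ℝ φ ((1 - t) • y + t • x) (x - y)) ^ 2
        = ‖fderiv ℝ φ ((1 - t) • y + t • x) (x - y)‖ ^ 2 := by rw [Real.norm_eq_abs, sq_abs]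
      _ ≤ (‖fderiv ℝ φ ((1 - t) • y + t • x)‖ * ‖x - y‖) ^ 2 := by gcongr
      _ = ‖x - y‖ ^ 2 * ‖fderiv ℝ φ ((1 - t) • y + t • x)‖ ^ 2 := by ring
      _ ≤ _ := by gcongr
  refine (ENNReal.ofReal_le_ofReal hle).trans ?_
  rw [ENNReal.ofReal_mul ((sq_nonneg _).trans hD), intervalIntegral.integral_of_le zero_le_one,
    ← integral_Icc_eq_integral_Ioc, ofReal_integral_eq_lintegral_ofReal]
  · exact hcg.continuousOn.integrableOn_Icc
  · exact ae_of_all _ fun t => sq_nonneg _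

/-- Substitution `z = (1 - r) x + r y`: convexity keeps `z` in `S`, and the Jacobian factor `r⁻ᵈ` is
at most `2 ^ d` because `r ≥ 1/2`. -/
theorem setLIntegral_convexComb_le {S : Set (Euc d)} (hS : MeasurableSet S) (hc : Convex ℝ S)
    {G : Euc d → ℝ≥0∞} (hG : Measurable G) {r : ℝ} (hr : 1 / 2 ≤ r) (hr1 : r ≤ 1) {x : Euc d}
    (hx : x ∈ S) :
    ∫⁻ y in S, G ((1 - r) • x + r • y) ≤ 2 ^ d * ∫⁻ y in S, G y := by
  have hr0 : 0 < r := by linarith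
  have hGi : Measurable (S.indicator G) := hG.indicator hS
  calc ∫⁻ y in S, G ((1 - r) • x + r • y)
      = ∫⁻ y, S.indicator (fun y => G ((1 - r) • x + r • y)) y := (lintegral_indicator hS _).symm
    _ ≤ ∫⁻ y, S.indicator G ((1 - r) • x + r • y) := by
      refine lintegral_mono fun y => ?_
      by_cases hy : y ∈ S
      · rw [indicator_of_mem hy, indicator_of_mem]
        exact hc hx hy (by linarith) hr0.le (by ring)
      · rw [indicator_of_notMem hy]; exact zero_le
    _ = ∫⁻ z, S.indicator G ((1 - r) • x + z) ∂(Measure.map (fun y => r • y) volume) := by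
      rw [lintegral_map (by fun_prop) (by fun_prop)]
    _ = ENNReal.ofReal |(r ^ d)⁻¹| * ∫⁻ y in S, G y := by
      rw [Measure.map_addHaar_smul _ hr0.ne', lintegral_smul_measure,
        lintegral_add_left_eq_self (S.indicator G), lintegral_indicator hS]
      simp
    _ ≤ 2 ^ d * ∫⁻ y in S, G y := by
      gcongr
      rw [abs_of_nonneg (by positivity), ← inv_pow, ENNReal.ofReal_pow (by positivity)]
      gcongr
      rw [show (2 : ℝ≥0∞) = ENNReal.ofReal 2 by simp]
      refine ENNReal.ofReal_le_ofReal ?_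
      rw [inv_le_comm₀ hr0 two_pos]
      linarith

/-- One of the weights `t` and `1 - t` is at least `1/2`. Substituting in the variable that carries
this weight keeps the Jacobian bounded for all `t`. -/
theorem lintegral_sq_sub_le {S : Set (Euc d)} (hS : MeasurableSet S) (hc : Convex ℝ S)
    {D : ℝ} (hD : ∀ x ∈ S, ∀ y ∈ S, ‖x - y‖ ^ 2 ≤ D) {φ : Euc d → ℝ}
    (hφ : ContDiff ℝ (⊤ : ℕ∞) φ) :
    ∫⁻ x in S, ∫⁻ y in S, ENNReal.ofReal ((φ x - φ y) ^ 2) ≤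
      ENNReal.ofReal D * (2 ^ d * (∫⁻ x in S, ENNReal.ofReal (‖gradient φ x‖ ^ 2)) * volume S) := by
  set G : Euc d → ℝ≥0∞ := fun x => ENNReal.ofReal (‖gradient φ x‖ ^ 2) with hG
  have hGm : Measurable G := ((continuous_gradient hφ).norm.pow 2).measurable.ennreal_ofReal
  set I := ∫⁻ x in S, G x
  have hJ : ∀ t ∈ Icc (0 : ℝ) 1,
      ∫⁻ x in S, ∫⁻ y in S, G ((1 - t) • y + t • x) ≤ 2 ^ d * I * volume S := by
    intro t ht
    rcases le_total t (1 / 2) with h | h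
    · rw [← setLIntegral_const]
      refine setLIntegral_mono measurable_const fun x hx => ?_
      have := setLIntegral_convexComb_le hS hc hGm (r := 1 - t) (by linarith) (by linarith [ht.1]) hx
      simpa [add_comm] using this
    · rw [lintegral_lintegral_swap (by fun_prop), ← setLIntegral_const]
      refine setLIntegral_mono measurable_const fun x hx => ?_
      exact setLIntegral_convexComb_le hS hc hGm h ht.2 hx
  calc ∫⁻ x in S, ∫⁻ y in S, ENNReal.ofReal ((φ x - φ y) ^ 2)
      ≤ ∫⁻ x in S, ∫⁻ y in S, ENNReal.ofReal D *
          ∫⁻ t in Icc (0 : ℝ) 1, G ((1 - t) • y + t • x) := by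
        refine setLIntegral_mono' hS fun x hx => setLIntegral_mono' hS fun y hy => ?_
        exact ofReal_sq_sub_le hφ (hD x hx y hy)
    _ = ENNReal.ofReal D * ∫⁻ x in S, ∫⁻ y in S,
          ∫⁻ t in Icc (0 : ℝ) 1, G ((1 - t) • y + t • x) := by
        have : Measurable fun z : Euc d × Euc d =>
            ∫⁻ t in Icc (0 : ℝ) 1, G ((1 - t) • z.2 + t • z.1) :=
          Measurable.lintegral_prod_right' (f := fun w : (Euc d × Euc d) × ℝ =>
            G ((1 - w.2) • w.1.2 + w.2 • w.1.1)) (by fun_prop)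
        rw [← lintegral_const_mul]
        · refine lintegral_congr fun x => ?_
          rw [lintegral_const_mul]
          exact Measurable.of_uncurry_left (f := fun x y =>
            ∫⁻ t in Icc (0 : ℝ) 1, G ((1 - t) • y + t • x)) this
        · exact this.lintegral_prod_right'
    _ = ENNReal.ofReal D * ∫⁻ x in S, ∫⁻ t in Icc (0 : ℝ) 1, ∫⁻ y in S,
          G ((1 - t) • y + t • x) := by
        congr 1
        refine lintegral_congr fun x => ?_
        rw [lintegral_lintegral_swap (by fun_prop)]
    _ = ENNReal.ofReal D * ∫⁻ t in Icc (0 : ℝ) 1, ∫⁻ x in S, ∫⁻ y in S,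
          G ((1 - t) • y + t • x) := by
        congr 1
        rw [lintegral_lintegral_swap]
        refine Measurable.aemeasurable ?_
        exact Measurable.lintegral_prod_right' (f := fun w : (Euc d × ℝ) × Euc d =>
            G ((1 - w.1.2) • w.2 + w.1.2 • w.1.1)) (by fun_prop)
    _ ≤ ENNReal.ofReal D * ∫⁻ t in Icc (0 : ℝ) 1, 2 ^ d * I * volume S := by
        gcongr ENNReal.ofReal D * ?_
        exact setLIntegral_mono' measurableSet_Icc hJ
    _ = _ := by rw [setLIntegral_const]; simp

/-- The Poincaré inequality on convex sets for smooth functions. -/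
theorem poincare_smooth {S : Set (Euc d)} (hS : MeasurableSet S) (hc : Convex ℝ S)
    (hfin : volume S ≠ ∞)
    {D : ℝ} (hD0 : 0 ≤ D) (hD : ∀ x ∈ S, ∀ y ∈ S, ‖x - y‖ ^ 2 ≤ D) {φ : Euc d → ℝ}
    (hφ : IsTestFunction Ω φ) :
    volume.real S * (∫ x in S, φ x ^ 2) - (∫ x in S, φ x) ^ 2 ≤
      D * 2 ^ d * volume.real S * ∫ x in S, ‖gradient φ x‖ ^ 2 := by
  have : IsFiniteMeasure (volume.restrict S) := isFiniteMeasure_restrict.2 hfin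
  have i1 : IntegrableOn φ S := (hφ.memLp S).integrable (by norm_num)
  have i2 : IntegrableOn (fun x => φ x ^ 2) S := (hφ.memLp S).integrable_sq
  have i3 : IntegrableOn (fun x => ‖gradient φ x‖ ^ 2) S := (hφ.memLp_gradient S).norm.integrable_sq
  set V := volume.real S with hV
  set a := ∫ x in S, φ x with ha
  set b := ∫ x in S, φ x ^ 2 with hb
  -- Integrating `(φ x - φ y) ^ 2` over both variables gives twice the quantity to be bounded. The
  -- gain of a factor 2 is discarded at the end.
  have inner : ∀ x, ∫ y in S, (φ x - φ y) ^ 2 = V * φ x ^ 2 - 2 * a * φ x + b := by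
    intro x
    have : ∀ y, (φ x - φ y) ^ 2 = (φ x ^ 2 - (2 * φ x) * φ y) + φ y ^ 2 := fun y => by ring
    simp_rw [this]
    rw [integral_add, integral_sub, integral_const_mul, setIntegral_const, smul_eq_mul]
    · ring
    · exact integrable_const _
    · exact i1.const_mul _
    · exact (integrable_const _).sub (i1.const_mul _)
    · exact i2
  have hsqint : ∀ x, IntegrableOn (fun y => (φ x - φ y) ^ 2) S := fun x =>
    ((memLp_const (φ x)).sub (hφ.memLp S)).integrable_sq
  have hint : IntegrableOn (fun x => V * φ x ^ 2 - 2 * a * φ x + b) S :=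
    ((i2.const_mul _).sub (i1.const_mul _)).add (integrable_const _)
  have outer : ∫ x in S, (V * φ x ^ 2 - 2 * a * φ x + b) = 2 * (V * b - a ^ 2) := by
    rw [integral_add, integral_sub, integral_const_mul, integral_const_mul, setIntegral_const,
      smul_eq_mul, ← ha, ← hb, ← hV]
    · ring
    · exact i2.const_mul _
    · exact i1.const_mul _
    · exact (i2.const_mul _).sub (i1.const_mul _)
    · exact integrable_const _
  have hnn : ∀ x, 0 ≤ V * φ x ^ 2 - 2 * a * φ x + b := fun x => by
    rw [← inner]; exact integral_nonneg fun y => sq_nonneg _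
  have key := lintegral_sq_sub_le hS hc hD hφ.1
  have e1 : ∫⁻ x in S, ∫⁻ y in S, ENNReal.ofReal ((φ x - φ y) ^ 2) =
      ENNReal.ofReal (2 * (V * b - a ^ 2)) := by
    rw [← outer, ofReal_integral_eq_lintegral_ofReal hint (ae_of_all _ hnn)]
    refine lintegral_congr fun x => ?_
    rw [← inner, ofReal_integral_eq_lintegral_ofReal (hsqint x) (ae_of_all _ fun y => sq_nonneg _)]
  have hg0 : 0 ≤ ∫ x in S, ‖gradient φ x‖ ^ 2 := integral_nonneg fun x => sq_nonneg _
  have e2 : ENNReal.ofReal D * (2 ^ d * (∫⁻ x in S, ENNReal.ofReal (‖gradient φ x‖ ^ 2)) * volume S)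
      = ENNReal.ofReal (D * (2 ^ d * (∫ x in S, ‖gradient φ x‖ ^ 2) * V)) := by
    rw [ENNReal.ofReal_mul hD0, ENNReal.ofReal_mul (by positivity),
      ENNReal.ofReal_mul (by positivity), hV, Measure.real, ENNReal.ofReal_toReal hfin,
      ofReal_integral_eq_lintegral_ofReal i3 (ae_of_all _ fun y => sq_nonneg _),
      ENNReal.ofReal_pow zero_le_two, ENNReal.ofReal_ofNat]
  rw [e1, e2] at key
  have hV0 : 0 ≤ V := measureReal_nonneg
  have h := (ENNReal.ofReal_le_ofReal_iff (by positivity)).1 key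
  have hp : 0 ≤ D * (2 ^ d * (∫ x in S, ‖gradient φ x‖ ^ 2) * V) := by positivity
  linarith [show D * 2 ^ d * V * ∫ x in S, ‖gradient φ x‖ ^ 2 =
    D * (2 ^ d * (∫ x in S, ‖gradient φ x‖ ^ 2) * V) by ring]

/-! ### Norms and Cauchy–Schwarz inequalities in `L²` -/

section Lp

variable {X E : Type*} [MeasurableSpace X] {ν : Measure X} [NormedAddCommGroup E]
  [InnerProductSpace ℝ E]

theorem L2_norm_sq (f : Lp E 2 ν) : ‖f‖ ^ 2 = ∫ x, ‖f x‖ ^ 2 ∂ν := by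
  rw [← real_inner_self_eq_norm_sq, L2.inner_def]
  simp_rw [real_inner_self_eq_norm_sq]

theorem L2_toLp_norm {f : X → E} (hf : MemLp f 2 ν) :
    ‖hf.toLp f‖ = Real.sqrt (∫ x, ‖f x‖ ^ 2 ∂ν) := by
  rw [← Real.sqrt_sq (norm_nonneg _), L2_norm_sq]
  congr 1
  refine integral_congr_ae ?_
  filter_upwards [hf.coeFn_toLp] with x hx
  rw [hx]

theorem abs_integral_mul_le {f g : X → ℝ} (hf : MemLp f 2 ν) (hg : MemLp g 2 ν) :
    |∫ x, f x * g x ∂ν| ≤ Real.sqrt (∫ x, f x ^ 2 ∂ν) * Real.sqrt (∫ x, g x ^ 2 ∂ν) := by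
  have h := abs_real_inner_le_norm (hf.toLp f) (hg.toLp g)
  rw [L2.inner_def, L2_toLp_norm, L2_toLp_norm] at h
  simp only [Real.norm_eq_abs, sq_abs] at h
  convert h using 2
  refine integral_congr_ae ?_
  filter_upwards [hf.coeFn_toLp, hg.coeFn_toLp] with x hx hx'
  rw [hx, hx']; simp [mul_comm]

theorem abs_integral_mul_inner_le {A : X → ℝ} {β : ℝ} {f g : X → E} (hA : ∀ᵐ x ∂ν, |A x| ≤ β)
    (hβ : 0 ≤ β) (hf : MemLp f 2 ν) (hg : MemLp g 2 ν) :
    |∫ x, A x * inner ℝ (f x) (g x) ∂ν| ≤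
      β * (Real.sqrt (∫ x, ‖f x‖ ^ 2 ∂ν) * Real.sqrt (∫ x, ‖g x‖ ^ 2 ∂ν)) := by
  have h := abs_integral_mul_le hf.norm hg.norm
  calc |∫ x, A x * inner ℝ (f x) (g x) ∂ν| ≤ ∫ x, |A x * inner ℝ (f x) (g x)| ∂ν :=
        abs_integral_le_integral_abs
    _ ≤ ∫ x, β * (‖f x‖ * ‖g x‖) ∂ν := by
        refine integral_mono_of_nonneg (ae_of_all _ fun _ => abs_nonneg _)
          ((hf.norm.integrable_mul hg.norm).const_mul β) ?_
        filter_upwards [hA] with x hx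
        rw [abs_mul]
        exact mul_le_mul hx (abs_real_inner_le_norm _ _) (abs_nonneg _) hβ
    _ = β * ∫ x, ‖f x‖ * ‖g x‖ ∂ν := integral_const_mul _ _
    _ ≤ _ := by gcongr; exact (le_abs_self _).trans h

end Lp

/-- The Poincaré inequality on convex subsets for functions in `H¹₀(Ω)`. -/
theorem H10.poincare (u : H10 Ω) {S : Set (Euc d)} (hS : MeasurableSet S) (hSΩ : S ⊆ Ω)
    (hc : Convex ℝ S) (hfin : volume S ≠ ∞)
    {D : ℝ} (hD0 : 0 ≤ D) (hD : ∀ x ∈ S, ∀ y ∈ S, ‖x - y‖ ^ 2 ≤ D) :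
    volume.real S * (∫ x in S, fnOf u x ^ 2) - (∫ x in S, fnOf u x) ^ 2 ≤
      D * 2 ^ d * volume.real S * ∫ x in S, ‖gradOf u x‖ ^ 2 := by
  have hr : (volume.restrict Ω).restrict S = volume.restrict S :=
    Measure.restrict_restrict_of_subset hSΩ
  have hfin' : (volume.restrict Ω) S ≠ ∞ := by
    rw [Measure.restrict_apply hS, inter_eq_left.2 hSΩ]; exact hfin
  let R1 := LpToLpRestrictCLM (Euc d) ℝ ℝ (volume.restrict Ω) 2 S
  let R2 := LpToLpRestrictCLM (Euc d) (Euc d) ℝ (volume.restrict Ω) 2 S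
  have e1 : ∀ f : L2 Ω, ∫ x in S, f x ^ 2 = ‖R1 f‖ ^ 2 := fun f => by
    rw [L2_norm_sq, ← hr]
    refine integral_congr_ae ?_
    filter_upwards [LpToLpRestrictCLM_coeFn ℝ S f] with x hx
    rw [hx, Real.norm_eq_abs, sq_abs]
  have e2 : ∀ f, ∫ x in S, ‖f x‖ ^ 2 = ‖R2 f‖ ^ 2 := fun f => by
    rw [L2_norm_sq, ← hr]
    refine integral_congr_ae ?_
    filter_upwards [LpToLpRestrictCLM_coeFn ℝ S f] with x hx
    rw [hx]
  have e3 : ∀ f : L2 Ω, ∫ x in S, f x = inner ℝ (indicatorConstLp 2 hS hfin' (1 : ℝ)) f :=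
    fun f => by
    rw [L2.inner_indicatorConstLp_one, ← hr]
  -- Restriction to `S` is a bounded operator and the integral over `S` is an inner product with the
  -- indicator of `S`, so both sides are continuous in the pair.
  have key := H10.mem_of_isClosed u
    (P := {z | volume.real S * ‖R1 z.fst‖ ^ 2 -
      (inner ℝ (indicatorConstLp 2 hS hfin' (1 : ℝ)) z.fst) ^ 2 ≤
      D * 2 ^ d * volume.real S * ‖R2 z.snd‖ ^ 2})
    (isClosed_le (by fun_prop) (by fun_prop)) ?_
  · simp only [mem_ofPred_eq, ← e1, ← e2, ← e3] at key
    exact key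
  · rintro z ⟨φ, hφ, hz1, hz2⟩
    simp only [mem_ofPred_eq, ← e1, ← e2, ← e3]
    have h1 : ∀ᵐ x ∂volume.restrict S, z.fst x = φ x :=
      ae_restrict_of_ae_restrict_of_subset hSΩ hz1
    have h2 : ∀ᵐ x ∂volume.restrict S, z.snd x = gradient φ x :=
      ae_restrict_of_ae_restrict_of_subset hSΩ hz2
    have := poincare_smooth hS hc hfin hD0 hD hφ
    rw [integral_congr_ae (h1.mono fun x hx => congrArg (· ^ 2) hx), integral_congr_ae h1,
      integral_congr_ae (h2.mono fun x hx => congrArg (‖·‖ ^ 2) hx)]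
    exact this

theorem convex_openCell (K : BoxIntegral.Box (Fin d)) : Convex ℝ (openCell K) := by
  rw [openCell_eq_preimage]
  exact (convex_pi fun i _ => convex_Ioo _ _).linear_preimage
    (EuclideanSpace.equiv (Fin d) ℝ).toLinearMap

theorem volume_real_openCell_pos (K : BoxIntegral.Box (Fin d)) : 0 < volume.real (openCell K) := by
  rw [Measure.real, volume_openCell, ENNReal.toReal_ofReal (prod_side_pos K).le]
  exact prod_side_pos K

namespace H10

variable {H κ : ℝ} {T : Finset (BoxIntegral.Box (Fin d))}

theorem memLp_fnOf (hT : IsRectMesh Ω H κ T) {K : BoxIntegral.Box (Fin d)} (hK : K ∈ T)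
    (f : L2 Ω) : MemLp f 2 (volume.restrict (openCell K)) :=
  (Lp.memLp f).mono_measure (hT.restrict_le hK)

theorem memLp_gradOf (hT : IsRectMesh Ω H κ T) {K : BoxIntegral.Box (Fin d)} (hK : K ∈ T)
    (f : Lp (Euc d) 2 (volume.restrict Ω)) : MemLp f 2 (volume.restrict (openCell K)) :=
  (Lp.memLp f).mono_measure (hT.restrict_le hK)

/-- The squared diameter of a cell is at most `d * (κ * H) ^ 2`; the Poincaré inequality is then
divided by the volume. -/
theorem variance_cell_le (hT : IsRectMesh Ω H κ T) {K : BoxIntegral.Box (Fin d)} (hK : K ∈ T)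
    (u : H10 Ω) :
    (∫ x in openCell K, fnOf u x ^ 2) - (volume.real (openCell K))⁻¹ *
      (∫ x in openCell K, fnOf u x) ^ 2 ≤
      d * κ ^ 2 * 2 ^ d * H ^ 2 * ∫ x in openCell K, ‖gradOf u x‖ ^ 2 := by
  have h := H10.poincare u (measurableSet_openCell K) (hT.openCell_subset hK) (convex_openCell K)
    (volume_openCell_ne_top K) (D := d * (κ * H) ^ 2) (by positivity) fun x hx y hy => by
      rw [EuclideanSpace.norm_sq_eq]
      calc ∑ i, ‖(x - y) i‖ ^ 2 ≤ ∑ _i : Fin d, (κ * H) ^ 2 := by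
            refine Finset.sum_le_sum fun i _ => ?_
            have := hT.side_le K hK i
            rw [Real.norm_eq_abs]
            refine pow_le_pow_left₀ (abs_nonneg _) (abs_le.2 ⟨?_, ?_⟩) 2 <;>
            · rw [PiLp.sub_apply]; linarith [(hx i).1, (hx i).2, (hy i).1, (hy i).2]
        _ = _ := by simp
  have hV := volume_real_openCell_pos K
  refine le_of_mul_le_mul_left ?_ hV
  rw [mul_sub, mul_inv_cancel_left₀ hV.ne']
  refine h.trans (le_of_eq ?_)
  ring

theorem integral_sq_le_of_mean_zero (hT : IsRectMesh Ω H κ T) {K : BoxIntegral.Box (Fin d)}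
    (hK : K ∈ T) (u : H10 Ω) (h0 : ∫ x in openCell K, fnOf u x = 0) :
    ∫ x in openCell K, fnOf u x ^ 2 ≤
      d * κ ^ 2 * 2 ^ d * H ^ 2 * ∫ x in openCell K, ‖gradOf u x‖ ^ 2 := by
  have := variance_cell_le hT hK u
  rw [h0] at this
  simpa using this

/-- Since `w` has mean zero, the mean of `v` can be subtracted from `v` at no cost. Poincaré then
applies to both factors and each gives one power of `H`; this is the source of `H ^ 2` in the final
estimate. -/
theorem abs_integral_mul_le_of_mean_zero (hT : IsRectMesh Ω H κ T) {K : BoxIntegral.Box (Fin d)}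
    (hK : K ∈ T) (v w : H10 Ω) (h0 : ∫ x in openCell K, fnOf w x = 0) :
    |∫ x in openCell K, fnOf v x * fnOf w x| ≤ d * κ ^ 2 * 2 ^ d * H ^ 2 *
      (Real.sqrt (∫ x in openCell K, ‖gradOf v x‖ ^ 2) *
        Real.sqrt (∫ x in openCell K, ‖gradOf w x‖ ^ 2)) := by
  have : IsFiniteMeasure (volume.restrict (openCell K)) :=
    isFiniteMeasure_restrict.2 (volume_openCell_ne_top K)
  have hV := volume_real_openCell_pos K
  set V := volume.real (openCell K) with hVdef
  have mv := memLp_fnOf hT hK (fnOf v)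
  have mw := memLp_fnOf hT hK (fnOf w)
  set m := V⁻¹ * ∫ x in openCell K, fnOf v x with hm
  have e1 : ∫ x in openCell K, fnOf v x * fnOf w x =
      ∫ x in openCell K, (fnOf v x - m) * fnOf w x := by
    simp_rw [sub_mul]
    rw [integral_sub (f := fun x => fnOf v x * fnOf w x) (mv.integrable_mul mw)
      ((mw.integrable (by norm_num)).const_mul m),
      integral_const_mul, h0, mul_zero, sub_zero]
  have e2 : ∫ x in openCell K, (fnOf v x - m) ^ 2 =
      (∫ x in openCell K, fnOf v x ^ 2) - V⁻¹ * (∫ x in openCell K, fnOf v x) ^ 2 := by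
    have : ∀ x, (fnOf v x - m) ^ 2 = (fnOf v x ^ 2 - (2 * m) * fnOf v x) + m ^ 2 :=
      fun x => by ring
    simp_rw [this]
    rw [integral_add, integral_sub, integral_const_mul, setIntegral_const, smul_eq_mul, ← hVdef]
    · rw [hm]; field_simp; ring
    · exact mv.integrable_sq
    · exact (mv.integrable (by norm_num)).const_mul _
    · exact mv.integrable_sq.sub ((mv.integrable (by norm_num)).const_mul _)
    · exact integrable_const _
  set c := (d : ℝ) * κ ^ 2 * 2 ^ d * H ^ 2 with hc
  have hc0 : 0 ≤ c := by positivity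
  rw [e1]
  refine (abs_integral_mul_le (mv.sub (memLp_const m)) mw).trans ?_
  simp only [Pi.sub_apply]
  rw [e2]
  calc _ ≤ Real.sqrt (c * ∫ x in openCell K, ‖gradOf v x‖ ^ 2) *
        Real.sqrt (c * ∫ x in openCell K, ‖gradOf w x‖ ^ 2) := by
        gcongr
        · exact variance_cell_le hT hK v
        · exact integral_sq_le_of_mean_zero hT hK w h0
    _ = (Real.sqrt c * Real.sqrt c) * (Real.sqrt (∫ x in openCell K, ‖gradOf v x‖ ^ 2) *
        Real.sqrt (∫ x in openCell K, ‖gradOf w x‖ ^ 2)) := by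
        rw [Real.sqrt_mul hc0, Real.sqrt_mul hc0]; ring
    _ = _ := by rw [Real.mul_self_sqrt hc0]

end H10

end

noncomputable section

/-! ### Bubble corrections -/

open scoped ENNReal

variable {d : ℕ} {Ω : Set (Euc d)}

/-- The value of a polynomial in `d` variables at a point of `ℝ^d`. -/
abbrev polyEval (q : MvPolynomial (Fin d) ℝ) (x : Euc d) : ℝ := MvPolynomial.eval (fun i => x i) q

theorem contDiff_polyEval (q : MvPolynomial (Fin d) ℝ) {n : ℕ∞} : ContDiff ℝ n (polyEval q) := by
  unfold polyEval
  simp_rw [MvPolynomial.eval_eq']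
  exact ContDiff.sum fun s _ => contDiff_const.mul
    (contDiff_prod fun i _ => ContDiff.pow (by fun_prop) _)

theorem continuous_polyEval (q : MvPolynomial (Fin d) ℝ) : Continuous (polyEval q) :=
  (contDiff_polyEval q (n := 0)).continuous

/-- The substitution acts on each variable separately and so raises no partial degree. A general
linear change of variables could. -/
theorem exists_affine_comp {p : ℕ} {q : MvPolynomial (Fin d) ℝ}
    (hq : q ∈ MvPolynomial.restrictDegree (Fin d) ℝ p) (a c : Fin d → ℝ) :
    ∃ q' ∈ MvPolynomial.restrictDegree (Fin d) ℝ p, ∀ y : Fin d → ℝ,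
      MvPolynomial.eval y q' = MvPolynomial.eval (fun i => a i + c i * y i) q := by
  classical
  refine ⟨∑ s ∈ q.support, MvPolynomial.C (q.coeff s) *
    ∏ i, (MvPolynomial.C (a i) + MvPolynomial.C (c i) * MvPolynomial.X i) ^ s i, ?_, fun y => ?_⟩
  · refine Submodule.sum_mem _ fun s hs => ?_
    rw [MvPolynomial.mem_restrictDegree] at hq ⊢
    intro t ht j
    refine (MvPolynomial.degreeOf_le_iff.1 ?_ t ht).trans (hq s hs j)
    refine (MvPolynomial.degreeOf_C_mul_le _ _ _).trans ?_
    refine (MvPolynomial.degreeOf_prod_le _ _ _).trans ?_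
    calc _ ≤ ∑ i, if i = j then s j else 0 := by
          refine Finset.sum_le_sum fun i _ => ?_
          refine (MvPolynomial.degreeOf_pow_le _ _ _).trans ?_
          have : MvPolynomial.degreeOf j (MvPolynomial.C (a i) + MvPolynomial.C (c i) *
              MvPolynomial.X i : MvPolynomial (Fin d) ℝ) ≤ if i = j then 1 else 0 := by
            refine (MvPolynomial.degreeOf_add_le _ _ _).trans (max_le ?_ ?_)
            · simp
            · refine (MvPolynomial.degreeOf_C_mul_le _ _ _).trans ?_
              rw [MvPolynomial.degreeOf_X]
              simp [eq_comm]
          refine (Nat.mul_le_mul_left _ this).trans ?_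
          split_ifs with h
          · subst h; simp
          · simp
      _ = s j := by simp
  · rw [map_sum, MvPolynomial.eval_eq' _ q]
    simp [map_prod]

/-- The unit cube. -/
def unitBox (d : ℕ) : BoxIntegral.Box (Fin d) := ⟨0, 1, fun _ => zero_lt_one⟩

/-- The middle third of the unit cube. -/
def middleBox (d : ℕ) : BoxIntegral.Box (Fin d) :=
  ⟨fun _ => 1 / 3, fun _ => 2 / 3, fun _ => by norm_num⟩

theorem isCompact_cell (K : BoxIntegral.Box (Fin d)) : IsCompact (cell K) := by
  rw [cell_eq_preimage]
  exact (EuclideanSpace.equiv (Fin d) ℝ).toHomeomorph.isCompact_preimage.2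
    (isCompact_univ_pi fun i => isCompact_Icc)

/-- With slope 6 the plateau over `[1/3, 2/3]` has dropped to zero at `1/6` and `5/6`, strictly
inside the unit cube. -/
theorem isTestFunction_boxPlateau :
    IsTestFunction (openCell (unitBox d)) (boxPlateau 6 (middleBox d)) := by
  let B : BoxIntegral.Box (Fin d) := ⟨fun _ => 1 / 6, fun _ => 5 / 6, fun _ => by norm_num⟩
  have h0 : ∀ x ∉ cell B, boxPlateau 6 (middleBox d) x = 0 := by
    intro x hx
    simp only [cell, mem_ofPred_eq, not_forall] at hx
    obtain ⟨i, hi⟩ := hx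
    refine boxPlateau_eq_zero (i := i) ?_
    simp only [B, mem_Icc, not_and_or, not_le] at hi
    simp only [middleBox]
    rcases hi with hi | hi
    · left; linarith
    · right; linarith
  refine ⟨contDiff_boxPlateau _ _, HasCompactSupport.intro (isCompact_cell B) h0, ?_⟩
  refine (closure_minimal (fun x hx => ?_) (isClosed_cell B)).trans (fun x hx i => ?_)
  · by_contra h
    exact hx (h0 x h)
  · have := hx i
    simp only [B, mem_Icc] at this
    simp only [unitBox, mem_Ioo, Pi.zero_apply, Pi.one_apply]
    constructor <;> linarith

theorem IsTestFunction.mul_polyEval {φ : Euc d → ℝ} (h : IsTestFunction Ω φ)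
    (q : MvPolynomial (Fin d) ℝ) : IsTestFunction Ω (fun x => φ x * polyEval q x) :=
  ⟨h.1.mul (contDiff_polyEval q), h.2.1.mul_right, tsupport_mul_subset_left.trans h.2.2⟩

theorem IsTestFunction.integrable {φ : Euc d → ℝ} (h : IsTestFunction Ω φ) : Integrable φ :=
  h.1.continuous.integrable_of_hasCompactSupport h.2.1

/-- Polynomials on the unit cube are determined by, and can be recovered from, their moments against
finitely many smooth functions with compact support in the cube. -/
theorem exists_dual_testFunctions (d p : ℕ) :
    ∃ (n : ℕ) (ζ : Fin n → Euc d → ℝ) (b : Fin n → MvPolynomial (Fin d) ℝ),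
      (∀ j, b j ∈ MvPolynomial.restrictDegree (Fin d) ℝ p) ∧
      (∀ j, IsTestFunction (openCell (unitBox d)) (ζ j)) ∧
      ∀ q ∈ MvPolynomial.restrictDegree (Fin d) ℝ p, q = ∑ j, (∫ x, ζ j x * polyEval q x) • b j := by
  set R := MvPolynomial.restrictDegree (Fin d) ℝ p with hR
  set ψ := boxPlateau 6 (middleBox d) with hψ
  have tψ : IsTestFunction (openCell (unitBox d)) ψ := isTestFunction_boxPlateau
  have hint : ∀ r q : MvPolynomial (Fin d) ℝ,
      Integrable fun x : Euc d => ψ x * polyEval r x * polyEval q x := fun r q =>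
    ((tψ.mul_polyEval r).mul_polyEval q).integrable
  -- The `L²` inner product with weight `ψ` on the finite-dimensional space of polynomials.
  let Φ : R →ₗ[ℝ] R →ₗ[ℝ] ℝ := LinearMap.mk₂ ℝ
    (fun r q => ∫ x, ψ x * polyEval (r : MvPolynomial (Fin d) ℝ) x *
      polyEval (q : MvPolynomial (Fin d) ℝ) x)
    (fun r r' q => by
      rw [← integral_add (hint _ _) (hint _ _)]
      congr 1; ext x; simp [polyEval]; ring)
    (fun c r q => by
      rw [smul_eq_mul, ← integral_const_mul]
      congr 1; ext x; simp [polyEval, MvPolynomial.smul_eval]; ring)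
    (fun r q q' => by
      rw [← integral_add (hint _ _) (hint _ _)]
      congr 1; ext x; simp [polyEval]; ring)
    (fun c r q => by
      rw [smul_eq_mul, ← integral_const_mul]
      congr 1; ext x; simp [polyEval, MvPolynomial.smul_eval]; ring)
  have hΦ : ∀ r q : R, Φ r q = ∫ x, ψ x * polyEval (r : MvPolynomial (Fin d) ℝ) x *
      polyEval (q : MvPolynomial (Fin d) ℝ) x := fun r q => rfl
  -- Definiteness: a polynomial of zero weighted norm vanishes on the middle third, where the weight
  -- is 1, and a polynomial vanishing on a product of infinite sets is zero.
  have hinj : Function.Injective Φ := by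
    rw [injective_iff_map_eq_zero]
    intro r hr
    have h1 : ∫ x, ψ x * polyEval (r : MvPolynomial (Fin d) ℝ) x *
      polyEval (r : MvPolynomial (Fin d) ℝ) x = 0 := by
      rw [← hΦ, hr]; rfl
    rw [integral_eq_zero_iff_of_nonneg (fun x => by
      simp only [Pi.zero_apply, mul_assoc]
      exact mul_nonneg (boxPlateau_nonneg _ _ _) (mul_self_nonneg _)) (hint _ _)] at h1
    have h2 := (Continuous.ae_eq_iff_eq volume
      (((tψ.mul_polyEval _).mul_polyEval _).1.continuous) continuous_zero).1 h1
    refine Subtype.ext ?_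
    refine MvPolynomial.funext_set (fun _ => Icc (1 / 3 : ℝ) (2 / 3))
      (fun _ => Icc_infinite (by norm_num)) fun y hy => ?_
    have h3 := congrFun h2 (WithLp.toLp 2 y)
    have hy' : (WithLp.toLp 2 y : Euc d) ∈ cell (middleBox d) := fun i => hy i (mem_univ i)
    rw [hψ, boxPlateau_eq_one (by norm_num) hy'] at h3
    simpa using h3
  have hsurj : Function.Surjective Φ :=
    (LinearMap.injective_iff_surjective_of_finrank_eq_finrank
      (Subspace.dual_finrank_eq (K := ℝ) (V := R)).symm).1 hinj
  let β := Module.finBasis ℝ R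
  -- Riesz representatives of the coordinate functionals: the moments of a polynomial against `ψ * r
  -- j` are its coordinates in the basis `β`.
  choose r hr using fun j => hsurj (β.coord j)
  refine ⟨_, fun j x => ψ x * polyEval (r j : MvPolynomial (Fin d) ℝ) x,
    fun j => (β j : MvPolynomial (Fin d) ℝ), fun j => (β j).2, fun j => tψ.mul_polyEval _,
    fun q hq => ?_⟩
  have h1 : ∀ j, ∫ x, ψ x * polyEval (r j : MvPolynomial (Fin d) ℝ) x * polyEval q x =
      β.repr ⟨q, hq⟩ j := fun j => by
    rw [← β.coord_apply, ← hr j]; rfl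
  simp_rw [h1]
  have h2 := congrArg (Subtype.val : R → MvPolynomial (Fin d) ℝ) (β.sum_repr ⟨q, hq⟩)
  rw [Submodule.coe_sum] at h2
  exact h2.symm

/-! ### Affine maps between a box and the unit cube -/

/-- The linear part of the affine map from a box to the unit cube. -/
def boxScale (K : BoxIntegral.Box (Fin d)) : Euc d →L[ℝ] Euc d :=
  (EuclideanSpace.equiv (Fin d) ℝ).symm.toContinuousLinearMap.comp
    (ContinuousLinearMap.pi fun i => (K.upper i - K.lower i)⁻¹ • EuclideanSpace.proj i)

theorem boxScale_apply (K : BoxIntegral.Box (Fin d)) (x : Euc d) (i : Fin d) :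
    boxScale K x i = (K.upper i - K.lower i)⁻¹ * x i := by
  simp [boxScale]

/-- The affine map that takes the box `K` to the unit cube. -/
def toUnit (K : BoxIntegral.Box (Fin d)) (x : Euc d) : Euc d :=
  boxScale K (x - WithLp.toLp 2 K.lower)

theorem toUnit_apply (K : BoxIntegral.Box (Fin d)) (x : Euc d) (i : Fin d) :
    toUnit K x i = (K.upper i - K.lower i)⁻¹ * (x i - K.lower i) := by
  rw [toUnit, boxScale_apply]; simp

theorem contDiff_toUnit (K : BoxIntegral.Box (Fin d)) {n : ℕ∞} : ContDiff ℝ n (toUnit K) := by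
  unfold toUnit
  fun_prop

theorem hasFDerivAt_toUnit (K : BoxIntegral.Box (Fin d)) (x : Euc d) :
    HasFDerivAt (toUnit K) (boxScale K) x := by
  have := (boxScale K).hasFDerivAt (x := x - WithLp.toLp 2 K.lower)
  have h := this.comp x ((hasFDerivAt_id x).sub_const (WithLp.toLp 2 K.lower))
  rw [ContinuousLinearMap.comp_id] at h
  exact h

/-- The inverse of `toUnit`. -/
def fromUnit (K : BoxIntegral.Box (Fin d)) (y : Euc d) : Euc d :=
  WithLp.toLp 2 fun i => K.lower i + (K.upper i - K.lower i) * y i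

theorem toUnit_fromUnit (K : BoxIntegral.Box (Fin d)) (y : Euc d) : toUnit K (fromUnit K y) = y := by
  ext i
  have := (sub_pos.2 (K.lower_lt_upper i)).ne'
  rw [toUnit_apply]; simp only [fromUnit]; field_simp; ring

theorem fromUnit_toUnit (K : BoxIntegral.Box (Fin d)) (x : Euc d) : fromUnit K (toUnit K x) = x := by
  ext i
  have := (sub_pos.2 (K.lower_lt_upper i)).ne'
  simp only [fromUnit, toUnit_apply]; field_simp; ring

theorem toUnit_mem_openCell {K : BoxIntegral.Box (Fin d)} {x : Euc d} :
    toUnit K x ∈ openCell (unitBox d) ↔ x ∈ openCell K := by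
  simp only [openCell, mem_ofPred_eq]
  refine forall_congr' fun i => ?_
  have := (sub_pos.2 (K.lower_lt_upper i))
  rw [toUnit_apply]
  simp only [unitBox, mem_Ioo, Pi.zero_apply, Pi.one_apply]
  rw [inv_mul_lt_iff₀ this, mul_pos_iff_of_pos_left (inv_pos.2 this)]
  constructor <;> rintro ⟨h1, h2⟩ <;> constructor <;> linarith

theorem volume_real_unitBox : volume.real (openCell (unitBox d)) = 1 := by
  rw [Measure.real, volume_openCell]
  simp [unitBox]

/-- The determinant need not be computed: the change of variables, applied to the indicator of the
unit cube, shows that its absolute value is the reciprocal of the volume of the cell. -/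
theorem integral_comp_toUnit (K : BoxIntegral.Box (Fin d)) (g : Euc d → ℝ) :
    ∫ x, g (toUnit K x) = volume.real (openCell K) * ∫ y, g y := by
  have himg : toUnit K '' univ = univ := by
    rw [image_univ]; exact (Function.LeftInverse.surjective (toUnit_fromUnit K)).range_eq
  have h : ∀ g : Euc d → ℝ, ∫ y, g y = |(boxScale K).det| * ∫ x, g (toUnit K x) := by
    intro g
    have := integral_image_eq_integral_abs_det_fderiv_smul volume MeasurableSet.univ
      (fun x _ => (hasFDerivAt_toUnit K x).hasFDerivWithinAt)
      (Function.LeftInverse.injective (fromUnit_toUnit K)).injOn g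
    rw [himg] at this
    simpa [integral_const_mul] using this
  have h1 := h ((openCell (unitBox d)).indicator fun _ => 1)
  have e : (fun x => (openCell (unitBox d)).indicator (fun _ => (1 : ℝ)) (toUnit K x)) =
      (openCell K).indicator fun _ => 1 := by
    ext x
    by_cases hx : x ∈ openCell K
    · rw [indicator_of_mem hx, indicator_of_mem (toUnit_mem_openCell.2 hx)]
    · rw [indicator_of_notMem hx, indicator_of_notMem fun h => hx (toUnit_mem_openCell.1 h)]
  rw [e, integral_indicator (measurableSet_openCell _), integral_indicator (measurableSet_openCell _),
    setIntegral_const, setIntegral_const, volume_real_unitBox, smul_eq_mul, smul_eq_mul, mul_one,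
    mul_one] at h1
  rw [h g, ← mul_assoc, mul_comm (volume.real _), ← h1, one_mul]

theorem norm_boxScale_le {K : BoxIntegral.Box (Fin d)} {c : ℝ} (hc : 0 ≤ c)
    (h : ∀ i, (K.upper i - K.lower i)⁻¹ ≤ c) : ‖boxScale K‖ ≤ c := by
  refine ContinuousLinearMap.opNorm_le_bound _ hc fun x => ?_
  refine le_of_sq_le_sq ?_ (by positivity)
  rw [mul_pow, EuclideanSpace.norm_sq_eq, EuclideanSpace.norm_sq_eq, Finset.mul_sum]
  refine Finset.sum_le_sum fun i _ => ?_
  rw [boxScale_apply, norm_mul, mul_pow]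
  have := inv_nonneg.2 (sub_pos.2 (K.lower_lt_upper i)).le
  rw [Real.norm_of_nonneg this]
  gcongr
  exact h i

theorem IsTestFunction.comp_toUnit {ζ : Euc d → ℝ} (h : IsTestFunction (openCell (unitBox d)) ζ)
    (K : BoxIntegral.Box (Fin d)) : IsTestFunction (openCell K) (fun x => ζ (toUnit K x)) := by
  have hcl : IsClosed (toUnit K ⁻¹' tsupport ζ) :=
    (isClosed_tsupport ζ).preimage (contDiff_toUnit K (n := 0)).continuous
  have hsub : tsupport (fun x => ζ (toUnit K x)) ⊆ toUnit K ⁻¹' tsupport ζ :=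
    closure_minimal (fun x hx => subset_tsupport ζ hx) hcl
  have hsub' : tsupport (fun x => ζ (toUnit K x)) ⊆ openCell K := fun x hx =>
    toUnit_mem_openCell.1 (h.2.2 (hsub hx))
  exact ⟨h.1.comp (contDiff_toUnit K), (isCompact_cell K).of_isClosed_subset (isClosed_tsupport _)
    (hsub'.trans (openCell_subset_cell K)), hsub'⟩

theorem memLp_polyEval (q : MvPolynomial (Fin d) ℝ) (K : BoxIntegral.Box (Fin d)) :
    MemLp (polyEval q) 2 (volume.restrict (openCell K)) := by
  have : IsFiniteMeasure (volume.restrict (openCell K)) :=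
    isFiniteMeasure_restrict.2 (volume_openCell_ne_top K)
  obtain ⟨B, hB⟩ := (isCompact_cell K).exists_bound_of_continuousOn
    (continuous_polyEval q).continuousOn
  refine MemLp.of_bound (continuous_polyEval q).aestronglyMeasurable B ?_
  filter_upwards [ae_restrict_mem (measurableSet_openCell K)] with x hx
  exact hB x (openCell_subset_cell K hx)

theorem IsTestFunction.setIntegral_mul {K : BoxIntegral.Box (Fin d)} {φ : Euc d → ℝ}
    (h : IsTestFunction (openCell K) φ) (g : Euc d → ℝ) :
    ∫ x in openCell K, φ x * g x = ∫ x, φ x * g x :=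
  setIntegral_eq_integral_of_forall_compl_eq_zero fun x hx => by
    rw [image_eq_zero_of_notMem_tsupport fun h' => hx (h.2.2 h'), zero_mul]

theorem exists_comp_toUnit {p : ℕ} {q : MvPolynomial (Fin d) ℝ}
    (hq : q ∈ MvPolynomial.restrictDegree (Fin d) ℝ p) (K : BoxIntegral.Box (Fin d)) :
    ∃ q' ∈ MvPolynomial.restrictDegree (Fin d) ℝ p, ∀ x, polyEval q' x = polyEval q (toUnit K x) := by
  obtain ⟨q', h1, h2⟩ := exists_affine_comp hq
    (fun i => -((K.upper i - K.lower i)⁻¹ * K.lower i)) (fun i => (K.upper i - K.lower i)⁻¹)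
  refine ⟨q', h1, fun x => ?_⟩
  rw [polyEval, h2, polyEval]
  congr 2
  ext i
  rw [toUnit_apply]; ring

theorem exists_comp_fromUnit {p : ℕ} {q : MvPolynomial (Fin d) ℝ}
    (hq : q ∈ MvPolynomial.restrictDegree (Fin d) ℝ p) (K : BoxIntegral.Box (Fin d)) :
    ∃ q' ∈ MvPolynomial.restrictDegree (Fin d) ℝ p, ∀ x, polyEval q' (toUnit K x) = polyEval q x := by
  obtain ⟨q', h1, h2⟩ := exists_affine_comp hq K.lower (fun i => K.upper i - K.lower i)
  refine ⟨q', h1, fun x => ?_⟩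
  rw [polyEval, h2, polyEval]
  congr 2
  ext i
  exact congrArg (fun z : Euc d => z i) (fromUnit_toUnit K x)

/-- On a box, every square-integrable function has the same moments up to degree `p` as a smooth
function with compact support in the box, whose gradient is controlled. -/
theorem exists_bubble (d p : ℕ) {κ : ℝ} (hκ : 0 < κ) :
    ∃ C : ℝ, 0 ≤ C ∧ ∀ H : ℝ, 0 < H → ∀ K : BoxIntegral.Box (Fin d),
      (∀ i, H ≤ κ * (K.upper i - K.lower i)) → ∀ f : Euc d → ℝ,
      MemLp f 2 (volume.restrict (openCell K)) →
      ∃ φ : Euc d → ℝ, IsTestFunction (openCell K) φ ∧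
        (∀ q ∈ MvPolynomial.restrictDegree (Fin d) ℝ p,
          ∫ x in openCell K, φ x * polyEval q x = ∫ x in openCell K, f x * polyEval q x) ∧
        ((∀ q ∈ MvPolynomial.restrictDegree (Fin d) ℝ p,
          ∫ x in openCell K, f x * polyEval q x = 0) → ∀ x, φ x = 0) ∧
        ∫ x in openCell K, ‖gradient φ x‖ ^ 2 ≤ C / H ^ 2 * ∫ x in openCell K, f x ^ 2 := by
  obtain ⟨n, ζ, b, hb, hζ, hrep⟩ := exists_dual_testFunctions d p
  have hM : ∀ j, ∃ M, ∀ y, ‖fderiv ℝ (ζ j) y‖ ≤ M := fun j =>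
    ((hζ j).2.1.fderiv ℝ).exists_bound_of_continuous ((hζ j).1.continuous_fderiv (by simp))
  choose M hM using hM
  have hB : ∀ j, ∃ B, ∀ y ∈ cell (unitBox d), ‖polyEval (b j) y‖ ≤ B := fun j =>
    (isCompact_cell (unitBox d)).exists_bound_of_continuousOn (continuous_polyEval (b j)).continuousOn
  choose B hB using hB
  have hM0 : ∀ j, 0 ≤ M j := fun j => (norm_nonneg _).trans (hM j 0)
  have hB0 : ∀ j, 0 ≤ B j := fun j => by
    obtain ⟨y, hy⟩ := cell_nonempty (unitBox d)
    exact (norm_nonneg _).trans (hB j y hy)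
  -- `M j` and `B j` are bounds on the unit cube and depend only on `d` and `p`; `κ` comes from the
  -- norm `κ / H` of the scaling map.
  refine ⟨(∑ j, B j * M j * κ) ^ 2, sq_nonneg _, fun H hH K hK f hf => ?_⟩
  set V := volume.real (openCell K) with hV
  have hV0 : 0 < V := volume_real_openCell_pos K
  choose b' hb' hbb using fun j => exists_comp_toUnit (hb j) K
  -- Moments of `f` against the basis transported to `K`, normalized by the volume. Testing `∑ c j *
  -- ζ j ∘ toUnit K` with `q` gives `∑ c j * V * ∫ ζ j * q'`, where `q'` is `q` on the unit cube;
  -- the reproducing formula for `q'` turns this into `∫ f * q`.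
  set c : Fin n → ℝ := fun j => V⁻¹ * ∫ x in openCell K, f x * polyEval (b' j) x with hc
  have hζK : ∀ j, IsTestFunction (openCell K) (fun x => ζ j (toUnit K x)) := fun j =>
    (hζ j).comp_toUnit K
  have htest : IsTestFunction (openCell K) fun x => ∑ j, c j * ζ j (toUnit K x) :=
    IsTestFunction.sum fun j _ => (hζK j).const_mul (c j)
  refine ⟨fun x => ∑ j, c j * ζ j (toUnit K x), htest, fun q hq => ?_, fun h0 x => ?_, ?_⟩
  · obtain ⟨q', hq', hqq⟩ := exists_comp_fromUnit hq K
    have hmom : ∀ j, ∫ x, ζ j (toUnit K x) * polyEval q x = V * ∫ y, ζ j y * polyEval q' y :=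
      fun j => by
      rw [hV, ← integral_comp_toUnit K fun y => ζ j y * polyEval q' y]
      simp_rw [hqq]
    rw [htest.setIntegral_mul]
    simp_rw [Finset.sum_mul, mul_assoc]
    rw [integral_finsetSum _ fun j _ => ((hζK j).mul_polyEval q).integrable.const_mul (c j)]
    simp_rw [integral_const_mul, hmom]
    have hq2 : ∀ x, polyEval q x = ∑ j, (∫ y, ζ j y * polyEval q' y) * polyEval (b' j) x := by
      intro x
      have h := congrArg (fun r => polyEval r (toUnit K x)) (hrep q' hq')
      simp only [hqq] at h
      rw [h]
      simp only [polyEval, map_sum, MvPolynomial.smul_eval]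
      exact Finset.sum_congr rfl fun j _ => congrArg _ (hbb j x).symm
    have hi : ∀ j, IntegrableOn (fun x => f x * polyEval (b' j) x) (openCell K) := fun j =>
      hf.integrable_mul (memLp_polyEval (b' j) K)
    have hsplit : ∀ x, f x * polyEval q x =
        ∑ j, (∫ y, ζ j y * polyEval q' y) * (f x * polyEval (b' j) x) := fun x => by
      rw [hq2, Finset.mul_sum]
      exact Finset.sum_congr rfl fun j _ => by ring
    simp_rw [hsplit]
    rw [integral_finsetSum _ fun j _ => (hi j).const_mul _]
    refine Finset.sum_congr rfl fun j _ => ?_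
    rw [integral_const_mul, hc]
    field_simp
  · refine Finset.sum_eq_zero fun j _ => ?_
    rw [hc]
    simp only
    rw [h0 _ (hb' j), mul_zero, zero_mul]
  · set F := ∫ x in openCell K, f x ^ 2 with hF
    have hF0 : 0 ≤ F := integral_nonneg fun x => sq_nonneg _
    have hcj : ∀ j, |c j| ≤ V⁻¹ * (Real.sqrt F * (Real.sqrt V * B j)) := by
      intro j
      rw [hc]
      simp only
      rw [abs_mul, abs_of_pos (inv_pos.2 hV0)]
      refine mul_le_mul_of_nonneg_left ?_ (inv_pos.2 hV0).le
      refine (abs_integral_mul_le hf (memLp_polyEval (b' j) K)).trans ?_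
      refine mul_le_mul_of_nonneg_left ?_ (Real.sqrt_nonneg _)
      rw [← Real.sqrt_sq (hB0 j), ← Real.sqrt_mul hV0.le]
      refine Real.sqrt_le_sqrt ?_
      have : IsFiniteMeasure (volume.restrict (openCell K)) :=
        isFiniteMeasure_restrict.2 (volume_openCell_ne_top K)
      calc ∫ x in openCell K, polyEval (b' j) x ^ 2 ≤ ∫ _x in openCell K, B j ^ 2 := by
            refine setIntegral_mono_on (memLp_polyEval _ K).integrable_sq (integrable_const _)
              (measurableSet_openCell K) fun x hx => ?_
            rw [hbb, ← sq_abs]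
            exact pow_le_pow_left₀ (abs_nonneg _)
              (hB j _ (openCell_subset_cell _ (toUnit_mem_openCell.2 hx))) 2
        _ = V * B j ^ 2 := by rw [setIntegral_const, smul_eq_mul]
    have hscale : ‖boxScale K‖ ≤ κ / H := norm_boxScale_le (by positivity) fun i => by
      have h1 := sub_pos.2 (K.lower_lt_upper i)
      rw [inv_le_comm₀ h1 (by positivity), inv_div, div_le_iff₀' hκ]
      exact hK i
    have hgrad : ∀ x, ‖gradient (fun x => ∑ j, c j * ζ j (toUnit K x)) x‖ ≤
        (∑ j, B j * M j * κ) * (V⁻¹ * Real.sqrt F * Real.sqrt V / H) := by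
      intro x
      rw [norm_gradient]
      have hd : ∀ j, HasFDerivAt (fun x => c j * ζ j (toUnit K x))
          (c j • (fderiv ℝ (ζ j) (toUnit K x)).comp (boxScale K)) x := fun j =>
        ((((hζ j).1.differentiable (by simp) _).hasFDerivAt.comp x
          (hasFDerivAt_toUnit K x)).const_mul (c j))
      rw [(HasFDerivAt.fun_sum fun j _ => hd j).fderiv, Finset.sum_mul]
      refine (norm_sum_le _ _).trans (Finset.sum_le_sum fun j _ => ?_)
      rw [norm_smul]
      calc ‖c j‖ * ‖(fderiv ℝ (ζ j) (toUnit K x)).comp (boxScale K)‖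
          ≤ (V⁻¹ * (Real.sqrt F * (Real.sqrt V * B j))) * (M j * (κ / H)) := by
            refine mul_le_mul (hcj j) ?_ (norm_nonneg _) (by have := hB0 j; positivity)
            exact (ContinuousLinearMap.opNorm_comp_le _ _).trans
              (mul_le_mul (hM j _) hscale (norm_nonneg _) (hM0 j))
        _ = _ := by ring
    -- All powers of the volume cancel, so that only `H` remains in the bound.
    have hsq : ((∑ j, B j * M j * κ) * (V⁻¹ * Real.sqrt F * Real.sqrt V / H)) ^ 2 * V =
        (∑ j, B j * M j * κ) ^ 2 / H ^ 2 * F := by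
      rw [mul_pow, div_pow, mul_pow, mul_pow, Real.sq_sqrt hF0, Real.sq_sqrt hV0.le]
      generalize (∑ j, B j * M j * κ) = m
      field_simp
    rw [← hsq]
    have : IsFiniteMeasure (volume.restrict (openCell K)) :=
      isFiniteMeasure_restrict.2 (volume_openCell_ne_top K)
    calc _ ≤ ∫ _x in openCell K,
          ((∑ j, B j * M j * κ) * (V⁻¹ * Real.sqrt F * Real.sqrt V / H)) ^ 2 := by
          refine integral_mono (htest.memLp_gradient _).norm.integrable_sq (integrable_const _)
            fun x => ?_
          exact pow_le_pow_left₀ (norm_nonneg _) (hgrad x) 2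
      _ = _ := by rw [setIntegral_const, smul_eq_mul, mul_comm]

variable {H κ : ℝ} {T : Finset (BoxIntegral.Box (Fin d))} {p : ℕ}

/-- Orthogonality to the piecewise polynomials is a condition on the moments on every cell. -/
theorem IsRectMesh.mem_polySpace_orthogonal (hT : IsRectMesh Ω H κ T) {f : L2 Ω} :
    f ∈ (polySpace Ω T p)ᗮ ↔ ∀ K ∈ T, ∀ q ∈ MvPolynomial.restrictDegree (Fin d) ℝ p,
      ∫ x in openCell K, f x * polyEval q x = 0 := by
  classical
  rw [Submodule.mem_orthogonal]
  constructor
  · intro h K hK q hq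
    -- The test element is `q` on `K` extended by zero, which is admissible because no continuity
    -- across cells is required in `V_H`.
    have hmem : MemLp ((openCell K).indicator (polyEval q)) 2 (volume.restrict Ω) := by
      rw [memLp_indicator_iff_restrict (measurableSet_openCell K),
        Measure.restrict_restrict_of_subset (hT.openCell_subset hK)]
      exact memLp_polyEval q K
    have hV : hmem.toLp _ ∈ polySpace Ω T p := by
      intro L hL
      refine ⟨if L = K then q else 0, ?_, ?_⟩
      · split_ifs
        exacts [hq, Submodule.zero_mem _]
      · filter_upwards [hmem.coeFn_toLp, IsRectMesh.ae_mem_openCell_of_mem_cell L] with x hx hxL h'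
        rw [hx]
        have hxL := hxL h'
        split_ifs with hLK
        · rw [indicator_of_mem (hLK ▸ hxL)]
        · rw [indicator_of_notMem fun hxK => hLK (hT.eq_of_mem_openCell hL hK hxL hxK), map_zero]
    have := h _ hV
    rw [L2.inner_def] at this
    rw [← this, ← Measure.restrict_restrict_of_subset (hT.openCell_subset hK),
      ← integral_indicator (measurableSet_openCell K)]
    refine integral_congr_ae ?_
    filter_upwards [hmem.coeFn_toLp] with x hx
    rw [hx]
    by_cases hxK : x ∈ openCell K
    · rw [indicator_of_mem hxK, indicator_of_mem hxK]; rfl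
    · rw [indicator_of_notMem hxK, indicator_of_notMem hxK, inner_zero_left]
  · intro h r hr
    rw [L2.inner_def, hT.setIntegral_eq_sum]
    · refine Finset.sum_eq_zero fun K hK => ?_
      obtain ⟨q, hq, hrq⟩ := hr K hK
      rw [← h K hK q hq]
      refine integral_congr_ae ?_
      filter_upwards [hT.ae_openCell hK hrq, ae_restrict_mem (measurableSet_openCell K)]
        with x hx hxK
      rw [hx (openCell_subset_cell K hxK)]; rfl
    · exact L2.integrable_inner r f

/-- A correction in `H¹₀(Ω)` that has the same projection onto the piecewise polynomials as `f`, is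
local, and is controlled element by element. -/
theorem exists_correction (d p : ℕ) {κ : ℝ} (hκ : 0 < κ) :
    ∃ C : ℝ, 0 ≤ C ∧ ∀ (Ω : Set (Euc d)) (H : ℝ), 0 < H →
      ∀ T : Finset (BoxIntegral.Box (Fin d)), IsRectMesh Ω H κ T → ∀ f : L2 Ω,
      ∃ u : H10 Ω, f - fnOf u ∈ (polySpace Ω T p)ᗮ ∧ ∀ K ∈ T,
        ((∀ q ∈ MvPolynomial.restrictDegree (Fin d) ℝ p,
          ∫ x in openCell K, f x * polyEval q x = 0) →
          (∀ᵐ x ∂volume.restrict (openCell K), fnOf u x = 0) ∧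
          ∀ᵐ x ∂volume.restrict (openCell K), gradOf u x = 0) ∧
        ∫ x in openCell K, ‖gradOf u x‖ ^ 2 ≤ C / H ^ 2 * ∫ x in openCell K, f x ^ 2 := by
  classical
  obtain ⟨C, hC0, hC⟩ := exists_bubble d p hκ
  refine ⟨C, hC0, fun Ω H hH T hT f => ?_⟩
  have hex : ∀ K : T, _ := fun K => hC H hH K (hT.le_side K K.2) f (H10.memLp_fnOf hT K.2 f)
  choose φ hφ hmom hzero hgrad using hex
  have hφΩ : ∀ K : T, IsTestFunction Ω (φ K) := fun K =>
    ⟨(hφ K).1, (hφ K).2.1, (hφ K).2.2.trans (hT.openCell_subset K.2)⟩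
  -- The bubbles have supports in disjoint open cells, so near each point of an open cell the sum
  -- reduces to the bubble of that cell.
  have htest : IsTestFunction Ω fun x => ∑ K, φ K x := IsTestFunction.sum fun K _ => hφΩ K
  have hloc : ∀ K : T, ∀ x ∈ openCell (K : BoxIntegral.Box (Fin d)),
      (fun x => ∑ L, φ L x) =ᶠ[nhds x] φ K := by
    intro K x hx
    filter_upwards [(isOpen_openCell (K : BoxIntegral.Box (Fin d))).mem_nhds hx] with y hy
    refine Finset.sum_eq_single K (fun L _ hLK => ?_) (fun h => absurd (Finset.mem_univ K) h)
    refine image_eq_zero_of_notMem_tsupport fun h => hLK ?_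
    exact Subtype.ext (hT.eq_of_mem_openCell L.2 K.2 ((hφ L).2.2 h) hy)
  have hfn : ∀ K : T, ∀ᵐ x ∂volume.restrict (openCell (K : BoxIntegral.Box (Fin d))),
      fnOf htest.toH10 x = φ K x := fun K => by
    filter_upwards [hT.ae_openCell K.2 htest.fnOf_toH10, ae_restrict_mem (measurableSet_openCell _)]
      with x hx hxK
    rw [hx]
    exact (hloc K x hxK).self_of_nhds
  have hgr : ∀ K : T, ∀ᵐ x ∂volume.restrict (openCell (K : BoxIntegral.Box (Fin d))),
      gradOf htest.toH10 x = gradient (φ K) x := fun K => by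
    filter_upwards [hT.ae_openCell K.2 htest.gradOf_toH10,
      ae_restrict_mem (measurableSet_openCell _)] with x hx hxK
    rw [hx, gradient, gradient, (hloc K x hxK).fderiv_eq]
  refine ⟨htest.toH10, hT.mem_polySpace_orthogonal.2 fun K hK q hq => ?_,
    fun K hK => ⟨fun h0 => ⟨?_, ?_⟩, ?_⟩⟩
  · have e : ∫ x in openCell K, (f - fnOf htest.toH10 : L2 Ω) x * polyEval q x =
        ∫ x in openCell K, (f x * polyEval q x - φ ⟨K, hK⟩ x * polyEval q x) := by
      refine integral_congr_ae ?_
      filter_upwards [hfn ⟨K, hK⟩, hT.ae_openCell hK (Lp.coeFn_sub f (fnOf htest.toH10))]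
        with x h1 h2
      rw [h2, Pi.sub_apply, h1, sub_mul]
    rw [e, integral_sub (f := fun x => f x * polyEval q x) ((H10.memLp_fnOf hT hK f).integrable_mul (memLp_polyEval q K))
      ((hφ ⟨K, hK⟩).mul_polyEval q).integrable.integrableOn, sub_eq_zero]
    exact (hmom ⟨K, hK⟩ q hq).symm
  · filter_upwards [hfn ⟨K, hK⟩] with x hx
    rw [hx, hzero ⟨K, hK⟩ h0]
  · filter_upwards [hgr ⟨K, hK⟩] with x hx
    rw [hx, show φ ⟨K, hK⟩ = fun _ => 0 from funext (hzero ⟨K, hK⟩ h0), gradient_fun_const]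
  · rw [integral_congr_ae ((hgr ⟨K, hK⟩).mono fun x hx => congrArg (‖·‖ ^ 2) hx)]
    exact hgrad ⟨K, hK⟩

end

noncomputable section

/-! ### Layers of elements and fine-scale cutoffs -/

open scoped ENNReal

variable {d : ℕ} {Ω : Set (Euc d)} {H κ : ℝ} {T : Finset (BoxIntegral.Box (Fin d))} {p : ℕ}

/-- The energy `‖∇u‖²` on one cell. -/
def cellEnergy (K : BoxIntegral.Box (Fin d)) (u : H10 Ω) : ℝ :=
  ∫ x in openCell K, ‖gradOf u x‖ ^ 2

theorem cellEnergy_nonneg (K : BoxIntegral.Box (Fin d)) (u : H10 Ω) : 0 ≤ cellEnergy K u :=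
  integral_nonneg fun _ => sq_nonneg _

theorem IsRectMesh.moment_eq_zero (hT : IsRectMesh Ω H κ T) {w : H10 Ω} (hw : w ∈ fineSpace Ω T p)
    {K : BoxIntegral.Box (Fin d)} (hK : K ∈ T) {q : MvPolynomial (Fin d) ℝ}
    (hq : q ∈ MvPolynomial.restrictDegree (Fin d) ℝ p) :
    ∫ x in openCell K, fnOf w x * polyEval q x = 0 :=
  hT.mem_polySpace_orthogonal.1 hw K hK q hq

theorem IsRectMesh.mean_eq_zero (hT : IsRectMesh Ω H κ T) {w : H10 Ω} (hw : w ∈ fineSpace Ω T p)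
    {K : BoxIntegral.Box (Fin d)} (hK : K ∈ T) : ∫ x in openCell K, fnOf w x = 0 := by
  have h1 : (1 : MvPolynomial (Fin d) ℝ) ∈ MvPolynomial.restrictDegree (Fin d) ℝ p := by
    rw [MvPolynomial.mem_restrictDegree]
    intro s hs i
    rw [MvPolynomial.mem_support_iff, MvPolynomial.coeff_one] at hs
    split_ifs at hs with h
    · rw [← h]; simp
    · exact absurd rfl hs
  have := hT.moment_eq_zero hw hK h1
  simpa [polyEval] using this

/-- The constant of the Poincaré inequality on the cells, in units of `H²`. -/
def poincareConst (d : ℕ) (κ : ℝ) : ℝ := d * κ ^ 2 * 2 ^ d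

theorem poincareConst_nonneg (d : ℕ) (κ : ℝ) : 0 ≤ poincareConst d κ := by
  unfold poincareConst; positivity

theorem IsRectMesh.integral_sq_le (hT : IsRectMesh Ω H κ T) {w : H10 Ω}
    (hw : w ∈ fineSpace Ω T p) {K : BoxIntegral.Box (Fin d)} (hK : K ∈ T) :
    ∫ x in openCell K, fnOf w x ^ 2 ≤ poincareConst d κ * H ^ 2 * cellEnergy K w :=
  H10.integral_sq_le_of_mean_zero hT hK w (hT.mean_eq_zero hw hK)

/-- Fine-scale functions can be cut off within the fine-scale space, with stability constant `C`: the
result vanishes on the elements in `S`, is unchanged on the elements that do not touch `S`, and is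
controlled on every element. -/
def HasFineCutoff (Ω : Set (Euc d)) (T : Finset (BoxIntegral.Box (Fin d))) (p : ℕ) (C : ℝ) : Prop :=
  ∀ S ⊆ T, ∀ w ∈ fineSpace Ω T p, ∃ w' ∈ fineSpace Ω T p,
    (∀ K ∈ S, ∀ᵐ x ∂volume.restrict (openCell K), fnOf w' x = 0) ∧
    (∀ K ∈ T, (∀ L ∈ S, ¬(cell L ∩ cell K).Nonempty) →
      ∀ᵐ x ∂volume.restrict (openCell K), fnOf w' x = fnOf w x) ∧
    (∀ K ∈ T, (∀ᵐ x ∂volume.restrict (openCell K), fnOf w x = 0) →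
      ∀ᵐ x ∂volume.restrict (openCell K), fnOf w' x = 0) ∧
    ∀ K ∈ T, cellEnergy K w' ≤ C * cellEnergy K w

/-- The cut-off is `θw - b`, where `b` is the sum of bubbles that carries the moments of `θw`. The
gradient of `θ` costs `|w| / H` and the bubble costs `‖θw‖ / H`; since `w` has mean zero on each
cell, Poincaré bounds both by the energy of `w` on that cell. -/
theorem exists_hasFineCutoff (d p : ℕ) {κ : ℝ} (hκ : 0 < κ) :
    ∃ C : ℝ, 0 < C ∧ ∀ (Ω : Set (Euc d)), IsOpen Ω → ∀ H : ℝ, 0 < H →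
      ∀ T : Finset (BoxIntegral.Box (Fin d)), IsRectMesh Ω H κ T → HasFineCutoff Ω T p C := by
  obtain ⟨Cθ, hCθ0, hCθ⟩ := exists_cutoff d hκ
  obtain ⟨Cb, hCb0, hCb⟩ := exists_correction d p hκ
  set P := poincareConst d κ with hP
  have hP0 : 0 ≤ P := poincareConst_nonneg d κ
  -- The summands bound the energies of `θw` and of the correction; the factors 2 come from `(a +
  -- b)² ≤ 2a² + 2b²`.
  refine ⟨2 * (2 + 2 * Cθ ^ 2 * P) + 2 * (Cb * P), by positivity, ?_⟩
  intro Ω hΩ H hH T hT S hS w hw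
  obtain ⟨θ, hθs, hθ01, hθL, hθ0, hθ1⟩ := hCθ Ω hΩ H hH T hT S hS
  have hθabs : ∀ x, |θ x| ≤ 1 := fun x => by rw [abs_of_nonneg (hθ01 x).1]; exact (hθ01 x).2
  obtain ⟨w₁, hw₁, hw₁g⟩ := H10.exists_mul hΩ hθs hθabs hθL w
  obtain ⟨b, hb, hbK⟩ := hCb Ω H hH T hT (fnOf w₁)
  have hsub : ∀ K ∈ T, ∀ᵐ x ∂volume.restrict (openCell K),
      fnOf (w₁ - b) x = θ x * fnOf w x - fnOf b x := fun K hK => by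
    filter_upwards [hT.ae_openCell hK hw₁, hT.ae_openCell hK (Lp.coeFn_sub (fnOf w₁) (fnOf b))]
      with x h1 h2
    rw [fnOf_sub, h2, Pi.sub_apply, h1]
  -- Where `θw` agrees on a cell with a function of vanishing moments, no correction is made. This
  -- covers the cells with `θ = 0`, with `θ = 1` and with `w = 0`.
  have hconst : ∀ K ∈ T, ∀ f : Euc d → ℝ,
      (∀ᵐ x ∂volume.restrict (openCell K), θ x * fnOf w x = f x) →
      (∀ q ∈ MvPolynomial.restrictDegree (Fin d) ℝ p, ∫ x in openCell K, f x * polyEval q x = 0) →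
      ∀ᵐ x ∂volume.restrict (openCell K), fnOf (w₁ - b) x = f x := by
    intro K hK f hf hf0
    have h0 := ((hbK K hK).1 fun q hq => ?_).1
    · filter_upwards [hsub K hK, hf, h0] with x h1 h2 h3
      rw [h1, h2, h3, sub_zero]
    · rw [← hf0 q hq]
      refine integral_congr_ae ?_
      filter_upwards [hT.ae_openCell hK hw₁, hf] with x h1 h2
      rw [h1, h2]
  refine ⟨w₁ - b, hb, fun K hK => ?_, fun K hK hKS => ?_, fun K hK h0 => ?_, fun K hK => ?_⟩
  · refine hconst K (hS hK) (fun _ => 0) ?_ (by simp)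
    filter_upwards [ae_restrict_mem (measurableSet_openCell K)] with x hx
    rw [hθ0 K hK x (openCell_subset_cell K hx), zero_mul]
  · refine hconst K hK (fnOf w) ?_ fun q hq => hT.moment_eq_zero hw hK hq
    filter_upwards [ae_restrict_mem (measurableSet_openCell K)] with x hx
    rw [hθ1 K hK hKS x (openCell_subset_cell K hx), one_mul]
  · refine hconst K hK (fun _ => 0) ?_ (by simp)
    filter_upwards [h0] with x hx
    rw [hx, mul_zero]
  · have hPK : ∫ x in openCell K, fnOf w x ^ 2 ≤ P * H ^ 2 * cellEnergy K w :=
      hT.integral_sq_le hw hK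
    have mw := H10.memLp_fnOf hT hK (fnOf w)
    have mw₁ := H10.memLp_fnOf hT hK (fnOf w₁)
    have mg := (H10.memLp_gradOf hT hK (gradOf w)).norm
    have mg₁ := (H10.memLp_gradOf hT hK (gradOf w₁)).norm
    have mgb := (H10.memLp_gradOf hT hK (gradOf b)).norm
    have mgs := (H10.memLp_gradOf hT hK (gradOf (w₁ - b))).norm
    have hE := cellEnergy_nonneg K w
    have s1 : cellEnergy K (w₁ - b) ≤ 2 * cellEnergy K w₁ + 2 * cellEnergy K b := by
      unfold cellEnergy
      rw [← integral_const_mul, ← integral_const_mul, ← integral_add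
        (mg₁.integrable_sq.const_mul 2) (mgb.integrable_sq.const_mul 2)]
      refine integral_mono_ae mgs.integrable_sq
        ((mg₁.integrable_sq.const_mul 2).add (mgb.integrable_sq.const_mul 2)) ?_
      filter_upwards [hT.ae_openCell hK (Lp.coeFn_sub (gradOf w₁) (gradOf b))] with x hx
      rw [gradOf_sub, hx, Pi.sub_apply]
      have := norm_sub_le (gradOf w₁ x) (gradOf b x)
      nlinarith [sq_nonneg (‖gradOf w₁ x‖ - ‖gradOf b x‖), norm_nonneg (gradOf w₁ x - gradOf b x)]
    have s2 : cellEnergy K w₁ ≤ 2 * cellEnergy K w + 2 * (Cθ / H) ^ 2 *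
        ∫ x in openCell K, fnOf w x ^ 2 := by
      unfold cellEnergy
      rw [← integral_const_mul, ← integral_const_mul, ← integral_add
        (mg.integrable_sq.const_mul 2) (mw.integrable_sq.const_mul _)]
      refine integral_mono_ae mg₁.integrable_sq
        ((mg.integrable_sq.const_mul 2).add (mw.integrable_sq.const_mul _)) ?_
      filter_upwards [hT.ae_openCell hK hw₁g, ae_restrict_mem (measurableSet_openCell K)] with x hx hxK
      rw [hx]
      have h1 : ‖θ x • gradOf w x + fnOf w x • gradient θ x‖ ≤
          ‖gradOf w x‖ + |fnOf w x| * (Cθ / H) := by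
        refine (norm_add_le _ _).trans ?_
        rw [norm_smul, norm_smul, norm_gradient]
        refine add_le_add (mul_le_of_le_one_left (norm_nonneg _) (hθabs x)) ?_
        exact mul_le_mul_of_nonneg_left (hθL x (hT.openCell_subset hK hxK)) (norm_nonneg _)
      have h2 := pow_le_pow_left₀ (norm_nonneg _) h1 2
      have h3 : (|fnOf w x| * (Cθ / H)) ^ 2 = (Cθ / H) ^ 2 * fnOf w x ^ 2 := by
        rw [mul_pow, sq_abs]; ring
      nlinarith [sq_nonneg (‖gradOf w x‖ - |fnOf w x| * (Cθ / H))]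
    have s3 : ∫ x in openCell K, fnOf w₁ x ^ 2 ≤ ∫ x in openCell K, fnOf w x ^ 2 := by
      refine integral_mono_ae mw₁.integrable_sq mw.integrable_sq ?_
      filter_upwards [hT.ae_openCell hK hw₁] with x hx
      rw [hx, mul_pow]
      refine mul_le_of_le_one_left (sq_nonneg _) ?_
      rw [← sq_abs]
      exact pow_le_one₀ (abs_nonneg _) (hθabs x)
    have s4 : cellEnergy K b ≤ Cb * P * cellEnergy K w := by
      calc cellEnergy K b ≤ Cb / H ^ 2 * ∫ x in openCell K, fnOf w₁ x ^ 2 := (hbK K hK).2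
        _ ≤ Cb / H ^ 2 * (P * H ^ 2 * cellEnergy K w) := by
          gcongr; exact s3.trans hPK
        _ = _ := by field_simp
    have s5 : 2 * (Cθ / H) ^ 2 * ∫ x in openCell K, fnOf w x ^ 2 ≤
        2 * Cθ ^ 2 * P * cellEnergy K w := by
      calc _ ≤ 2 * (Cθ / H) ^ 2 * (P * H ^ 2 * cellEnergy K w) := by gcongr
        _ = _ := by field_simp
    linarith

open Classical in
/-- The elements that make up the patch of order `l` around `G`. -/
def layer (T : Finset (BoxIntegral.Box (Fin d))) (G : BoxIntegral.Box (Fin d)) :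
    ℕ → Finset (BoxIntegral.Box (Fin d))
  | 0 => {G}
  | l + 1 => T.filter fun K => ∃ L ∈ layer T G l, (cell L ∩ cell K).Nonempty

theorem mem_layer_succ {G K : BoxIntegral.Box (Fin d)} {l : ℕ} :
    K ∈ layer T G (l + 1) ↔ K ∈ T ∧ ∃ L ∈ layer T G l, (cell L ∩ cell K).Nonempty := by
  simp [layer]

theorem layer_subset {G : BoxIntegral.Box (Fin d)} (hG : G ∈ T) (l : ℕ) : layer T G l ⊆ T := by
  cases l with
  | zero => simpa [layer] using hG
  | succ l => exact fun K hK => (mem_layer_succ.1 hK).1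

theorem layer_subset_succ {G : BoxIntegral.Box (Fin d)} (hG : G ∈ T) (l : ℕ) :
    layer T G l ⊆ layer T G (l + 1) := fun K hK =>
  mem_layer_succ.2 ⟨layer_subset hG l hK, K, hK, by rw [inter_self]; exact cell_nonempty K⟩

theorem self_mem_layer {G : BoxIntegral.Box (Fin d)} (hG : G ∈ T) (l : ℕ) : G ∈ layer T G l := by
  induction l with
  | zero => simp [layer]
  | succ l ih => exact layer_subset_succ hG l ih

/-- A finite union of closed cells is closed, so the closure in the definition of a patch has no
effect and patches can be handled as finite sets of elements. -/
theorem patch_eq_biUnion (T : Finset (BoxIntegral.Box (Fin d))) (G : BoxIntegral.Box (Fin d))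
    (l : ℕ) : patch T l (cell G) = ⋃ K ∈ layer T G l, cell K := by
  induction l with
  | zero => simp [patch, layer]
  | succ l ih =>
    have h : patch T (l + 1) (cell G) = patchOne T (patch T l (cell G)) :=
      Function.iterate_succ_apply' _ _ _
    rw [h, ih]
    ext x
    have hcl : IsClosed (⋃ K ∈ layer T G l, cell K) :=
      (layer T G l).finite_toSet.isClosed_biUnion fun K _ => isClosed_cell K
    rw [mem_patchOne, hcl.closure_eq]
    simp only [mem_iUnion, exists_prop, mem_layer_succ]
    refine exists_congr fun K => ?_
    constructor
    · rintro ⟨hK, ⟨y, hy, hyK⟩, hx⟩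
      obtain ⟨L, hL, hyL⟩ := mem_iUnion₂.1 hy
      exact ⟨⟨hK, L, hL, y, hyL, hyK⟩, hx⟩
    · rintro ⟨⟨hK, L, hL, y, hyL, hyK⟩, hx⟩
      exact ⟨hK, ⟨y, mem_iUnion₂.2 ⟨L, hL, hyL⟩, hyK⟩, hx⟩

theorem measurableSet_biUnion_cell (S : Finset (BoxIntegral.Box (Fin d))) :
    MeasurableSet (⋃ K ∈ S, cell K) :=
  S.measurableSet_biUnion fun K _ => (isClosed_cell K).measurableSet

/-- Membership in the localized fine-scale space, element by element. -/
theorem IsRectMesh.mem_fineSpaceOn (hT : IsRectMesh Ω H κ T)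
    {S : Finset (BoxIntegral.Box (Fin d))} (hS : S ⊆ T) {w : H10 Ω} :
    w ∈ fineSpaceOn Ω T p (⋃ K ∈ S, cell K) ↔ w ∈ fineSpace Ω T p ∧
      ∀ K ∈ T, K ∉ S → ∀ᵐ x ∂volume.restrict (openCell K), fnOf w x = 0 := by
  refine and_congr_right fun _ => ⟨fun h K hK hKS => ?_, fun h => ?_⟩
  · have hc : ∀ᵐ x ∂(volume : Measure (Euc d)).restrict Ω, ∀ L ∈ S, x ∈ cell L → x ∈ openCell L := by
      rw [Filter.eventually_all_finset]
      exact fun L _ => IsRectMesh.ae_mem_openCell_of_mem_cell L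
    filter_upwards [hT.ae_openCell hK h, hT.ae_openCell hK hc,
      ae_restrict_mem (measurableSet_openCell K)] with x hx hxc hxK
    refine hx fun hxS => ?_
    obtain ⟨L, hL, hxL⟩ := mem_iUnion₂.1 hxS
    exact hKS (hT.eq_of_mem_openCell hK (hS hL) hxK (hxc L hL hxL) ▸ hL)
  · refine hT.ae_of_forall_cell fun K hK => ?_
    by_cases hKS : K ∈ S
    · filter_upwards [ae_restrict_mem (measurableSet_openCell K)] with x hx hxS
      exact absurd (mem_iUnion₂.2 ⟨K, hKS, openCell_subset_cell K hx⟩) hxS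
    · filter_upwards [h K hK hKS] with x hx _
      exact hx

/-! ### The energy form, element by element -/

/-- The energy form on one cell. -/
def cellForm (A : Euc d → ℝ) (K : BoxIntegral.Box (Fin d)) (u w : H10 Ω) : ℝ :=
  ∫ x in openCell K, A x * inner ℝ (gradOf u x) (gradOf w x)

namespace IsCoefficient

variable {α β : ℝ} {A : Euc d → ℝ}

theorem ae_abs_le (hA : IsCoefficient Ω α β A) (hα : 0 < α) :
    ∀ᵐ x ∂volume.restrict Ω, |A x| ≤ β := by
  filter_upwards [hA.2] with x hx
  rw [abs_of_nonneg (hα.le.trans hx.1)]; exact hx.2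

theorem integrableOn (hA : IsCoefficient Ω α β A) (hα : 0 < α) (u w : H10 Ω) :
    IntegrableOn (fun x => A x * inner ℝ (gradOf u x) (gradOf w x)) Ω :=
  (L2.integrable_inner (𝕜 := ℝ) (gradOf u) (gradOf w)).bdd_mul hA.1 (hA.ae_abs_le hα)

theorem energyOn_biUnion (hA : IsCoefficient Ω α β A) (hα : 0 < α) (hT : IsRectMesh Ω H κ T)
    {S : Finset (BoxIntegral.Box (Fin d))} (hS : S ⊆ T) (u w : H10 Ω) :
    energyOn A (⋃ K ∈ S, cell K) u w = ∑ K ∈ S, cellForm A K u w :=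
  hT.setIntegral_biUnion hS (hA.integrableOn hα u w)

theorem energyOn_self (hA : IsCoefficient Ω α β A) (hα : 0 < α) (hT : IsRectMesh Ω H κ T)
    (u w : H10 Ω) : energyOn A Ω u w = ∑ K ∈ T, cellForm A K u w := by
  rw [energyOn, inter_self]
  exact hT.setIntegral_eq_sum (hA.integrableOn hα u w)

theorem cellForm_sub_left (hA : IsCoefficient Ω α β A) (hα : 0 < α) (hT : IsRectMesh Ω H κ T)
    {K : BoxIntegral.Box (Fin d)} (hK : K ∈ T) (u u' w : H10 Ω) :
    cellForm A K (u - u') w = cellForm A K u w - cellForm A K u' w := by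
  unfold cellForm
  rw [← integral_sub ((hA.integrableOn hα u w).mono_set (hT.openCell_subset hK))
    ((hA.integrableOn hα u' w).mono_set (hT.openCell_subset hK))]
  refine integral_congr_ae ?_
  filter_upwards [hT.ae_openCell hK (Lp.coeFn_sub (gradOf u) (gradOf u'))] with x hx
  rw [gradOf_sub, hx, Pi.sub_apply, inner_sub_left, mul_sub]

theorem cellForm_comm (u w : H10 Ω) (K : BoxIntegral.Box (Fin d)) :
    cellForm A K u w = cellForm A K w u := by
  unfold cellForm
  simp_rw [real_inner_comm]

theorem cellForm_sub_right (hA : IsCoefficient Ω α β A) (hα : 0 < α) (hT : IsRectMesh Ω H κ T)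
    {K : BoxIntegral.Box (Fin d)} (hK : K ∈ T) (u w w' : H10 Ω) :
    cellForm A K u (w - w') = cellForm A K u w - cellForm A K u w' := by
  rw [cellForm_comm, hA.cellForm_sub_left hα hT hK, cellForm_comm, cellForm_comm w']

theorem abs_cellForm_le (hA : IsCoefficient Ω α β A) (hα : 0 < α) (hαβ : α ≤ β)
    (hT : IsRectMesh Ω H κ T) {K : BoxIntegral.Box (Fin d)} (hK : K ∈ T) (u w : H10 Ω) :
    |cellForm A K u w| ≤ β * (Real.sqrt (cellEnergy K u) * Real.sqrt (cellEnergy K w)) :=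
  abs_integral_mul_inner_le (hT.ae_openCell hK (hA.ae_abs_le hα)) (hα.le.trans hαβ)
    (H10.memLp_gradOf hT hK _) (H10.memLp_gradOf hT hK _)

theorem le_cellForm_self (hA : IsCoefficient Ω α β A) (hα : 0 < α) (hT : IsRectMesh Ω H κ T)
    {K : BoxIntegral.Box (Fin d)} (hK : K ∈ T) (u : H10 Ω) :
    α * cellEnergy K u ≤ cellForm A K u u := by
  unfold cellEnergy cellForm
  rw [← integral_const_mul]
  refine integral_mono_ae ((H10.memLp_gradOf hT hK _).norm.integrable_sq.const_mul α)
    ((hA.integrableOn hα u u).mono_set (hT.openCell_subset hK)) ?_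
  filter_upwards [hT.ae_openCell hK hA.2] with x hx
  rw [real_inner_self_eq_norm_sq]
  exact mul_le_mul_of_nonneg_right hx.1 (sq_nonneg _)

end IsCoefficient

/-- The support conditions in `W(S)` concern the function only; here they are carried over to the
weak gradient on a cell. -/
theorem cellEnergy_eq_zero [IsFiniteMeasure (volume.restrict Ω)] (hT : IsRectMesh Ω H κ T)
    {K : BoxIntegral.Box (Fin d)} (hK : K ∈ T) {u : H10 Ω}
    (h : ∀ᵐ x ∂volume.restrict (openCell K), fnOf u x = 0) : cellEnergy K u = 0 := by
  have := H10.gradOf_ae_eq_zero u (isOpen_openCell K) (hT.openCell_subset hK) h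
  rw [cellEnergy, integral_congr_ae (this.mono fun x hx => congrArg (‖·‖ ^ 2) hx)]
  simp

theorem cellForm_eq_zero_right [IsFiniteMeasure (volume.restrict Ω)] (hT : IsRectMesh Ω H κ T)
    {K : BoxIntegral.Box (Fin d)} (hK : K ∈ T) {A : Euc d → ℝ} {u w : H10 Ω}
    (h : ∀ᵐ x ∂volume.restrict (openCell K), fnOf w x = 0) : cellForm A K u w = 0 := by
  have := H10.gradOf_ae_eq_zero w (isOpen_openCell K) (hT.openCell_subset hK) h
  rw [cellForm, ← integral_zero (Euc d) ℝ (μ := volume.restrict (openCell K))]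
  refine integral_congr_ae (this.mono fun x hx => ?_)
  simp only [hx, inner_zero_right, mul_zero]

theorem cellForm_congr_right [IsFiniteMeasure (volume.restrict Ω)] (hT : IsRectMesh Ω H κ T)
    {K : BoxIntegral.Box (Fin d)} (hK : K ∈ T) {A : Euc d → ℝ} {u w w' : H10 Ω}
    (h : ∀ᵐ x ∂volume.restrict (openCell K), fnOf w x = fnOf w' x) :
    cellForm A K u w = cellForm A K u w' := by
  have := H10.gradOf_ae_eq_zero (w - w') (isOpen_openCell K) (hT.openCell_subset hK) <| by
    filter_upwards [h, hT.ae_openCell hK (Lp.coeFn_sub (fnOf w) (fnOf w'))] with x h1 h2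
    rw [fnOf_sub, h2, Pi.sub_apply, h1, sub_self]
  refine integral_congr_ae ?_
  filter_upwards [this, hT.ae_openCell hK (Lp.coeFn_sub (gradOf w) (gradOf w'))] with x h1 h2
  rw [gradOf_sub, h2, Pi.sub_apply, sub_eq_zero] at h1
  rw [h1]

theorem cellForm_eq_zero_left [IsFiniteMeasure (volume.restrict Ω)] (hT : IsRectMesh Ω H κ T)
    {K : BoxIntegral.Box (Fin d)} (hK : K ∈ T) {A : Euc d → ℝ} {u w : H10 Ω}
    (h : ∀ᵐ x ∂volume.restrict (openCell K), fnOf u x = 0) : cellForm A K u w = 0 := by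
  rw [IsCoefficient.cellForm_comm, cellForm_eq_zero_right hT hK h]

theorem IsRectMesh.setIntegral_cell (hT : IsRectMesh Ω H κ T) {G : BoxIntegral.Box (Fin d)}
    (hG : G ∈ T) (g : Euc d → ℝ) : ∫ x in Ω ∩ cell G, g x = ∫ x in openCell G, g x := by
  have := hT.inter_biUnion_ae_eq (S := {G}) (by simpa using hG)
  simp only [Finset.mem_singleton, iUnion_iUnion_eq_left] at this
  exact setIntegral_congr_set this

theorem IsRectMesh.gradNorm_cell (hT : IsRectMesh Ω H κ T) {G : BoxIntegral.Box (Fin d)}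
    (hG : G ∈ T) (u : H10 Ω) : gradNorm (cell G) u = Real.sqrt (cellEnergy G u) := by
  rw [gradNorm, hT.setIntegral_cell hG, cellEnergy]

theorem IsRectMesh.gradNorm_biUnion (hT : IsRectMesh Ω H κ T)
    {S : Finset (BoxIntegral.Box (Fin d))} (hS : S ⊆ T) (u : H10 Ω) :
    gradNorm (⋃ K ∈ S, cell K) u = Real.sqrt (∑ K ∈ S, cellEnergy K u) := by
  rw [gradNorm, hT.setIntegral_biUnion hS (Lp.memLp (gradOf u)).norm.integrable_sq]
  rfl

end

noncomputable section

/-! ### Exponential decay -/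

open scoped ENNReal

variable {d : ℕ} {Ω : Set (Euc d)} {H κ : ℝ} {T : Finset (BoxIntegral.Box (Fin d))} {p : ℕ}
  {α β : ℝ} {A : Euc d → ℝ}

/-! ### Unique solvability of the correction problems -/

/-- The inclusion of `H¹₀(Ω)` into `L²(Ω)`. -/
def fnOfL (Ω : Set (Euc d)) : H10 Ω →L[ℝ] L2 Ω :=
  (WithLp.fstL 2 ℝ _ _).comp (H10 Ω).subtypeL

/-- The weak gradient as a continuous linear map. -/
def gradOfL (Ω : Set (Euc d)) : H10 Ω →L[ℝ] Lp (Euc d) 2 (volume.restrict Ω) :=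
  (WithLp.sndL 2 ℝ _ _).comp (H10 Ω).subtypeL

/-- The localized fine-scale space as a closed subspace. -/
def fineSubmodule (Ω : Set (Euc d)) (T : Finset (BoxIntegral.Box (Fin d))) (p : ℕ)
    (S : Set (Euc d)) : Submodule ℝ (H10 Ω) :=
  ((polySpace Ω T p)ᗮ.comap (fnOfL Ω).toLinearMap) ⊓
    (((LpToLpRestrictCLM (Euc d) ℝ ℝ (volume.restrict Ω) 2 Sᶜ).comp (fnOfL Ω)).toLinearMap).ker

theorem isClosed_fineSubmodule (Ω : Set (Euc d)) (T : Finset (BoxIntegral.Box (Fin d))) (p : ℕ)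
    (S : Set (Euc d)) : IsClosed (fineSubmodule Ω T p S : Set (H10 Ω)) :=
  ((Submodule.isClosed_orthogonal _).preimage (fnOfL Ω).continuous).inter
    (isClosed_singleton.preimage ((LpToLpRestrictCLM (Euc d) ℝ ℝ (volume.restrict Ω) 2 Sᶜ).comp
      (fnOfL Ω)).continuous)

theorem mem_fineSubmodule {S : Set (Euc d)} (hS : MeasurableSet S) {w : H10 Ω} :
    w ∈ fineSubmodule Ω T p S ↔ w ∈ fineSpaceOn Ω T p S := by
  refine and_congr Iff.rfl ?_
  change LpToLpRestrictCLM (Euc d) ℝ ℝ (volume.restrict Ω) 2 Sᶜ (fnOf w) = 0 ↔ _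
  rw [Lp.eq_zero_iff_ae_eq_zero]
  have h1 := LpToLpRestrictCLM_coeFn (μ := volume.restrict Ω) (p := 2) ℝ Sᶜ (fnOf w)
  have h2 : (∀ᵐ x ∂(volume.restrict Ω).restrict Sᶜ, fnOf w x = 0) ↔
      ∀ᵐ x ∂volume.restrict Ω, x ∉ S → fnOf w x = 0 := ae_restrict_iff' hS.compl
  rw [← h2]
  constructor
  · intro h
    filter_upwards [h, h1] with x a b
    rw [← b, a]; rfl
  · intro h
    filter_upwards [h, h1] with x a b
    rw [b, a]; rfl

/-- The energy form on a measurable set as a continuous bilinear form. -/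
theorem exists_energyOn_bilin (hA : IsCoefficient Ω α β A) (hα : 0 < α) {S : Set (Euc d)}
    (hS : MeasurableSet S) :
    ∃ B : H10 Ω →L[ℝ] H10 Ω →L[ℝ] ℝ, ∀ u w, B u w = energyOn A S u w := by
  have hm : MemLp (S.indicator A) ∞ (volume.restrict Ω) :=
    (memLp_top_of_bound hA.1 β (hA.ae_abs_le hα)).indicator hS
  let m : Lp (Euc d) 2 (volume.restrict Ω) →L[ℝ] Lp (Euc d) 2 (volume.restrict Ω) :=
    (ContinuousLinearMap.lsmul ℝ ℝ : ℝ →L[ℝ] Euc d →L[ℝ] Euc d).holderL _ ∞ 2 2 (hm.toLp _)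
  refine ⟨(innerSL ℝ).bilinearComp (m.comp (gradOfL Ω)) (gradOfL Ω), fun u w => ?_⟩
  change inner ℝ (m (gradOf u)) (gradOf w) = _
  rw [L2.inner_def, energyOn, inter_comm, ← Measure.restrict_restrict hS, ← integral_indicator hS]
  refine integral_congr_ae ?_
  filter_upwards [ContinuousLinearMap.coeFn_holder (r := 2)
    (ContinuousLinearMap.lsmul ℝ ℝ : ℝ →L[ℝ] Euc d →L[ℝ] Euc d) (hm.toLp _) (gradOf u),
    hm.coeFn_toLp] with x a b
  change inner ℝ ((ContinuousLinearMap.lsmul ℝ ℝ : ℝ →L[ℝ] Euc d →L[ℝ] Euc d).holder 2 (hm.toLp _)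
    (gradOf u) x) _ = _
  rw [a, b, ContinuousLinearMap.lsmul_apply, real_inner_smul_left]
  by_cases hx : x ∈ S
  · rw [indicator_of_mem hx, indicator_of_mem hx]
  · rw [indicator_of_notMem hx, indicator_of_notMem hx, zero_mul]

theorem exists_load (v : L2 Ω) {S : Set (Euc d)} (hS : MeasurableSet S) :
    ∃ F : H10 Ω →L[ℝ] ℝ, ∀ w, F w = -∫ x in Ω ∩ S, v x * fnOf w x := by
  have hm : MemLp (S.indicator v) 2 (volume.restrict Ω) := (Lp.memLp v).indicator hS
  refine ⟨-((innerSL ℝ (hm.toLp _)).comp (fnOfL Ω)), fun w => ?_⟩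
  change -(inner ℝ (hm.toLp _) (fnOf w)) = _
  rw [L2.inner_def, inter_comm, ← Measure.restrict_restrict hS, ← integral_indicator hS]
  congr 1
  refine integral_congr_ae ?_
  filter_upwards [hm.coeFn_toLp] with x a
  rw [a]
  by_cases hx : x ∈ S
  · rw [indicator_of_mem hx, indicator_of_mem hx]; simp [mul_comm]
  · rw [indicator_of_notMem hx, indicator_of_notMem hx, inner_zero_left]

theorem norm_sq_eq_fnOf_gradOf (u : H10 Ω) : ‖u‖ ^ 2 = ‖fnOf u‖ ^ 2 + ‖gradOf u‖ ^ 2 :=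
  WithLp.prod_norm_sq_eq_of_L2 (u : L2Pair Ω)

theorem IsRectMesh.norm_gradOf_sq (hT : IsRectMesh Ω H κ T) (u : H10 Ω) :
    ‖gradOf u‖ ^ 2 = ∑ K ∈ T, cellEnergy K u := by
  rw [L2_norm_sq, hT.setIntegral_eq_sum (Lp.memLp (gradOf u)).norm.integrable_sq]
  rfl

/-- The means vanish cell by cell, so the inequalities on the cells add up. Neither boundary values
nor the diameter of `Ω` enter. -/
theorem IsRectMesh.norm_fnOf_sq_le (hT : IsRectMesh Ω H κ T) {u : H10 Ω}
    (hu : u ∈ fineSpace Ω T p) :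
    ‖fnOf u‖ ^ 2 ≤ poincareConst d κ * H ^ 2 * ‖gradOf u‖ ^ 2 := by
  rw [L2_norm_sq, hT.norm_gradOf_sq, Finset.mul_sum]
  simp only [Real.norm_eq_abs, sq_abs]
  rw [hT.setIntegral_eq_sum (Lp.memLp (fnOf u)).integrable_sq]
  exact Finset.sum_le_sum fun K hK => hT.integral_sq_le hu hK

/-- The Lax–Milgram theorem on a closed subspace. -/
theorem existsUnique_of_coercive_on {E : Type*} [NormedAddCommGroup E] [InnerProductSpace ℝ E]
    [CompleteSpace E] {V : Submodule ℝ E} (hV : IsClosed (V : Set E)) (B : E →L[ℝ] E →L[ℝ] ℝ)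
    (F : E →L[ℝ] ℝ) {c : ℝ} (hc : 0 < c) (h : ∀ u ∈ V, c * ‖u‖ ^ 2 ≤ B u u) :
    ∃! u, u ∈ V ∧ ∀ w ∈ V, B u w = F w := by
  have : CompleteSpace V := hV.completeSpace_coe
  let BV : V →L[ℝ] V →L[ℝ] ℝ := B.bilinearComp V.subtypeL V.subtypeL
  have hBV : ∀ u w : V, BV u w = B u w := fun u w => rfl
  have hcoer : IsCoercive BV := ⟨c, hc, fun u => by
    rw [hBV, mul_assoc, ← sq]; exact h u u.2⟩
  let r : V := (InnerProductSpace.toDual ℝ V).symm (F.comp V.subtypeL)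
  have hr : ∀ w : V, inner ℝ r w = F w := fun w => by
    simp only [r, InnerProductSpace.toDual_symm_apply]; rfl
  have hiff : ∀ u : V, (∀ w ∈ V, B u w = F w) ↔ hcoer.continuousLinearEquivOfBilin u = r := by
    intro u
    constructor
    · intro hu
      refine ext_inner_right ℝ fun w => ?_
      rw [hcoer.continuousLinearEquivOfBilin_apply, hr, hBV]
      exact hu w w.2
    · intro hu w hw
      have h2 := hcoer.continuousLinearEquivOfBilin_apply u ⟨w, hw⟩
      rw [hu, hr, hBV] at h2
      exact h2.symm
  refine ⟨(hcoer.continuousLinearEquivOfBilin.symm r : V), ⟨Subtype.coe_prop _,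
    (hiff _).2 (by simp)⟩, fun u hu => ?_⟩
  have := (hiff ⟨u, hu.1⟩).1 hu.2
  rw [← this]; simp

/-- The form is coercive on `W(S)` in the full `H¹`-norm: gradients vanish on the cells outside `S`,
so integrating over `S` loses nothing, and Poincaré controls the `L²` part. The coercivity constant
depends on `H`, which is harmless because only existence and uniqueness are drawn from it. -/
theorem existsUnique_enrichedCorrection [IsFiniteMeasure (volume.restrict Ω)]
    (hT : IsRectMesh Ω H κ T) (hA : IsCoefficient Ω α β A)
    (hα : 0 < α) {S : Finset (BoxIntegral.Box (Fin d))} (hS : S ⊆ T) (G : BoxIntegral.Box (Fin d))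
    (v : L2 Ω) : ∃! u, IsEnrichedCorrection T p A (⋃ K ∈ S, cell K) G v u := by
  have hSm := measurableSet_biUnion_cell S
  have : CompleteSpace (H10 Ω) :=
    (Submodule.isClosed_topologicalClosure (testPairs Ω)).completeSpace_coe
  obtain ⟨B, hB⟩ := exists_energyOn_bilin hA hα hSm
  obtain ⟨F, hF⟩ := exists_load v (isClosed_cell G).measurableSet
  have hP := poincareConst_nonneg d κ
  have hmem := fun w : H10 Ω => mem_fineSubmodule (p := p) (T := T) hSm (w := w)
  have key := existsUnique_of_coercive_on (isClosed_fineSubmodule Ω T p (⋃ K ∈ S, cell K)) B F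
    (c := α / (1 + poincareConst d κ * H ^ 2)) (by positivity) fun u hu => ?_
  · simp only [hmem, hB, hF] at key
    exact key
  · rw [hmem] at hu
    have h1 : ‖u‖ ^ 2 ≤ (1 + poincareConst d κ * H ^ 2) * ‖gradOf u‖ ^ 2 := by
      rw [norm_sq_eq_fnOf_gradOf, add_mul, one_mul]
      linarith [hT.norm_fnOf_sq_le hu.1]
    have h2 : α * ‖gradOf u‖ ^ 2 ≤ B u u := by
      rw [hB, hA.energyOn_biUnion hα hT hS, hT.norm_gradOf_sq, Finset.mul_sum]
      rw [← Finset.sum_subset hS (f := fun K => α * cellEnergy K u) fun K hK hKS => by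
        rw [cellEnergy_eq_zero hT hK (((hT.mem_fineSpaceOn hS).1 hu).2 K hK hKS), mul_zero]]
      exact Finset.sum_le_sum fun K hK => hA.le_cellForm_self hα hT (hS hK) _
    calc α / (1 + poincareConst d κ * H ^ 2) * ‖u‖ ^ 2
        ≤ α / (1 + poincareConst d κ * H ^ 2) *
          ((1 + poincareConst d κ * H ^ 2) * ‖gradOf u‖ ^ 2) := by gcongr
      _ = α * ‖gradOf u‖ ^ 2 := by field_simp
      _ ≤ _ := h2

/-- The problem on the whole of `Ω` is the problem on the union of all elements. -/
theorem isEnrichedCorrection_univ (hΩ : IsOpen Ω) (hT : IsRectMesh Ω H κ T)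
    (hA : IsCoefficient Ω α β A) (hα : 0 < α) {G : BoxIntegral.Box (Fin d)} {v : L2 Ω} {u : H10 Ω} :
    IsEnrichedCorrection T p A Ω G v u ↔
      IsEnrichedCorrection T p A (⋃ K ∈ T, cell K) G v u := by
  have h1 : fineSpaceOn Ω T p Ω = fineSpaceOn Ω T p (⋃ K ∈ T, cell K) := by
    ext w
    rw [hT.mem_fineSpaceOn Finset.Subset.rfl]
    refine and_congr_right fun _ => ⟨fun _ K hK hK' => absurd hK hK', fun _ => ?_⟩
    filter_upwards [ae_restrict_mem hΩ.measurableSet] with x hx hx'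
    exact absurd hx hx'
  unfold IsEnrichedCorrection
  rw [h1]
  simp_rw [hA.energyOn_self hα hT, hA.energyOn_biUnion hα hT Finset.Subset.rfl]

theorem integral_mul_eq_zero_of_ae {G : BoxIntegral.Box (Fin d)} {v : L2 Ω} {w : H10 Ω}
    (h : ∀ᵐ x ∂volume.restrict (openCell G), fnOf w x = 0) :
    ∫ x in openCell G, v x * fnOf w x = 0 := by
  rw [← integral_zero (Euc d) ℝ (μ := volume.restrict (openCell G))]
  exact integral_congr_ae (h.mono fun x hx => by simp only [hx, mul_zero])

/-! ### Energy bound, decay and defect of the localized correction -/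

section Decay

variable [IsFiniteMeasure (volume.restrict Ω)] {G : BoxIntegral.Box (Fin d)} {l : ℕ}

/-- The defining equation of the localized correction, with the sum over all elements. -/
theorem IsEnrichedCorrection.sum_cellForm (hT : IsRectMesh Ω H κ T) (hA : IsCoefficient Ω α β A)
    (hα : 0 < α) (hG : G ∈ T) {S : Finset (BoxIntegral.Box (Fin d))} (hS : S ⊆ T) {v : L2 Ω}
    {u w : H10 Ω} (hu : IsEnrichedCorrection T p A (⋃ K ∈ S, cell K) G v u)
    (hw : w ∈ fineSpaceOn Ω T p (⋃ K ∈ S, cell K)) :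
    ∑ K ∈ T, cellForm A K u w = -∫ x in openCell G, v x * fnOf w x := by
  rw [← hT.setIntegral_cell hG fun x => v x * fnOf w x, ← hu.2 w hw,
    hA.energyOn_biUnion hα hT hS]
  symm
  exact Finset.sum_subset hS fun K hK hKS =>
    cellForm_eq_zero_left hT hK (((hT.mem_fineSpaceOn hS).1 hu.1).2 K hK hKS)

/-- The equation is tested with `u` itself. Ellipticity bounds the left side from below, the product
form of Poincaré on `G` bounds the load, and one factor `√E` is cancelled. -/
theorem sqrt_sum_energy_le (hT : IsRectMesh Ω H κ T) (hA : IsCoefficient Ω α β A)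
    (hα : 0 < α) (hG : G ∈ T) {S : Finset (BoxIntegral.Box (Fin d))} (hS : S ⊆ T) {v u : H10 Ω}
    (hu : IsEnrichedCorrection T p A (⋃ K ∈ S, cell K) G (fnOf v) u) :
    Real.sqrt (∑ K ∈ T, cellEnergy K u) ≤
      poincareConst d κ / α * H ^ 2 * Real.sqrt (cellEnergy G v) := by
  set E := ∑ K ∈ T, cellEnergy K u with hE
  have hE0 : 0 ≤ E := Finset.sum_nonneg fun K _ => cellEnergy_nonneg K u
  have h1 : α * E ≤ poincareConst d κ * H ^ 2 * (Real.sqrt (cellEnergy G v) * Real.sqrt E) := by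
    calc α * E ≤ ∑ K ∈ T, cellForm A K u u := by
          rw [hE, Finset.mul_sum]
          exact Finset.sum_le_sum fun K hK => hA.le_cellForm_self hα hT hK u
      _ = -∫ x in openCell G, fnOf v x * fnOf u x := hu.sum_cellForm hT hA hα hG hS hu.1
      _ ≤ |∫ x in openCell G, fnOf v x * fnOf u x| := neg_le_abs _
      _ ≤ poincareConst d κ * H ^ 2 *
          (Real.sqrt (cellEnergy G v) * Real.sqrt (cellEnergy G u)) :=
          H10.abs_integral_mul_le_of_mean_zero hT hG v u (hT.mean_eq_zero hu.1.1 hG)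
      _ ≤ _ := by
          have := poincareConst_nonneg d κ
          gcongr
          exact Finset.single_le_sum (fun K _ => cellEnergy_nonneg K u) hG
  rcases hE0.eq_or_lt with h0 | hpos
  · rw [← h0, Real.sqrt_zero]
    have := poincareConst_nonneg d κ
    positivity
  · have hs := Real.sqrt_pos.2 hpos
    have h2 : α * Real.sqrt E * Real.sqrt E ≤
        poincareConst d κ * H ^ 2 * Real.sqrt (cellEnergy G v) * Real.sqrt E := by
      rw [mul_assoc, Real.mul_self_sqrt hE0]; linarith
    have h3 := le_of_mul_le_mul_right h2 hs
    rw [div_mul_eq_mul_div, div_mul_eq_mul_div, le_div_iff₀ hα]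
    linarith

open scoped Classical in
/-- The energy of the localized correction decays exponentially away from `G`. -/
theorem sum_energy_sdiff_layer_le (hT : IsRectMesh Ω H κ T) (hA : IsCoefficient Ω α β A)
    (hα : 0 < α) (hαβ : α ≤ β) (hG : G ∈ T) {C : ℝ} (hC : 0 < C) (hcut : HasFineCutoff Ω T p C)
    {l : ℕ} {v : L2 Ω} {u : H10 Ω}
    (hu : IsEnrichedCorrection T p A (⋃ K ∈ layer T G l, cell K) G v u) (k : ℕ) :
    ∑ K ∈ T \ layer T G k, cellEnergy K u ≤
      (β * Real.sqrt C / (β * Real.sqrt C + α)) ^ k * ∑ K ∈ T, cellEnergy K u := by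
  have hβ : 0 < β := hα.trans_le hαβ
  have hsC := Real.sqrt_pos.2 hC
  have hρ : 0 ≤ β * Real.sqrt C / (β * Real.sqrt C + α) := by positivity
  induction k with
  | zero =>
    rw [pow_zero, one_mul]
    exact Finset.sum_le_sum_of_subset_of_nonneg Finset.sdiff_subset
      fun K _ _ => cellEnergy_nonneg K u
  | succ k ih =>
    -- The test function is `u` cut off so as to vanish on layer `k`. The cut-off does not enlarge
    -- the support of `u`, so it is admissible for every `k`, even beyond `l`.
    obtain ⟨w, hw, hw0, hw1, hwu, hwE⟩ := hcut (layer T G k) (layer_subset hG k) u hu.1.1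
    have huS := (hT.mem_fineSpaceOn (layer_subset hG l)).1 hu.1
    have hwS : w ∈ fineSpaceOn Ω T p (⋃ K ∈ layer T G l, cell K) :=
      (hT.mem_fineSpaceOn (layer_subset hG l)).2
        ⟨hw, fun K hK hKl => hwu K hK (huS.2 K hK hKl)⟩
    have hsum := hu.sum_cellForm hT hA hα hG (layer_subset hG l) hwS
    -- `G` belongs to every layer, so the test function does not see the load.
    rw [integral_mul_eq_zero_of_ae (hw0 G (self_mem_layer hG k)), neg_zero] at hsum
    have hfar : ∀ K ∈ T \ layer T G (k + 1), α * cellEnergy K u ≤ cellForm A K u w := by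
      intro K hK
      obtain ⟨hKT, hKn⟩ := Finset.mem_sdiff.1 hK
      rw [cellForm_congr_right hT hKT (hw1 K hKT fun L hL hLK =>
        hKn (mem_layer_succ.2 ⟨hKT, L, hL, hLK⟩))]
      exact hA.le_cellForm_self hα hT hKT u
    have hring : ∀ K ∈ layer T G (k + 1) \ layer T G k,
        -(β * Real.sqrt C * cellEnergy K u) ≤ cellForm A K u w := by
      intro K hK
      have hKT := layer_subset hG _ (Finset.mem_sdiff.1 hK).1
      have h := (abs_le.1 (hA.abs_cellForm_le hα hαβ hT hKT u w)).1
      refine le_trans (neg_le_neg ?_) h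
      calc β * (Real.sqrt (cellEnergy K u) * Real.sqrt (cellEnergy K w))
          ≤ β * (Real.sqrt (cellEnergy K u) * Real.sqrt (C * cellEnergy K u)) := by
            gcongr; exact hwE K hKT
        _ = β * Real.sqrt C * (Real.sqrt (cellEnergy K u) * Real.sqrt (cellEnergy K u)) := by
            rw [Real.sqrt_mul hC.le]; ring
        _ = _ := by rw [Real.mul_self_sqrt (cellEnergy_nonneg K u)]
    have hsplit : ∀ f : BoxIntegral.Box (Fin d) → ℝ, ∑ K ∈ T \ layer T G k, f K =
        ∑ K ∈ layer T G (k + 1) \ layer T G k, f K + ∑ K ∈ T \ layer T G (k + 1), f K := by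
      intro f
      rw [← Finset.sum_sdiff (Finset.sdiff_subset_sdiff (Finset.Subset.refl T)
        (layer_subset_succ hG k))]
      congr 1
      refine Finset.sum_congr ?_ fun _ _ => rfl
      ext K
      simp only [Finset.mem_sdiff, not_and, not_not]
      have := @layer_subset _ T G hG (k + 1) K
      tauto
    have hsum' : ∑ K ∈ T \ layer T G k, cellForm A K u w = 0 := by
      rw [← hsum]
      refine Finset.sum_subset Finset.sdiff_subset fun K hK hKn => ?_
      refine cellForm_eq_zero_right hT hK (hw0 K ?_)
      by_contra hKl
      exact hKn (Finset.mem_sdiff.2 ⟨hK, hKl⟩)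
    have h1 := Finset.sum_le_sum hfar
    have h2 := Finset.sum_le_sum hring
    rw [hsplit] at hsum'
    have h3 := hsplit fun K => cellEnergy K u
    rw [← Finset.mul_sum] at h1
    rw [Finset.sum_neg_distrib, ← Finset.mul_sum] at h2
    set E := ∑ K ∈ T \ layer T G k, cellEnergy K u
    set E' := ∑ K ∈ T \ layer T G (k + 1), cellEnergy K u
    -- Hole filling: the ring carries the energy `E - E'`, so `α E' ≤ β √C (E - E')`, and the term
    -- with `E'` is moved to the left.
    have hE : (β * Real.sqrt C + α) * E' ≤ β * Real.sqrt C * E := by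
      rw [h3]
      linarith
    calc E' ≤ β * Real.sqrt C / (β * Real.sqrt C + α) * E := by
          rw [div_mul_eq_mul_div, le_div_iff₀ (by positivity)]; linarith
      _ ≤ β * Real.sqrt C / (β * Real.sqrt C + α) *
          ((β * Real.sqrt C / (β * Real.sqrt C + α)) ^ k * ∑ K ∈ T, cellEnergy K u) := by gcongr
      _ = _ := by ring

open scoped Classical in
/-- The defect of the localized correction in the global problem lives in the outermost layer. -/
theorem defect_le (hT : IsRectMesh Ω H κ T) (hA : IsCoefficient Ω α β A)
    (hα : 0 < α) (hαβ : α ≤ β) (hG : G ∈ T) {C : ℝ} (hC : 0 < C) (hcut : HasFineCutoff Ω T p C)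
    {m : ℕ} {v : L2 Ω} {u : H10 Ω}
    (hu : IsEnrichedCorrection T p A (⋃ K ∈ layer T G (m + 1), cell K) G v u) {w : H10 Ω}
    (hw : w ∈ fineSpace Ω T p) :
    ∑ K ∈ T, cellForm A K u w + ∫ x in openCell G, v x * fnOf w x ≤
      β * Real.sqrt C * (Real.sqrt (∑ K ∈ T \ layer T G m, cellEnergy K u) *
        Real.sqrt (∑ K ∈ layer T G (m + 2), cellEnergy K w)) := by
  have hβ : 0 < β := hα.trans_le hαβ
  -- Outside layer `m + 1` the cut-off `w'` agrees with `w`, so `w - w'` is admissible for the local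
  -- problem. On `G` it vanishes, so `w` and `w - w'` have the same load.
  obtain ⟨w', hw', hw0, hw1, -, hwE⟩ := hcut (layer T G m) (layer_subset hG m) w hw
  have huS := (hT.mem_fineSpaceOn (layer_subset hG (m + 1))).1 hu.1
  have hdae : ∀ K ∈ T, ∀ᵐ x ∂volume.restrict (openCell K),
      fnOf (w - w') x = fnOf w x - fnOf w' x := fun K hK =>
    hT.ae_openCell hK (Lp.coeFn_sub (fnOf w) (fnOf w'))
  have hdS : w - w' ∈ fineSpaceOn Ω T p (⋃ K ∈ layer T G (m + 1), cell K) := by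
    refine (hT.mem_fineSpaceOn (layer_subset hG (m + 1))).2
      ⟨show fnOf (w - w') ∈ (polySpace Ω T p)ᗮ from Submodule.sub_mem _ hw hw', fun K hK hKl => ?_⟩
    filter_upwards [hdae K hK, hw1 K hK fun L hL hLK => hKl (mem_layer_succ.2 ⟨hK, L, hL, hLK⟩)]
      with x h1 h2
    rw [h1, h2, sub_self]
  have hsum := hu.sum_cellForm hT hA hα hG (layer_subset hG (m + 1)) hdS
  have hG0 : ∫ x in openCell G, v x * fnOf (w - w') x = ∫ x in openCell G, v x * fnOf w x := by
    refine integral_congr_ae ?_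
    filter_upwards [hdae G hG, hw0 G (self_mem_layer hG m)] with x h1 h2
    rw [h1, h2, sub_zero]
  rw [hG0, Finset.sum_congr rfl fun K hK => hA.cellForm_sub_right hα hT hK u w w',
    Finset.sum_sub_distrib] at hsum
  -- In `a(u, w')` the elements of layer `m` drop out because of `w'`, and those outside layer `m +
  -- 1` because of `u`.
  have heq : ∑ K ∈ T, cellForm A K u w + ∫ x in openCell G, v x * fnOf w x =
      ∑ K ∈ layer T G (m + 1) \ layer T G m, cellForm A K u w' := by
    have : ∑ K ∈ layer T G (m + 1) \ layer T G m, cellForm A K u w' = ∑ K ∈ T, cellForm A K u w' := by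
      refine Finset.sum_subset (Finset.sdiff_subset.trans (layer_subset hG _)) fun K hK hKn => ?_
      by_cases hKl : K ∈ layer T G (m + 1)
      · refine cellForm_eq_zero_right hT hK (hw0 K ?_)
        by_contra hKm
        exact hKn (Finset.mem_sdiff.2 ⟨hKl, hKm⟩)
      · exact cellForm_eq_zero_left hT hK (huS.2 K hK hKl)
    rw [this]; linarith
  rw [heq]
  calc ∑ K ∈ layer T G (m + 1) \ layer T G m, cellForm A K u w'
      ≤ ∑ K ∈ layer T G (m + 1) \ layer T G m,
        β * Real.sqrt C * (Real.sqrt (cellEnergy K u) * Real.sqrt (cellEnergy K w)) := by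
        refine Finset.sum_le_sum fun K hK => ?_
        have hKT := layer_subset hG _ (Finset.mem_sdiff.1 hK).1
        refine ((le_abs_self _).trans (hA.abs_cellForm_le hα hαβ hT hKT u w')).trans ?_
        calc β * (Real.sqrt (cellEnergy K u) * Real.sqrt (cellEnergy K w'))
            ≤ β * (Real.sqrt (cellEnergy K u) * Real.sqrt (C * cellEnergy K w)) := by
              gcongr; exact hwE K hKT
          _ = _ := by rw [Real.sqrt_mul hC.le]; ring
    _ = β * Real.sqrt C * ∑ K ∈ layer T G (m + 1) \ layer T G m,
          Real.sqrt (cellEnergy K u) * Real.sqrt (cellEnergy K w) := by rw [Finset.mul_sum]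
    _ ≤ β * Real.sqrt C * (Real.sqrt (∑ K ∈ layer T G (m + 1) \ layer T G m, cellEnergy K u) *
          Real.sqrt (∑ K ∈ layer T G (m + 1) \ layer T G m, cellEnergy K w)) := by
        gcongr
        exact Real.sum_sqrt_mul_sqrt_le _ (fun K => cellEnergy_nonneg K u)
          fun K => cellEnergy_nonneg K w
    -- The ring already lies in layer `m + 1`; layer `m + 2` is the larger patch that appears in the
    -- theorem.
    _ ≤ _ := by
        refine mul_le_mul_of_nonneg_left (mul_le_mul (Real.sqrt_le_sqrt ?_) (Real.sqrt_le_sqrt ?_)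
          (Real.sqrt_nonneg _) (Real.sqrt_nonneg _)) (by positivity)
        · exact Finset.sum_le_sum_of_subset_of_nonneg
            (Finset.sdiff_subset_sdiff (layer_subset hG _) (Finset.Subset.refl _))
            fun K _ _ => cellEnergy_nonneg K u
        · exact Finset.sum_le_sum_of_subset_of_nonneg
            (Finset.sdiff_subset.trans (layer_subset_succ hG _))
            fun K _ _ => cellEnergy_nonneg K w

end Decay

end

/-! ### The localization error -/

theorem mainTheorem6 (d : ℕ) (hd : 0 < d) (p : ℕ) (Ω : Set (Euc d)) (hΩ : IsOpen Ω)
    (hΩb : Bornology.IsBounded Ω) (α β κ : ℝ) (hα : 0 < α) (hαβ : α ≤ β) :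
    ∃ C₀ > 0, ∃ C > 0, ∀ H : ℝ, 0 < H → ∀ T : Finset (BoxIntegral.Box (Fin d)),
      IsRectMesh Ω H κ T → ∀ A : Euc d → ℝ, IsCoefficient Ω α β A →
      ∀ G ∈ T, ∀ l : ℕ, 1 ≤ l →
        (∀ v : L2 Ω,
          (∃! u, IsEnrichedCorrection T p A (patch T l (cell G)) G v u) ∧
          (∃! u, IsEnrichedCorrection T p A Ω G v u)) ∧
        ∀ v : H10 Ω, ∀ w ∈ fineSpace Ω T p,
          energyOn A Ω (locCorrection T p A l G (fnOf v) - globCorrection T p A G (fnOf v)) w ≤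
            C₀ * H ^ 2 * Real.exp (-C * l) *
              gradNorm (cell G) v * gradNorm (patch T (l + 1) (cell G)) w := by
  classical
  by_cases hκ : 0 < κ
  swap
  -- If `κ ≤ 0` there is no nonempty mesh: a cell has a side, as `0 < d`, and its positive length
  -- would satisfy `H ≤ κ * s ≤ 0`.
  · refine ⟨1, one_pos, 1, one_pos, fun H hH T hT A _ G hG => ?_⟩
    have h1 := hT.le_side G hG ⟨0, hd⟩
    have h2 := sub_pos.2 (G.lower_lt_upper ⟨0, hd⟩)
    exact absurd (hH.trans_le h1) (not_lt.2 (mul_nonpos_of_nonpos_of_nonneg (not_lt.1 hκ) h2.le))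
  have : IsFiniteMeasure (volume.restrict Ω) := isFiniteMeasure_restrict.2 hΩb.measure_lt_top.ne
  obtain ⟨C, hC, hcut⟩ := exists_hasFineCutoff d p hκ
  have hβ : 0 < β := hα.trans_le hαβ
  have hsC := Real.sqrt_pos.2 hC
  set ρ := β * Real.sqrt C / (β * Real.sqrt C + α) with hρ
  have hρ0 : 0 < ρ := by positivity
  have hρ1 : ρ < 1 := by rw [hρ, div_lt_one (by positivity)]; linarith
  have hsρ := Real.sqrt_pos.2 hρ0
  have hsρ1 : Real.sqrt ρ < 1 := by rw [Real.sqrt_lt' one_pos]; simpa using hρ1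
  have hP : 0 < poincareConst d κ := by
    have : (0 : ℝ) < d := by exact_mod_cast hd
    unfold poincareConst; positivity
  -- The energy decays with ratio `ρ`, hence the norm with ratio `√ρ`, which fixes the rate. The
  -- defect uses the decay over `l - 1` layers only; the factor `(√ρ)⁻¹` compensates for the missing
  -- one.
  refine ⟨β * Real.sqrt C * (poincareConst d κ / α) * (Real.sqrt ρ)⁻¹, by positivity,
    -Real.log (Real.sqrt ρ), neg_pos.2 (Real.log_neg hsρ hsρ1), ?_⟩
  intro H hH T hT A hA G hG l hl
  have hex : ∀ v : L2 Ω, (∃! u, IsEnrichedCorrection T p A (patch T l (cell G)) G v u) ∧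
      (∃! u, IsEnrichedCorrection T p A Ω G v u) := fun v => by
    constructor
    · rw [patch_eq_biUnion]
      exact existsUnique_enrichedCorrection hT hA hα (layer_subset hG l) G v
    · simp only [isEnrichedCorrection_univ hΩ hT hA hα]
      exact existsUnique_enrichedCorrection hT hA hα Finset.Subset.rfl G v
  refine ⟨hex, fun v w hw => ?_⟩
  have hu : IsEnrichedCorrection T p A (patch T l (cell G)) G (fnOf v)
      (locCorrection T p A l G (fnOf v)) := Classical.epsilon_spec (hex (fnOf v)).1.exists
  have hu' : IsEnrichedCorrection T p A Ω G (fnOf v) (globCorrection T p A G (fnOf v)) :=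
    Classical.epsilon_spec (hex (fnOf v)).2.exists
  set u := locCorrection T p A l G (fnOf v)
  set u' := globCorrection T p A G (fnOf v)
  obtain ⟨m, rfl⟩ : ∃ m, l = m + 1 := ⟨l - 1, by omega⟩
  rw [patch_eq_biUnion] at hu
  rw [isEnrichedCorrection_univ hΩ hT hA hα] at hu'
  have hcut' : HasFineCutoff Ω T p C := hcut Ω hΩ H hH T hT
  -- The global correction enters only here: tested with `w`, its equation replaces `a(D_G v, w)` by
  -- minus the load, so that the error becomes the defect of the localized correction.
  have hglob := hu'.sum_cellForm hT hA hα hG Finset.Subset.rfl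
    ((hT.mem_fineSpaceOn Finset.Subset.rfl).2 ⟨hw, fun K hK hK' => absurd hK hK'⟩)
  rw [hA.energyOn_self hα hT, Finset.sum_congr rfl fun K hK => hA.cellForm_sub_left hα hT hK u u' w,
    Finset.sum_sub_distrib, hglob, sub_neg_eq_add, hT.gradNorm_cell hG, patch_eq_biUnion,
    hT.gradNorm_biUnion (layer_subset hG _)]
  have hdec := sum_energy_sdiff_layer_le hT hA hα hαβ hG hC hcut' hu m
  rw [← hρ] at hdec
  have hen := sqrt_sum_energy_le hT hA hα hG (layer_subset hG _) hu
  have hexp : Real.exp (-(-Real.log (Real.sqrt ρ)) * ((m + 1 : ℕ) : ℝ)) = Real.sqrt ρ ^ (m + 1) := by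
    rw [neg_neg, mul_comm, Real.exp_nat_mul, Real.exp_log hsρ]
  have hsq : Real.sqrt (∑ K ∈ T \ layer T G m, cellEnergy K u) ≤
      Real.sqrt ρ ^ m * (poincareConst d κ / α * H ^ 2 * Real.sqrt (cellEnergy G v)) := by
    calc _ ≤ Real.sqrt (ρ ^ m * ∑ K ∈ T, cellEnergy K u) := Real.sqrt_le_sqrt hdec
      _ = Real.sqrt ρ ^ m * Real.sqrt (∑ K ∈ T, cellEnergy K u) := by
        rw [Real.sqrt_mul (by positivity)]
        congr 1
        rw [← Real.sqrt_sq (pow_nonneg hsρ.le m), ← pow_mul, mul_comm m 2, pow_mul,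
          Real.sq_sqrt hρ0.le]
      _ ≤ _ := by gcongr
  refine (defect_le hT hA hα hαβ hG hC hcut' hu hw).trans ?_
  rw [hexp]
  calc _ ≤ β * Real.sqrt C * ((Real.sqrt ρ ^ m *
        (poincareConst d κ / α * H ^ 2 * Real.sqrt (cellEnergy G v))) *
        Real.sqrt (∑ K ∈ layer T G (m + 2), cellEnergy K w)) := by gcongr
    _ = _ := by
      rw [pow_succ]
      field_simp
      ring
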